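/- Let $\overline{\mathbb H}=\{z\in\mathbb C:\operatorname{Im} z\ge 0\}$, let $\alpha\in\mathbb C$ with $\operatorname{Im}\alpha\le 0$, let $U\subset\mathbb C$ be a simply connected domain containing $\overline{\mathbb H}\setminus\{\alpha\}$, and let $f:U\to\mathbb C$ be an injective holomorphic function such that $f(\overline{\mathbb H}\setminus\{\alpha\})$ is convex; write $f^{-1}:f(U)\to U$ for its inverse. Let $X_1,X_2,\dots$ be i.i.d. real-valued random variables that are continuous, that is, $P(X_1=x)=0$ for every $x\in\mathbb R$, and put $$M^f_n:=f^{-1}\Big(\frac1n\sum_{j=1}^n f(X_j)\Big),\qquad n\ge 1,$$ which is almost surely well defined. For a complex-valued random variable $Y\in L^2$ let $\operatorname{Var}(Y)=E\big[|Y-E[Y]|^2\big]$. Assume that $E\big[|f(X_1)|^2\big]<+\infty$, that $E[f(X_1)]\ne 0$, and that for some $\varepsilon_0>0$ $$\limsup_{n\to\infty}E\big[|M^f_n|^{2+\varepsilon_0}\big]<+\infty .$$ Then $E[f(X_1)]\in f(\overline{\mathbb H}\setminus\{\alpha\})$, $f'\big(f^{-1}(E[f(X_1)])\big)\neq 0$,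 $M^f_n\in L^2$ for all sufficiently large $n$, and $$\lim_{n\to\infty} n\operatorname{Var}(M^f_n)=\frac{\operatorname{Var}(f(X_1))}{\big|f'\big(f^{-1}(E[f(X_1)])\big)\big|^2}.$$ -/

import Mathlib

open MeasureTheory ProbabilityTheory Filter Topology
open scoped ENNReal

/-- The closed upper half-plane with the point `α` removed. -/
def puncturedClosedHalfPlane (α : ℂ) : Set ℂ := {z : ℂ | 0 ≤ z.im} \ {α}

/-- `f`, restricted to the simply connected domain `U`, is a generator with parameter `α`:
`Im α ≤ 0`, `U` contains the closed upper half-plane minus `α`, `f` is holomorphic and injective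
on `U`, and the image of the closed upper half-plane minus `α` is convex.
Only the values of `f` on `U` matter. -/
structure IsGenerator (α : ℂ) (U : Set ℂ) (f : ℂ → ℂ) : Prop where
  im_nonpos : α.im ≤ 0
  isOpen : IsOpen U
  simplyConnected : IsSimplyConnected U
  subset : puncturedClosedHalfPlane α ⊆ U
  holomorphic : DifferentiableOn ℂ f U
  injective : Set.InjOn f U
  convex_image : Convex ℝ (f '' puncturedClosedHalfPlane α)

/-- The quasi-arithmetic mean `f⁻¹ ((1 / n) ∑ f (X_j))` of the first `n` variables of the sequence
`X 0, X 1, …`, where `f⁻¹ : f(U) → U` is the inverse of the restriction of `f` to `U`. -/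
noncomputable def quasiArithmeticMean {Ω : Type*} (f : ℂ → ℂ) (U : Set ℂ) (X : ℕ → Ω → ℝ)
    (n : ℕ) (ω : Ω) : ℂ :=
  Function.invFunOn f U ((1 / (n : ℂ)) * ∑ j ∈ Finset.range n, f (X j ω : ℂ))

/-- The variance `E |Y - E Y|²` of a complex random variable `Y`. -/
noncomputable def complexVariance {Ω : Type*} [MeasurableSpace Ω] (Y : Ω → ℂ) (P : Measure Ω) :
    ℝ :=
  ∫ ω, ‖Y ω - ∫ ω', Y ω' ∂P‖ ^ 2 ∂P

/-! Write `W j = f (X j)`, `S n` for their mean, `m = E W 0`, `g = f⁻¹`, `M n = g (S n)`. By the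
delta method `M n = g m + g' m (S n - m) + R n`; the linear term contributes exactly `|g' m|² Var (W
0) / n`, so the point is `n E|R n|² → 0`. On `|S n - m| < δ` the remainder is small relative to `S n
- m`. The complement `A n` satisfies `n P(A n) → 0`, and there everything reduces to `n E[|M n|²; A
n] → 0` (`tendsto_tail`). Hölder and the `2 + ε₀` moments only give `n P(A n)^(ε₀/(2+ε₀))`, which
need not vanish, so the geometry of `f` enters through a dichotomy (`tendsto_or_hasMeanBound`).

(a) `f` has a finite limit `c` at infinity, outside the convex image. A large `|M n|` forces `S n`
near `c`. A real functional bounded below by its value at `c` on the range of `W` is strictly larger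
at `m` (`exists_separating`), so by Chernoff's bound for nonnegative variables this is exponentially
unlikely, and the `2 + ε₀` moments finish.

(b) Otherwise `f z₀ = ∑ w i f (z i)` implies `|z₀| ≤ C (1 + ∑ w i |z i|)` (`HasMeanBound`). Cutting
the sample into blocks of fixed length `k` dominates `|M n|` by an average of i.i.d.
square-integrable copies of `|M k|`, whose normalized squared deviation is uniformly integrable by
the central limit theorem.

The complex analysis behind this rests on one device. If `p` maps the half-plane into its image
under `f` and `p (iY) = f (iY)`, then `f⁻¹ ((1 - τ) f + τ p)` is a self-map fixing `iY`.
Schwarz–Pick with `Y → ∞`, differentiated at `τ = 0`, gives `Im ((p - f) / f') ≥ 0` in the limit.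
Constant `p` yields, after a rotation, `Re f' ≥ 0` in case (b); `p = f ∘ T` with a rotation `T`
about `iY` shows that `arg f'` increases to the right. The mean bound then comes from comparing two
growth rates of `f` from `ir`: at least `r |f' (ir)|` times a logarithm along a suitable segment, at
most `(|z| + r) |f' (ir)|` in general. -/

section Univalent

/-! ### Univalent functions and their inverses -/

variable {U : Set ℂ} {f : ℂ → ℂ}

theorem nhds_le_map_nhds_of_injOn (hU : IsOpen U) (hf : DifferentiableOn ℂ f U)
    (hinj : Set.InjOn f U) {z : ℂ} (hz : z ∈ U) : 𝓝 (f z) ≤ map f (𝓝 z) := by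
  have han : AnalyticAt ℂ f z := hf.analyticAt (hU.mem_nhds hz)
  rcases han.eventually_constant_or_nhds_le_map_nhds with h | h
  · exfalso
    have h2 : ∀ᶠ w in 𝓝[≠] z, f w = f z ∧ w ∈ U :=
      (h.and (hU.mem_nhds hz)).filter_mono nhdsWithin_le_nhds
    obtain ⟨w, ⟨hw, hwU⟩, hne⟩ := (h2.and self_mem_nhdsWithin).exists
    exact hne (hinj hwU hz hw)
  · exact h

theorem isOpen_image_of_injOn (hU : IsOpen U) (hf : DifferentiableOn ℂ f U)
    (hinj : Set.InjOn f U) {V : Set ℂ} (hV : IsOpen V) (hVU : V ⊆ U) : IsOpen (f '' V) := by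
  rw [isOpen_iff_mem_nhds]
  rintro _ ⟨z, hz, rfl⟩
  exact nhds_le_map_nhds_of_injOn hU hf hinj (hVU hz) (image_mem_map (hV.mem_nhds hz))

theorem invFunOn_apply (hinj : Set.InjOn f U) {z : ℂ} (hz : z ∈ U) :
    Function.invFunOn f U (f z) = z :=
  hinj.leftInvOn_invFunOn hz

theorem continuousAt_invFunOn (hU : IsOpen U) (hf : DifferentiableOn ℂ f U)
    (hinj : Set.InjOn f U) {z : ℂ} (hz : z ∈ U) :
    ContinuousAt (Function.invFunOn f U) (f z) := by
  rw [ContinuousAt, invFunOn_apply hinj hz]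
  intro N hN
  have h1 : f '' (N ∩ U) ∈ 𝓝 (f z) :=
    nhds_le_map_nhds_of_injOn hU hf hinj hz (image_mem_map (inter_mem hN (hU.mem_nhds hz)))
  refine mem_map.2 (mem_of_superset h1 ?_)
  rintro _ ⟨w, ⟨hwN, hwU⟩, rfl⟩
  rwa [Set.mem_preimage, invFunOn_apply hinj hwU]

theorem eventually_apply_invFunOn (hU : IsOpen U) (hf : DifferentiableOn ℂ f U)
    (hinj : Set.InjOn f U) {z : ℂ} (hz : z ∈ U) :
    ∀ᶠ w in 𝓝 (f z), f (Function.invFunOn f U w) = w := by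
  have h1 : f '' U ∈ 𝓝 (f z) :=
    (isOpen_image_of_injOn hU hf hinj hU subset_rfl).mem_nhds ⟨z, hz, rfl⟩
  filter_upwards [h1] with w hw
  exact Function.invFunOn_eq hw

theorem hasDerivAt_invFunOn_of_ne (hU : IsOpen U) (hf : DifferentiableOn ℂ f U)
    (hinj : Set.InjOn f U) {z : ℂ} (hz : z ∈ U) (h0 : deriv f z ≠ 0) :
    HasDerivAt (Function.invFunOn f U) (deriv f z)⁻¹ (f z) := by
  refine HasDerivAt.of_local_left_inverse (continuousAt_invFunOn hU hf hinj hz) ?_ h0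
    (eventually_apply_invFunOn hU hf hinj hz)
  rw [invFunOn_apply hinj hz]
  exact (hf.differentiableAt (hU.mem_nhds hz)).hasDerivAt

/-- An injective holomorphic function has non-vanishing derivative. -/
theorem deriv_ne_zero_of_injOn (hU : IsOpen U) (hf : DifferentiableOn ℂ f U)
    (hinj : Set.InjOn f U) {z : ℂ} (hz : z ∈ U) : deriv f z ≠ 0 := by
  have hd : AnalyticAt ℂ (deriv f) z := (hf.analyticAt (hU.mem_nhds hz)).deriv
  -- Zeros of `f'` are isolated: otherwise `f` would be constant on a ball.
  have hne : ∀ᶠ w in 𝓝[≠] z, deriv f w ≠ 0 := by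
    rcases hd.eventually_eq_zero_or_eventually_ne_zero with h | h
    · exfalso
      obtain ⟨r, hr, hball⟩ := Metric.eventually_nhds_iff_ball.1 (h.and (hU.mem_nhds hz))
      have hr2 : z + (r / 2 : ℝ) ∈ Metric.ball z r := by
        simp [abs_of_pos hr, hr]
      have hconst : f (z + (r / 2 : ℝ)) = f z := by
        refine (convex_ball z r).is_const_of_fderivWithin_eq_zero (𝕜 := ℂ) (f := f)
          (fun w hw => (hf.differentiableAt
            (hU.mem_nhds (hball w hw).2)).differentiableWithinAt) (fun w hw => ?_) hr2
          (Metric.mem_ball_self hr)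
        rw [fderivWithin_of_isOpen Metric.isOpen_ball hw]
        ext
        simp [(hball w hw).1]
      have := hinj (hball _ hr2).2 hz hconst
      simp [hr.ne'] at this
    · exact h
  -- The inverse is holomorphic off `f z` and continuous at `f z`, so the singularity is removable;
  -- the chain rule for `f⁻¹ ∘ f = id` then excludes `f' z = 0`.
  have hg : ∀ᶠ w in 𝓝[≠] (f z), DifferentiableAt ℂ (Function.invFunOn f U) w := by
    rw [eventually_nhdsWithin_iff] at hne ⊢
    have h1 : f '' {w | (w ∈ ({z} : Set ℂ)ᶜ → deriv f w ≠ 0) ∧ w ∈ U} ∈ 𝓝 (f z) :=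
      nhds_le_map_nhds_of_injOn hU hf hinj hz
        (image_mem_map (hne.and (hU.mem_nhds hz)))
    filter_upwards [h1]
    rintro _ ⟨w, ⟨hw, hwU⟩, rfl⟩ hwz
    refine (hasDerivAt_invFunOn_of_ne hU hf hinj hwU (hw ?_)).differentiableAt
    rintro rfl
    exact hwz rfl
  have hg2 : DifferentiableAt ℂ (Function.invFunOn f U) (f z) :=
    (Complex.analyticAt_of_differentiable_on_punctured_nhds_of_continuousAt hg
      (continuousAt_invFunOn hU hf hinj hz)).differentiableAt
  have hcomp : HasDerivAt (Function.invFunOn f U ∘ f)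
      (deriv (Function.invFunOn f U) (f z) * deriv f z) z :=
    hg2.hasDerivAt.comp z (hf.differentiableAt (hU.mem_nhds hz)).hasDerivAt
  have hid : Function.invFunOn f U ∘ f =ᶠ[𝓝 z] id := by
    filter_upwards [hU.mem_nhds hz] with w hw
    exact invFunOn_apply hinj hw
  have := hcomp.unique ((hasDerivAt_id z).congr_of_eventuallyEq hid)
  intro h0
  simp [h0] at this

theorem hasDerivAt_invFunOn (hU : IsOpen U) (hf : DifferentiableOn ℂ f U)
    (hinj : Set.InjOn f U) {z : ℂ} (hz : z ∈ U) :
    HasDerivAt (Function.invFunOn f U) (deriv f z)⁻¹ (f z) :=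
  hasDerivAt_invFunOn_of_ne hU hf hinj hz (deriv_ne_zero_of_injOn hU hf hinj hz)

end Univalent

/-! ### Half-planes and convex maps -/

/-- The open upper half-plane, as a subset of `ℂ`. -/
def upperHalf : Set ℂ := {z : ℂ | 0 < z.im}

theorem mem_upperHalf {z : ℂ} : z ∈ upperHalf ↔ 0 < z.im := Iff.rfl

theorem mem_punctured {α z : ℂ} : z ∈ puncturedClosedHalfPlane α ↔ 0 ≤ z.im ∧ z ≠ α := Iff.rfl

theorem isOpen_upperHalf : IsOpen upperHalf := isOpen_lt continuous_const Complex.continuous_im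

theorem convex_upperHalf : Convex ℝ upperHalf := convex_halfSpace_im_gt 0

/-- An injective holomorphic function with convex image of the closed upper half-plane minus `α`,
where `Im α ≤ 0`. -/
structure IsConvexMap (α : ℂ) (U : Set ℂ) (f : ℂ → ℂ) : Prop where
  im_nonpos : α.im ≤ 0
  isOpen : IsOpen U
  subset : puncturedClosedHalfPlane α ⊆ U
  holomorphic : DifferentiableOn ℂ f U
  injective : Set.InjOn f U
  convex_image : Convex ℝ (f '' puncturedClosedHalfPlane α)

theorem IsGenerator.isConvexMap {α : ℂ} {U : Set ℂ} {f : ℂ → ℂ} (h : IsGenerator α U f) :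
    IsConvexMap α U f :=
  ⟨h.im_nonpos, h.isOpen, h.subset, h.holomorphic, h.injective, h.convex_image⟩

namespace IsConvexMap

variable {α : ℂ} {U : Set ℂ} {f : ℂ → ℂ}

theorem upperHalf_subset_punctured (h : IsConvexMap α U f) :
    upperHalf ⊆ puncturedClosedHalfPlane α := by
  intro z hz
  rw [mem_upperHalf] at hz
  refine mem_punctured.2 ⟨hz.le, ?_⟩
  rintro rfl
  exact absurd h.im_nonpos (not_le.2 hz)

theorem upperHalf_subset (h : IsConvexMap α U f) : upperHalf ⊆ U :=
  h.upperHalf_subset_punctured.trans h.subset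

theorem ofReal_mem (x : ℝ) (hx : (x : ℂ) ≠ α) :
    (x : ℂ) ∈ puncturedClosedHalfPlane α := ⟨by simp, hx⟩

theorem ne_of_re_lt {x : ℝ} (hx : α.re < x) : (x : ℂ) ≠ α := by
  rintro rfl
  simp at hx

theorem differentiableAt (h : IsConvexMap α U f) {z : ℂ} (hz : z ∈ U) : DifferentiableAt ℂ f z :=
  h.holomorphic.differentiableAt (h.isOpen.mem_nhds hz)

theorem deriv_ne_zero (h : IsConvexMap α U f) {z : ℂ} (hz : z ∈ U) : deriv f z ≠ 0 :=
  deriv_ne_zero_of_injOn h.isOpen h.holomorphic h.injective hz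

theorem isOpen_image_upperHalf (h : IsConvexMap α U f) : IsOpen (f '' upperHalf) :=
  isOpen_image_of_injOn h.isOpen h.holomorphic h.injective isOpen_upperHalf h.upperHalf_subset

/-- This set is the interior of the convex image: if a real `z` went to an interior point, `f (z -
it)` would be attained in the closed half-plane for small `t > 0`, against injectivity on `U`. -/
theorem convex_image_upperHalf (h : IsConvexMap α U f) : Convex ℝ (f '' upperHalf) := by
  have hint : f '' upperHalf = interior (f '' puncturedClosedHalfPlane α) := by
    apply subset_antisymm
    · exact interior_maximal (Set.image_mono h.upperHalf_subset_punctured)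
        h.isOpen_image_upperHalf
    · intro w hw
      obtain ⟨z, hz, rfl⟩ := interior_subset hw
      rcases (mem_punctured.1 hz).1.lt_or_eq with h0 | h0
      · exact ⟨z, h0, rfl⟩
      exfalso
      have hzU := h.subset hz
      have hc : ContinuousAt f z := (h.differentiableAt hzU).continuousAt
      have hev : ∀ᶠ t : ℝ in 𝓝[>] 0, f (z - t * Complex.I) ∈ f '' puncturedClosedHalfPlane α ∧
          z - t * Complex.I ∈ U := by
        have ht : Tendsto (fun t : ℝ => z - t * Complex.I) (𝓝[>] 0) (𝓝 z) := by
          have : Continuous (fun t : ℝ => z - t * Complex.I) := by fun_prop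
          simpa using (this.tendsto 0).mono_left nhdsWithin_le_nhds
        exact ((hc.tendsto.comp ht).eventually (mem_interior_iff_mem_nhds.1 hw)).and
          (ht.eventually (h.isOpen.mem_nhds hzU))
      obtain ⟨t, ⟨⟨z', hz', he⟩, htU⟩, htpos⟩ := (hev.and self_mem_nhdsWithin).exists
      have := h.injective (h.subset hz') htU he
      have him : z'.im = -t := by rw [this]; simp [← h0]
      have h1 : 0 ≤ z'.im := hz'.1
      have h2 : (0 : ℝ) < t := htpos
      linarith
  rw [hint]
  exact h.convex_image.interior

theorem mem_closure_image (h : IsConvexMap α U f) {z : ℂ} (hz : z ∈ puncturedClosedHalfPlane α) :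
    f z ∈ closure (f '' upperHalf) := by
  have hc : ContinuousAt f z := (h.differentiableAt (h.subset hz)).continuousAt
  have ht : Tendsto (fun t : ℝ => z + t * Complex.I) (𝓝[>] 0) (𝓝 z) := by
    have : Continuous (fun t : ℝ => z + t * Complex.I) := by fun_prop
    simpa using (this.tendsto 0).mono_left nhdsWithin_le_nhds
  refine mem_closure_of_tendsto (hc.tendsto.comp ht) ?_
  filter_upwards [self_mem_nhdsWithin] with t htpos
  refine ⟨_, ?_, rfl⟩
  have h1 : 0 ≤ z.im := hz.1
  have h2 : (0 : ℝ) < t := htpos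
  rw [mem_upperHalf]
  simp
  linarith

theorem hasDerivAt_inv (h : IsConvexMap α U f) {z : ℂ} (hz : z ∈ U) :
    HasDerivAt (Function.invFunOn f U) (deriv f z)⁻¹ (f z) :=
  hasDerivAt_invFunOn h.isOpen h.holomorphic h.injective hz

theorem inv_apply (h : IsConvexMap α U f) {z : ℂ} (hz : z ∈ U) :
    Function.invFunOn f U (f z) = z := invFunOn_apply h.injective hz

theorem inv_mem (h : IsConvexMap α U f) {w : ℂ} (hw : w ∈ f '' upperHalf) :
    Function.invFunOn f U w ∈ upperHalf := by
  obtain ⟨z, hz, rfl⟩ := hw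
  rwa [h.inv_apply (h.upperHalf_subset hz)]

theorem inv_mem_punctured (h : IsConvexMap α U f) {w : ℂ}
    (hw : w ∈ f '' puncturedClosedHalfPlane α) :
    Function.invFunOn f U w ∈ puncturedClosedHalfPlane α := by
  obtain ⟨z, hz, rfl⟩ := hw
  rwa [h.inv_apply (h.subset hz)]

end IsConvexMap

/-! ### Schwarz–Pick and Harnack inequalities -/

section SchwarzPick

open ComplexConjugate

/-- The Schwarz–Pick inequality for self-maps of the upper half-plane. -/
theorem schwarzPick_upperHalf {Φ : ℂ → ℂ} (hd : DifferentiableOn ℂ Φ upperHalf)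
    (hm : Set.MapsTo Φ upperHalf upperHalf) {z w : ℂ} (hz : z ∈ upperHalf) (hw : w ∈ upperHalf) :
    ‖Φ z - Φ w‖ * ‖z - conj w‖ ≤ ‖z - w‖ * ‖Φ z - conj (Φ w)‖ := by
  have hsub : ∀ {a b : ℂ}, a ∈ upperHalf → b ∈ upperHalf → a - conj b ≠ 0 := by
    intro a b ha hb h0
    have := congrArg Complex.im h0
    rw [mem_upperHalf] at ha hb
    simp at this
    linarith
  have hcay : ∀ {a b : ℂ}, a ∈ upperHalf → b ∈ upperHalf → ‖(a - b) / (a - conj b)‖ < 1 := by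
    intro a b ha hb
    rw [norm_div, div_lt_one (norm_pos_iff.2 (hsub ha hb))]
    rw [← sq_lt_sq₀ (norm_nonneg _) (norm_nonneg _), ← Complex.normSq_eq_norm_sq,
      ← Complex.normSq_eq_norm_sq, Complex.normSq_apply, Complex.normSq_apply]
    rw [mem_upperHalf] at ha hb
    simp
    nlinarith [mul_pos ha hb]
  -- Inverse Cayley transform with `0 ↦ w`. Conjugating `Φ` by Cayley transforms gives a self-map
  -- `ψ` of the disc fixing `0`, to which Schwarz's lemma applies.
  let inv : ℂ → ℂ := fun ζ => (w - conj w * ζ) / (1 - ζ)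
  have hone : ∀ ζ ∈ Metric.ball (0 : ℂ) 1, (1 : ℂ) - ζ ≠ 0 := by
    intro ζ hζ h0
    rw [sub_eq_zero] at h0
    rw [← h0] at hζ
    simp at hζ
  have hinv : ∀ ζ ∈ Metric.ball (0 : ℂ) 1, inv ζ ∈ upperHalf := by
    intro ζ hζ
    have h1 := hone ζ hζ
    have hpos : 0 < Complex.normSq (1 - ζ) := Complex.normSq_pos.2 h1
    have hlt : Complex.normSq ζ < 1 := by
      rw [Complex.normSq_eq_norm_sq]
      have : ‖ζ‖ < 1 := by simpa using hζ
      nlinarith [norm_nonneg ζ]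
    rw [mem_upperHalf] at hw ⊢
    simp only [inv]
    rw [Complex.div_im, ← sub_div]
    apply div_pos _ hpos
    rw [Complex.normSq_apply] at hlt
    simp
    nlinarith
  let ψ : ℂ → ℂ := fun ζ => (Φ (inv ζ) - Φ w) / (Φ (inv ζ) - conj (Φ w))
  have hψd : DifferentiableOn ℂ ψ (Metric.ball 0 1) := by
    have h1 : DifferentiableOn ℂ inv (Metric.ball 0 1) := by
      apply DifferentiableOn.div
      · fun_prop
      · fun_prop
      · exact hone
    have h2 : DifferentiableOn ℂ (fun ζ => Φ (inv ζ)) (Metric.ball 0 1) := hd.comp h1 hinv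
    apply DifferentiableOn.div
    · exact h2.sub_const _
    · exact h2.sub_const _
    · intro ζ hζ
      exact hsub (hm (hinv ζ hζ)) (hm hw)
  have hψm : Set.MapsTo ψ (Metric.ball 0 1) (Metric.ball 0 1) := by
    intro ζ hζ
    simpa [ψ] using hcay (hm (hinv ζ hζ)) (hm hw)
  have hψ0 : ψ 0 = 0 := by simp [ψ, inv]
  have hζ : ‖(z - w) / (z - conj w)‖ < 1 := hcay hz hw
  have key := Complex.norm_le_norm_of_mapsTo_ball hψd
    (hψm.mono_right Metric.ball_subset_closedBall) hψ0 hζ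
  have hinvz : inv ((z - w) / (z - conj w)) = z := by
    have h1 := hsub hz hw
    have h2 := hsub hw hw
    have h3 : (1 : ℂ) - (z - w) / (z - conj w) ≠ 0 := by
      rw [one_sub_div h1]
      refine div_ne_zero ?_ h1
      convert h2 using 1
      ring
    simp only [inv]
    rw [div_eq_iff h3]
    field_simp
    ring
  simp only [ψ, hinvz, norm_div] at key
  rwa [div_le_div_iff₀ (norm_pos_iff.2 (hsub (hm hz) (hm hw)))
    (norm_pos_iff.2 (hsub hz hw))] at key

/-- The Schwarz–Pick inequality for self-maps of the upper half-plane fixing `iY`. -/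
theorem im_le_of_fixed {Φ : ℂ → ℂ} (hd : DifferentiableOn ℂ Φ upperHalf)
    (hm : Set.MapsTo Φ upperHalf upperHalf) {z : ℂ} (hz : z ∈ upperHalf) {Y : ℝ} (hY : 0 < Y)
    (hfix : Φ (Y * Complex.I) = Y * Complex.I) :
    z.im * (‖Φ z‖ ^ 2 + Y ^ 2) ≤ (Φ z).im * (‖z‖ ^ 2 + Y ^ 2) := by
  have h := schwarzPick_upperHalf hd hm hz (w := Y * Complex.I) (by simpa [mem_upperHalf] using hY)
  rw [hfix] at h
  -- After squaring, `‖u ± iY‖² = ‖u‖² + Y² ± 2 Y Im u` for `u = z` and `u = Φ z`; only the cross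
  -- terms survive.
  rw [← sq_le_sq₀ (by positivity) (by positivity), mul_pow, mul_pow] at h
  simp only [← Complex.normSq_eq_norm_sq, Complex.normSq_apply] at h ⊢
  simp at h
  nlinarith

/-- Harnack's inequality for holomorphic functions with positive real part. -/
theorem harnack_upperHalf {p : ℂ → ℂ} (hd : DifferentiableOn ℂ p upperHalf)
    (hm : ∀ z ∈ upperHalf, 0 < (p z).re) {z w : ℂ} (hz : z ∈ upperHalf) (hw : w ∈ upperHalf) :
    ‖p z - p w‖ * ‖z - conj w‖ ≤ ‖z - w‖ * (‖p z‖ + ‖p w‖) := by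
  have h := schwarzPick_upperHalf (Φ := fun z => Complex.I * p z) (hd.const_mul _)
    (fun z hz => by simpa [mem_upperHalf] using hm z hz) hz hw
  refine (le_of_eq ?_).trans (h.trans ?_)
  · simp [← mul_sub]
  · gcongr
    refine (norm_sub_le _ _).trans ?_
    simp

/-- Here `|z - w| / |z - conj w| = ρ = (t - s) / (t + s)`, and `(1 + ρ) / (1 - ρ) = t / s`. -/
theorem harnack_vertical {p : ℂ → ℂ} (hd : DifferentiableOn ℂ p upperHalf)
    (hm : ∀ z ∈ upperHalf, 0 < (p z).re) (x : ℝ) {s t : ℝ} (hs : 0 < s) (hst : s ≤ t) :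
    s * ‖p (x + s * Complex.I)‖ ≤ t * ‖p (x + t * Complex.I)‖ ∧
      s * ‖p (x + t * Complex.I)‖ ≤ t * ‖p (x + s * Complex.I)‖ := by
  have ht : 0 < t := hs.trans_le hst
  have h := harnack_upperHalf hd hm (z := x + s * Complex.I) (w := x + t * Complex.I)
    (by simpa [mem_upperHalf] using hs) (by simpa [mem_upperHalf] using ht)
  have e1 : ‖(x + s * Complex.I : ℂ) - conj (x + t * Complex.I : ℂ)‖ = s + t := by
    have : (x + s * Complex.I : ℂ) - conj (x + t * Complex.I : ℂ) = (s + t : ℝ) * Complex.I := by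
      simp
      ring
    rw [this, norm_mul, Complex.norm_I, mul_one, Complex.norm_real, Real.norm_eq_abs,
      abs_of_pos (by positivity)]
  have e2 : ‖(x + s * Complex.I : ℂ) - (x + t * Complex.I : ℂ)‖ = t - s := by
    have : (x + s * Complex.I : ℂ) - (x + t * Complex.I : ℂ) = (s - t : ℝ) * Complex.I := by
      push_cast
      ring
    rw [this, norm_mul, Complex.norm_I, mul_one, Complex.norm_real, Real.norm_eq_abs,
      abs_of_nonpos (by linarith)]
    ring
  rw [e1, e2] at h
  have h1 := norm_sub_norm_le (p (x + s * Complex.I)) (p (x + t * Complex.I))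
  have h2 := norm_sub_norm_le (p (x + t * Complex.I)) (p (x + s * Complex.I))
  rw [norm_sub_rev] at h2
  have hp : 0 < s + t := by positivity
  constructor <;> nlinarith

/-- For `|x - x'| ≤ 2y` the ratio `|z - w| / |z - conj w|` is at most `1/√2 < 5/7`, and `(1 + 5/7) /
(1 - 5/7) = 6`. -/
theorem harnack_horizontal {p : ℂ → ℂ} (hd : DifferentiableOn ℂ p upperHalf)
    (hm : ∀ z ∈ upperHalf, 0 < (p z).re) {x x' y : ℝ} (hy : 0 < y) (hx : |x - x'| ≤ 2 * y) :
    ‖p (x + y * Complex.I)‖ ≤ 6 * ‖p (x' + y * Complex.I)‖ := by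
  have h := harnack_upperHalf hd hm (z := x + y * Complex.I) (w := x' + y * Complex.I)
    (by simpa [mem_upperHalf] using hy) (by simpa [mem_upperHalf] using hy)
  have e : 7 * ‖(x + y * Complex.I : ℂ) - (x' + y * Complex.I : ℂ)‖ ≤
      5 * ‖(x + y * Complex.I : ℂ) - conj (x' + y * Complex.I : ℂ)‖ := by
    rw [← sq_le_sq₀ (by positivity) (by positivity), mul_pow, mul_pow]
    simp only [← Complex.normSq_eq_norm_sq, Complex.normSq_apply]
    simp
    have := abs_le.1 hx
    nlinarith
  have h1 := norm_sub_norm_le (p (x + y * Complex.I)) (p (x' + y * Complex.I))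
  have hpos : 0 < ‖(x + y * Complex.I : ℂ) - conj (x' + y * Complex.I : ℂ)‖ := by
    rw [norm_pos_iff]
    intro h0
    have := congrArg Complex.im h0
    simp at this
    linarith
  set A := ‖p (x + y * Complex.I)‖
  set B := ‖p (x' + y * Complex.I)‖
  set D := ‖(x + y * Complex.I : ℂ) - conj (x' + y * Complex.I : ℂ)‖
  have hA : 0 ≤ A := norm_nonneg _
  have hB : 0 ≤ B := norm_nonneg _
  have h3 : 7 * ((A - B) * D) ≤ 5 * D * (A + B) := by nlinarith
  have h4 : 7 * (A - B) ≤ 5 * (A + B) := by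
    by_contra! hcon
    nlinarith
  linarith

end SchwarzPick

/-! ### Phragmén–Lindelöf with an exceptional point -/

section PhragmenLindelof

/-- A Phragmén–Lindelöf principle on the right half-plane for bounded functions, with one
exceptional boundary point. -/
theorem norm_le_of_bounded_of_exceptional {G : ℂ → ℂ} {q : ℝ} {A B : ℝ} (hA : 0 < A)
    (hd : DifferentiableOn ℂ G {s : ℂ | 0 < s.re})
    (hc : ∀ s : ℂ, 0 ≤ s.re → s ≠ q * Complex.I → ContinuousWithinAt G {s : ℂ | 0 ≤ s.re} s)
    (hB : ∀ s : ℂ, 0 ≤ s.re → s ≠ q * Complex.I → ‖G s‖ ≤ B)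
    (hA' : ∀ y : ℝ, y ≠ q → ‖G (y * Complex.I)‖ ≤ A) {s : ℂ} (hs : 0 < s.re) : ‖G s‖ ≤ A := by
  -- `b` vanishes at the exceptional point and `|b| ≤ 1`, so `G ^ n * b` extends continuously by `0`
  -- there.
  set b : ℂ → ℂ := fun s => (s - q * Complex.I) / (s - q * Complex.I + 1) with hb
  have hden : ∀ s : ℂ, 0 ≤ s.re → s - q * Complex.I + 1 ≠ 0 := by
    intro s hs h0
    have := congrArg Complex.re h0
    simp at this
    linarith
  have hb1 : ∀ s : ℂ, 0 ≤ s.re → ‖b s‖ ≤ 1 := by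
    intro s hs
    rw [hb, norm_div, div_le_one (norm_pos_iff.2 (hden s hs)),
      ← sq_le_sq₀ (norm_nonneg _) (norm_nonneg _)]
    simp only [← Complex.normSq_eq_norm_sq, Complex.normSq_apply]
    simp
    nlinarith
  have hbd : ∀ s : ℂ, 0 ≤ s.re → DifferentiableAt ℂ b s := by
    intro s hs
    apply DifferentiableAt.div
    · fun_prop
    · fun_prop
    · exact hden s hs
  have hbne : b s ≠ 0 := by
    refine div_ne_zero ?_ (hden s hs.le)
    intro h0
    have := congrArg Complex.re h0
    simp at this
    linarith
  have hcl : closure {s : ℂ | 0 < s.re} = {s : ℂ | 0 ≤ s.re} := Complex.closure_setOfPred_lt_re 0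
  have hB0 : 0 ≤ B := (norm_nonneg _).trans (hB s hs.le (fun h => by simp [h] at hs))
  -- The power makes the auxiliary factor harmless: taking `n`-th roots as `n → ∞` removes `b`.
  have main : ∀ n : ℕ, ‖G s‖ ^ n * ‖b s‖ ≤ A ^ n := by
    intro n
    let F : ℂ → ℂ := fun s => if s = q * Complex.I then 0 else G s ^ n * b s
    have hFb : ∀ s : ℂ, 0 ≤ s.re → ‖F s‖ ≤ B ^ n * ‖b s‖ := by
      intro s hs
      simp only [F]
      split_ifs with h
      · simp
        positivity
      · rw [norm_mul, norm_pow]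
        gcongr
        exact hB s hs h
    have hFc : ContinuousOn F {s : ℂ | 0 ≤ s.re} := by
      intro s hs
      have hs' : 0 ≤ s.re := hs
      by_cases h : s = q * Complex.I
      · rw [ContinuousWithinAt]
        have hF0 : F s = 0 := by simp [F, h]
        rw [hF0]
        apply squeeze_zero_norm' (a := fun s => B ^ n * ‖b s‖)
        · filter_upwards [self_mem_nhdsWithin] with t ht
          exact hFb t ht
        · have : ContinuousAt (fun s => B ^ n * ‖b s‖) s :=
            continuousAt_const.mul (hbd s hs').continuousAt.norm
          have h2 := this.tendsto.mono_left (nhdsWithin_le_nhds (s := {s : ℂ | 0 ≤ s.re}))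
          simpa [hb, h] using h2
      · have h1 : ContinuousWithinAt (fun s => G s ^ n * b s) {s : ℂ | 0 ≤ s.re} s :=
          ((hc s hs' h).pow n).mul (hbd s hs').continuousAt.continuousWithinAt
        refine h1.congr_of_eventuallyEq ?_ (by simp [F, h])
        have : ∀ᶠ t in 𝓝 s, t ≠ q * Complex.I := isOpen_ne.mem_nhds h
        filter_upwards [nhdsWithin_le_nhds this] with t ht
        simp [F, ht]
    have hFd : DiffContOnCl ℂ F {s : ℂ | 0 < s.re} := by
      refine ⟨?_, by rwa [hcl]⟩
      have h1 : DifferentiableOn ℂ (fun s => G s ^ n * b s) {s : ℂ | 0 < s.re} :=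
        (hd.pow n).mul fun s hs => (hbd s (le_of_lt (show 0 < s.re from hs))).differentiableWithinAt
      refine h1.congr fun t ht => ?_
      have ht' : 0 < t.re := ht
      have : t ≠ q * Complex.I := by
        rintro rfl
        simp at ht'
      simp [F, this]
    have hle : ∀ s : ℂ, 0 ≤ s.re → ‖F s‖ ≤ B ^ n := fun s hs =>
      (hFb s hs).trans (mul_le_of_le_one_right (by positivity) (hb1 s hs))
    have hres := PhragmenLindelof.right_half_plane_of_bounded_on_real (C := A ^ n) hFd
      ⟨1, by norm_num, 0, by
        refine Asymptotics.IsBigO.of_bound (B ^ n) ?_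
        refine eventually_inf_principal.2 (Eventually.of_forall fun t ht => ?_)
        simpa using hle t (le_of_lt (show 0 < t.re from ht))⟩
      ⟨B ^ n, by
        rw [eventually_map]
        filter_upwards [eventually_ge_atTop 0] with x hx
        exact hle x (by simpa using hx)⟩
      (fun y => by
        simp only [F]
        split_ifs with h
        · simp
          positivity
        · rw [norm_mul, norm_pow]
          have hy : y ≠ q := by
            rintro rfl
            exact h rfl
          exact (mul_le_of_le_one_right (by positivity) (hb1 _ (by simp))).trans
            (pow_le_pow_left₀ (norm_nonneg _) (hA' y hy) n)) hs.le
    have hne : s ≠ q * Complex.I := by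
      rintro rfl
      simp at hs
    simpa [F, hne] using hres
  by_contra! hcon
  have hr : 1 < ‖G s‖ / A := (one_lt_div hA).2 hcon
  obtain ⟨n, hn⟩ := pow_unbounded_of_one_lt (‖b s‖)⁻¹ hr
  have h1 := main n
  have hbp : 0 < ‖b s‖ := norm_pos_iff.2 hbne
  rw [div_pow, lt_div_iff₀ (by positivity), inv_mul_lt_iff₀ hbp] at hn
  linarith

end PhragmenLindelof

/-! ### Symmetries, and convexity through Schwarz–Pick at infinity -/

open ComplexConjugate in
/-- The reflection `z ↦ -conj (f (-conj z))` of `f` in the imaginary axis. -/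
def reflectMap (f : ℂ → ℂ) (z : ℂ) : ℂ := -conj (f (-conj z))

namespace IsConvexMap

variable {α : ℂ} {U : Set ℂ} {f : ℂ → ℂ}

open ComplexConjugate

theorem neg_conj_mem_punctured {z : ℂ} :
    -conj z ∈ puncturedClosedHalfPlane α ↔ z ∈ puncturedClosedHalfPlane (-conj α) := by
  rw [mem_punctured, mem_punctured]
  have : -conj z = α ↔ z = -conj α := by
    constructor
    · rintro rfl
      simp
    · rintro rfl
      simp
  simp [this]

theorem hasDerivAt_reflectMap {f' z : ℂ} (hf : HasDerivAt f f' (-conj z)) :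
    HasDerivAt (reflectMap f) (conj f') z := by
  have h1 := hf.conj_conj
  have h2 : conj (-conj z) = -z := by simp
  rw [h2] at h1
  have h3 := (h1.scomp z (hasDerivAt_neg z)).neg
  have e : reflectMap f = -((conj ∘ f ∘ conj) ∘ Neg.neg) := by
    ext w
    simp [reflectMap]
  rw [e]
  simpa using h3

/-- Transfers estimates between the right and left halves of the half-plane. -/
theorem reflect (h : IsConvexMap α U f) :
    IsConvexMap (-conj α) {z | -conj z ∈ U} (reflectMap f) where
  im_nonpos := by simpa using h.im_nonpos
  isOpen := h.isOpen.preimage (by fun_prop)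
  subset := fun z hz => h.subset (neg_conj_mem_punctured.2 hz)
  holomorphic := fun z hz =>
    (hasDerivAt_reflectMap
      (h.differentiableAt hz).hasDerivAt).differentiableAt.differentiableWithinAt
  injective := by
    intro z hz w hw he
    have := h.injective hz hw ((starRingEnd ℂ).injective (neg_injective he))
    exact (starRingEnd ℂ).injective (neg_injective this)
  convex_image := by
    have e : reflectMap f '' puncturedClosedHalfPlane (-conj α) =
        (-Complex.conjLIE.toLinearEquiv.toLinearMap : ℂ →ₗ[ℝ] ℂ) ''
          (f '' puncturedClosedHalfPlane α) := by
      ext w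
      constructor
      · rintro ⟨z, hz, rfl⟩
        exact ⟨_, ⟨_, neg_conj_mem_punctured.2 hz, rfl⟩, by simp [reflectMap]⟩
      · rintro ⟨_, ⟨z, hz, rfl⟩, rfl⟩
        refine ⟨-conj z, ?_, by simp [reflectMap]⟩
        rw [← neg_conj_mem_punctured]
        simpa using hz
    rw [e]
    exact h.convex_image.linear_image _

theorem deriv_reflectMap (h : IsConvexMap α U f) {z : ℂ} (hz : -conj z ∈ U) :
    deriv (reflectMap f) z = conj (deriv f (-conj z)) :=
  (hasDerivAt_reflectMap (h.differentiableAt hz).hasDerivAt).deriv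

theorem smul (h : IsConvexMap α U f) {e : ℂ} (he : e ≠ 0) :
    IsConvexMap α U (fun z => e * f z) where
  im_nonpos := h.im_nonpos
  isOpen := h.isOpen
  subset := h.subset
  holomorphic := h.holomorphic.const_mul e
  injective := fun z hz w hw hzw => h.injective hz hw (mul_left_cancel₀ he hzw)
  convex_image := by
    have e : (fun z => e * f z) '' puncturedClosedHalfPlane α =
        (LinearMap.mulLeft ℝ e) '' (f '' puncturedClosedHalfPlane α) := by
      rw [Set.image_image]
      rfl
    rw [e]
    exact h.convex_image.linear_image _

theorem mixture_mem (h : IsConvexMap α U f) {z w : ℂ} (hz : z ∈ upperHalf)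
    (hw : w ∈ f '' upperHalf) {τ : ℝ} (h0 : 0 ≤ τ) (h1 : τ ≤ 1) :
    f z + τ * (w - f z) ∈ f '' upperHalf := by
  have := h.convex_image_upperHalf.add_smul_sub_mem ⟨z, hz, rfl⟩ hw ⟨h0, h1⟩
  simpa using this

/-- Convexity of the image makes `f⁻¹ ((1 - τ) f + τ p)` a self-map of the half-plane, and it fixes
`iY` because `p` and `f` agree there. -/
theorem im_le_inv_mixture (h : IsConvexMap α U f) {p : ℂ → ℂ}
    (hp : DifferentiableOn ℂ p upperHalf) (hm : Set.MapsTo p upperHalf (f '' upperHalf))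
    {Y : ℝ} (hY : 0 < Y) (hfix : p (Y * Complex.I) = f (Y * Complex.I)) {z : ℂ}
    (hz : z ∈ upperHalf) {τ : ℝ} (h0 : 0 ≤ τ) (h1 : τ ≤ 1) :
    z.im * (‖Function.invFunOn f U (f z + τ * (p z - f z))‖ ^ 2 + Y ^ 2) ≤
      (Function.invFunOn f U (f z + τ * (p z - f z))).im * (‖z‖ ^ 2 + Y ^ 2) := by
  have hmem : ∀ z ∈ upperHalf, f z + τ * (p z - f z) ∈ f '' upperHalf :=
    fun z hz => h.mixture_mem hz (hm hz) h0 h1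
  refine im_le_of_fixed (Φ := fun z => Function.invFunOn f U (f z + τ * (p z - f z)))
    ?_ (fun z hz => h.inv_mem (hmem z hz)) hz hY ?_
  · intro z hz
    obtain ⟨w, hw, hwe⟩ := hmem z hz
    have hg : DifferentiableAt ℂ (Function.invFunOn f U) (f z + τ * (p z - f z)) := by
      rw [← hwe]
      exact (h.hasDerivAt_inv (h.upperHalf_subset hw)).differentiableAt
    have hfz := h.differentiableAt (h.upperHalf_subset hz)
    have hpz := hp.differentiableAt (isOpen_upperHalf.mem_nhds hz)
    exact (hg.comp z (hfz.add ((hpz.sub hfz).const_mul _))).differentiableWithinAt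
  · simp only [hfix, sub_self, mul_zero, add_zero]
    exact h.inv_apply (h.upperHalf_subset (by simpa [mem_upperHalf] using hY))

/-- The curve `τ ↦ f⁻¹ (f z + τ d)` starts at `z` with velocity `d / f' z`; if it never goes below
`z`, its velocity does not point downwards. -/
theorem im_div_deriv_nonneg (h : IsConvexMap α U f) {z d : ℂ} (hz : z ∈ U)
    (hev : ∀ᶠ τ : ℝ in 𝓝[>] 0, z.im ≤ (Function.invFunOn f U (f z + τ * d)).im) :
    0 ≤ (d / deriv f z).im := by
  have h1 : HasDerivAt (fun τ : ℝ => Function.invFunOn f U (f z + τ * d))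
      ((deriv f z)⁻¹ * d) 0 := by
    have h2 : HasDerivAt (fun τ : ℝ => f z + τ * d) d 0 := by
      have := ((hasDerivAt_id (0 : ℝ)).ofReal_comp.mul_const d).const_add (f z)
      simpa using this
    have h3 : HasDerivAt (Function.invFunOn f U) (deriv f z)⁻¹ (f z + (0 : ℝ) * d) := by
      simpa using h.hasDerivAt_inv hz
    exact h3.comp (0 : ℝ) h2
  have h4 : HasDerivAt (fun τ : ℝ => (Function.invFunOn f U (f z + τ * d)).im)
      ((deriv f z)⁻¹ * d).im 0 := Complex.imCLM.hasFDerivAt.comp_hasDerivAt (0 : ℝ) h1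
  have h5 := hasDerivAt_iff_tendsto_slope.1 h4
  rw [show d / deriv f z = (deriv f z)⁻¹ * d by ring]
  refine ge_of_tendsto (h5.mono_left (nhdsWithin_mono (0 : ℝ) (s := Set.Ioi 0) ?_)) ?_
  · intro t ht
    exact ne_of_gt (show (0 : ℝ) < t from ht)
  · filter_upwards [hev, self_mem_nhdsWithin] with τ hτ hpos
    have hpos' : (0 : ℝ) < τ := hpos
    rw [slope_def_field]
    simp only [Complex.ofReal_zero, zero_mul, add_zero, sub_zero]
    rw [h.inv_apply hz]
    exact div_nonneg (by linarith) hpos'.le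

/-- Dividing the Schwarz–Pick inequality by `Y²` and letting `Y → ∞` leaves `Im z ≤ Im f⁻¹ (f z + τ
d₀)`: only the limiting displacement matters. -/
theorem im_div_deriv_nonneg_of_tendsto (h : IsConvexMap α U f) {ι : Type*} {l : Filter ι}
    [l.NeBot] {Y : ι → ℝ} {d : ι → ℂ} {d₀ z : ℂ} (hz : z ∈ upperHalf) (hY : Tendsto Y l atTop)
    (hd : Tendsto d l (𝓝 d₀))
    (hpush : ∀ τ : ℝ, 0 ≤ τ → τ ≤ 1 → ∀ᶠ k in l,
      z.im * (‖Function.invFunOn f U (f z + τ * d k)‖ ^ 2 + Y k ^ 2) ≤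
        (Function.invFunOn f U (f z + τ * d k)).im * (‖z‖ ^ 2 + Y k ^ 2)) :
    0 ≤ (d₀ / deriv f z).im := by
  have hzU := h.upperHalf_subset hz
  apply h.im_div_deriv_nonneg hzU
  have hmem : ∀ᶠ τ : ℝ in 𝓝[>] 0, f z + τ * d₀ ∈ f '' upperHalf := by
    have hc : Continuous (fun τ : ℝ => f z + τ * d₀) := by fun_prop
    have ht : Tendsto (fun τ : ℝ => f z + τ * d₀) (𝓝[>] 0) (𝓝 (f z)) := by
      simpa using (hc.tendsto 0).mono_left nhdsWithin_le_nhds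
    exact ht.eventually (h.isOpen_image_upperHalf.mem_nhds ⟨z, hz, rfl⟩)
  have hle : ∀ᶠ τ : ℝ in 𝓝[>] 0, τ ≤ 1 :=
    nhdsWithin_le_nhds (eventually_le_nhds one_pos)
  filter_upwards [hmem, hle, self_mem_nhdsWithin] with τ hτ h1 hpos
  have h0 : (0 : ℝ) ≤ τ := le_of_lt hpos
  obtain ⟨w, hw, hwe⟩ := hτ
  have hg : ContinuousAt (Function.invFunOn f U) (f z + τ * d₀) := by
    rw [← hwe]
    exact (h.hasDerivAt_inv (h.upperHalf_subset hw)).continuousAt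
  have hc : Tendsto (fun k => Function.invFunOn f U (f z + τ * d k)) l
      (𝓝 (Function.invFunOn f U (f z + τ * d₀))) :=
    hg.tendsto.comp ((hd.const_mul _).const_add _)
  have hY2 : Tendsto (fun k => (Y k ^ 2)⁻¹) l (𝓝 0) :=
    ((tendsto_pow_atTop two_ne_zero).comp hY).inv_tendsto_atTop
  have hl : Tendsto (fun k => z.im *
      (‖Function.invFunOn f U (f z + τ * d k)‖ ^ 2 * (Y k ^ 2)⁻¹ + 1)) l (𝓝 z.im) := by
    have := (((hc.norm.pow 2).mul hY2).add_const 1).const_mul z.im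
    simpa using this
  have hr : Tendsto (fun k => (Function.invFunOn f U (f z + τ * d k)).im *
      (‖z‖ ^ 2 * (Y k ^ 2)⁻¹ + 1)) l (𝓝 (Function.invFunOn f U (f z + τ * d₀)).im) := by
    have := ((Complex.continuous_im.tendsto _).comp hc).mul
      ((hY2.const_mul (‖z‖ ^ 2)).add_const 1)
    simpa using this
  refine le_of_tendsto_of_tendsto hl hr ?_
  filter_upwards [hpush τ h0 h1, hY.eventually_gt_atTop 0] with k hk hYk
  have h2 : 0 < Y k ^ 2 := by positivity
  have h3 := mul_le_mul_of_nonneg_right hk (inv_nonneg.2 h2.le)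
  convert h3 using 1 <;> field_simp

/-- The direction in which `f` tends along the imaginary axis. -/
theorem im_div_deriv_nonneg_of_axis (h : IsConvexMap α U f) {Y t : ℕ → ℝ} {d₀ z : ℂ}
    (hz : z ∈ upperHalf) (hY : Tendsto Y atTop atTop) (ht0 : ∀ᶠ k in atTop, 0 ≤ t k)
    (ht1 : ∀ᶠ k in atTop, t k ≤ 1)
    (hd : Tendsto (fun k => t k * (f (Y k * Complex.I) - f z)) atTop (𝓝 d₀)) :
    0 ≤ (d₀ / deriv f z).im := by
  refine h.im_div_deriv_nonneg_of_tendsto hz hY hd fun τ h0 h1 => ?_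
  filter_upwards [hY.eventually_gt_atTop 0, ht0, ht1] with k hYk h2 h3
  have hmem : (Y k * Complex.I : ℂ) ∈ upperHalf := by simpa [mem_upperHalf] using hYk
  -- Constant `p`, with `t k` absorbed into the mixture parameter; this rescaling is what allows `f
  -- (iY)` to be unbounded.
  have := h.im_le_inv_mixture (p := fun _ => f (Y k * Complex.I)) (differentiableOn_const _)
    (fun w _ => ⟨_, hmem, rfl⟩) hYk rfl hz (τ := τ * t k) (mul_nonneg h0 h2)
    (mul_le_one₀ h1 h2 h3)
  simpa [mul_assoc] using this

/-- Convexity of the images of horizontal lines. -/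
theorem im_sub_div_deriv_nonneg (h : IsConvexMap α U f) {z : ℂ} (hz : z ∈ upperHalf) (a : ℝ) :
    0 ≤ ((f (z + a) - f z) / deriv f z).im := by
  -- The hyperbolic rotation about `iY` taking `0` to `a`; as `Y → ∞` it tends to the translation by
  -- `a`.
  let T : ℝ → ℂ → ℂ := fun Y z => (z + a) / (1 - a * z / (Y ^ 2 : ℝ))
  have hT : ∀ Y : ℝ, 0 < Y → ∀ z ∈ upperHalf, (1 - a * z / (Y ^ 2 : ℝ) : ℂ) ≠ 0 ∧
      T Y z ∈ upperHalf := by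
    intro Y hY z hz
    rw [mem_upperHalf] at hz
    have hne : (1 - a * z / (Y ^ 2 : ℝ) : ℂ) ≠ 0 := by
      intro h0
      have him := congrArg Complex.im h0
      have hre := congrArg Complex.re h0
      simp only [Complex.sub_im, Complex.one_im, Complex.div_ofReal_im, Complex.sub_re,
        Complex.one_re, Complex.div_ofReal_re, Complex.mul_im, Complex.mul_re,
        Complex.ofReal_re, Complex.ofReal_im, Complex.zero_im, Complex.zero_re, zero_mul,
        sub_zero, add_zero, zero_sub, neg_eq_zero, div_eq_zero_iff] at him hre
      rcases him with h1 | h1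
      · rcases mul_eq_zero.1 h1 with h2 | h2
        · simp [h2] at hre
        · exact hz.ne' h2
      · exact (pow_pos hY 2).ne' h1
    refine ⟨hne, ?_⟩
    rw [mem_upperHalf]
    have hpos : 0 < Complex.normSq (1 - a * z / (Y ^ 2 : ℝ)) := Complex.normSq_pos.2 hne
    simp only [T]
    rw [Complex.div_im, ← sub_div]
    apply div_pos _ hpos
    simp only [Complex.sub_im, Complex.one_im, Complex.div_ofReal_im, Complex.sub_re,
        Complex.one_re, Complex.div_ofReal_re, Complex.mul_im, Complex.mul_re,
        Complex.ofReal_re, Complex.ofReal_im, zero_mul, Complex.add_im, Complex.add_re,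
        sub_zero, add_zero, zero_sub]
    have hY2 : 0 < Y ^ 2 := by positivity
    have : z.im * (1 - a * z.re / Y ^ 2) - (z.re + a) * -(a * z.im / Y ^ 2) =
        z.im * (1 + a ^ 2 / Y ^ 2) := by
      field_simp
      ring
    rw [this]
    positivity
  have hYlim : Tendsto (fun Y : ℝ => T Y z) atTop (𝓝 (z + a)) := by
    have hY2 : Tendsto (fun Y : ℝ => ((Y ^ 2 : ℝ) : ℂ)⁻¹) atTop (𝓝 0) := by
      have h1 : Tendsto (fun Y : ℝ => (Y ^ 2)⁻¹) atTop (𝓝 0) :=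
        (tendsto_pow_atTop two_ne_zero).inv_tendsto_atTop
      have h2 := (Complex.continuous_ofReal.tendsto 0).comp h1
      simpa [Function.comp_def] using h2
    have h1 : Tendsto (fun Y : ℝ => (1 - a * z / (Y ^ 2 : ℝ) : ℂ)) atTop (𝓝 1) := by
      have := (hY2.const_mul (a * z)).const_sub 1
      simpa [div_eq_mul_inv] using this
    have := (tendsto_const_nhds (x := z + a)).div h1 one_ne_zero
    rwa [div_one] at this
  have hza : z + a ∈ upperHalf := by simpa [mem_upperHalf] using hz
  have hfc : ContinuousAt f (z + a) := (h.differentiableAt (h.upperHalf_subset hza)).continuousAt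
  refine h.im_div_deriv_nonneg_of_tendsto hz tendsto_id
    (d := fun Y => f (T Y z) - f z) ((hfc.tendsto.comp hYlim).sub_const _) fun τ h0 h1 => ?_
  filter_upwards [eventually_gt_atTop 0] with Y hY
  refine h.im_le_inv_mixture (p := fun z => f (T Y z)) ?_ (fun w hw => ⟨_, (hT Y hY w hw).2, rfl⟩)
    hY ?_ hz h0 h1
  · intro w hw
    have h2 := hT Y hY w hw
    have h3 : DifferentiableAt ℂ (T Y) w := by
      apply DifferentiableAt.div
      · fun_prop
      · fun_prop
      · exact h2.1
    exact ((h.differentiableAt (h.upperHalf_subset h2.2)).comp w h3).differentiableWithinAt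
  · have h2 := (hT Y hY (Y * Complex.I) (by simpa [mem_upperHalf] using hY)).1
    have h3 : T Y (Y * Complex.I) = Y * Complex.I := by
      simp only [T]
      rw [div_eq_iff h2]
      have : (Y : ℂ) ≠ 0 := by exact_mod_cast hY.ne'
      push_cast
      field_simp
      ring_nf
      simp
    rw [h3]

/-- The supporting line of the image at a real boundary point. -/
theorem im_sub_div_deriv_nonneg_of_boundary (h : IsConvexMap α U f) {z w : ℂ}
    (hz : z ∈ puncturedClosedHalfPlane α) (hz0 : z.im = 0)
    (hw : w ∈ puncturedClosedHalfPlane α) : 0 ≤ ((f w - f z) / deriv f z).im := by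
  apply h.im_div_deriv_nonneg (h.subset hz)
  have hle : ∀ᶠ τ : ℝ in 𝓝[>] 0, τ ≤ 1 :=
    nhdsWithin_le_nhds (eventually_le_nhds one_pos)
  filter_upwards [hle, self_mem_nhdsWithin] with τ h1 hpos
  have h0 : (0 : ℝ) ≤ τ := le_of_lt hpos
  have := h.convex_image.add_smul_sub_mem ⟨z, hz, rfl⟩ ⟨w, hw, rfl⟩ ⟨h0, h1⟩
  rw [hz0]
  exact (mem_punctured.1 (h.inv_mem_punctured (by simpa using this))).1

end IsConvexMap

/-! ### Auxiliary calculus -/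

/-- Real part of Cauchy's theorem on a rectangle. -/
theorem integral_re_rect {F : ℂ → ℂ} {a b s t : ℝ} (hab : a ≤ b) (hst : s ≤ t)
    (hc : ∀ x ∈ Set.Icc a b, ∀ y ∈ Set.Icc s t, ContinuousAt F (x + y * Complex.I))
    (hd : ∀ x ∈ Set.Ioo a b, ∀ y ∈ Set.Ioo s t, DifferentiableAt ℂ F (x + y * Complex.I)) :
    ∫ x in a..b, (F (x + s * Complex.I)).re = (∫ x in a..b, (F (x + t * Complex.I)).re) +
      ∫ y in s..t, ((F (b + y * Complex.I)).im - (F (a + y * Complex.I)).im) := by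
  have hz : ∀ z : ℂ, z = z.re + z.im * Complex.I := fun z => (Complex.re_add_im z).symm
  have key := Complex.integral_boundary_rect_eq_zero_of_continuousOn_of_differentiableOn F
    (a + s * Complex.I) (b + t * Complex.I) ?_ ?_
  · simp only [Complex.add_re, Complex.ofReal_re, Complex.mul_re, Complex.I_re, mul_zero,
      Complex.ofReal_im, Complex.I_im, mul_one, sub_self, add_zero, Complex.add_im,
      Complex.mul_im, zero_add] at key
    have hx : ∀ y ∈ Set.Icc s t,
        IntervalIntegrable (fun x : ℝ => F (x + y * Complex.I)) volume a b := by
      intro y hy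
      apply ContinuousOn.intervalIntegrable
      intro x hx
      rw [Set.uIcc_of_le hab] at hx
      have : ContinuousAt (fun x : ℝ => (x + y * Complex.I : ℂ)) x := by fun_prop
      exact (ContinuousAt.comp (f := fun x : ℝ => (x + y * Complex.I : ℂ)) (hc x hx y hy)
        this).continuousWithinAt
    have hy : ∀ x ∈ Set.Icc a b,
        IntervalIntegrable (fun y : ℝ => F (x + y * Complex.I)) volume s t := by
      intro x hx
      apply ContinuousOn.intervalIntegrable
      intro y hy
      rw [Set.uIcc_of_le hst] at hy
      have : ContinuousAt (fun y : ℝ => (x + y * Complex.I : ℂ)) y := by fun_prop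
      exact (ContinuousAt.comp (f := fun y : ℝ => (x + y * Complex.I : ℂ)) (hc x hx y hy)
        this).continuousWithinAt
    have hre : ∀ {G : ℝ → ℂ} {u v : ℝ}, IntervalIntegrable G volume u v →
        (∫ x in u..v, G x).re = ∫ x in u..v, (G x).re := fun hG =>
      (Complex.reCLM.intervalIntegral_comp_comm hG).symm
    have him : ∀ {G : ℝ → ℂ} {u v : ℝ}, IntervalIntegrable G volume u v →
        (∫ x in u..v, G x).im = ∫ x in u..v, (G x).im := fun hG =>
      (Complex.imCLM.intervalIntegral_comp_comm hG).symm
    have hiI : ∀ {G : ℝ → ℂ} {u v : ℝ}, IntervalIntegrable G volume u v →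
        IntervalIntegrable (fun x => (G x).im) volume u v := fun hG =>
      ⟨hG.1.im, hG.2.im⟩
    have k2 := congrArg Complex.re key
    have hs : s ∈ Set.Icc s t := ⟨le_rfl, hst⟩
    have ht : t ∈ Set.Icc s t := ⟨hst, le_rfl⟩
    have ha : a ∈ Set.Icc a b := ⟨le_rfl, hab⟩
    have hb : b ∈ Set.Icc a b := ⟨hab, le_rfl⟩
    simp only [Complex.sub_re, Complex.add_re, smul_eq_mul, Complex.mul_re, Complex.I_re, zero_mul,
      Complex.I_im, one_mul, zero_sub, Complex.zero_re] at k2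
    rw [hre (hx s hs), hre (hx t ht), him (hy b hb), him (hy a ha)] at k2
    rw [intervalIntegral.integral_sub (hiI (hy b hb)) (hiI (hy a ha))]
    linarith
  · intro z hz'
    simp [Set.uIcc_of_le hab, Set.uIcc_of_le hst, Complex.mem_reProdIm] at hz'
    rw [hz z]
    exact (hc _ hz'.1 _ hz'.2).continuousWithinAt
  · intro z hz'
    simp [min_eq_left hab, max_eq_right hab, min_eq_left hst, max_eq_right hst,
      Complex.mem_reProdIm] at hz'
    rw [hz z]
    exact (hd _ hz'.1 _ hz'.2).differentiableWithinAt

theorem tendsto_punctured_vertical {α : ℂ} (z : ℂ) (hz : z ∈ puncturedClosedHalfPlane α) :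
    ∃ᶠ w in 𝓝 z, w ∈ upperHalf := by
  have ht : Tendsto (fun t : ℝ => z + t * Complex.I) (𝓝[>] 0) (𝓝 z) := by
    have : Continuous (fun t : ℝ => z + t * Complex.I) := by fun_prop
    simpa using (this.tendsto 0).mono_left nhdsWithin_le_nhds
  refine ht.frequently (Eventually.frequently ?_)
  filter_upwards [self_mem_nhdsWithin] with t htpos
  have h1 : 0 ≤ z.im := (mem_punctured.1 hz).1
  have h2 : (0 : ℝ) < t := htpos
  rw [mem_upperHalf]
  simp
  linarith

/-- A continuous inequality on the open half-plane extends to the punctured closed one. -/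
theorem le_of_continuousAt_of_upperHalf {α : ℂ} {u v : ℂ → ℝ} {z : ℂ}
    (hz : z ∈ puncturedClosedHalfPlane α) (hu : ContinuousAt u z) (hv : ContinuousAt v z)
    (hle : ∀ w ∈ upperHalf, u w ≤ v w) : u z ≤ v z := by
  by_contra! hcon
  obtain ⟨w, hw, hw2⟩ :=
    ((tendsto_punctured_vertical z hz).and_eventually (hv.eventually_lt hu hcon)).exists
  exact absurd (hle w hw) (not_le.2 hw2)

theorem abs_lt_of_punctured {α : ℂ} {x y : ℝ} (hx : ‖α‖ < |x|) (hy : 0 ≤ y) :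
    (x + y * Complex.I : ℂ) ∈ puncturedClosedHalfPlane α := by
  refine mem_punctured.2 ⟨by simpa using hy, ?_⟩
  rintro rfl
  have := Complex.abs_re_le_norm (x + y * Complex.I)
  simp at this hx
  linarith

theorem hasDerivAt_normSq_comp {γ : ℝ → ℂ} {γ' : ℂ} {t : ℝ} (h : HasDerivAt γ γ' t) :
    HasDerivAt (fun s => Complex.normSq (γ s)) (2 * (γ' * (starRingEnd ℂ) (γ t)).re) t := by
  have h1 : HasDerivAt (fun s => (γ s).re) γ'.re t :=
    Complex.reCLM.hasFDerivAt.comp_hasDerivAt t h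
  have h2 : HasDerivAt (fun s => (γ s).im) γ'.im t :=
    Complex.imCLM.hasFDerivAt.comp_hasDerivAt t h
  have h3 := (h1.mul h1).add (h2.mul h2)
  have e : (fun s => Complex.normSq (γ s)) =
      (fun s => (γ s).re) * (fun s => (γ s).re) + (fun s => (γ s).im) * (fun s => (γ s).im) := by
    ext s
    simp [Complex.normSq_apply]
  rw [e]
  refine h3.congr_deriv ?_
  rw [Complex.mul_re, Complex.conj_re, Complex.conj_im]
  ring

theorem hasDerivAt_line {F : ℂ → ℂ} {F' a b : ℂ} {t : ℝ} (h : HasDerivAt F F' (a + t * b)) :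
    HasDerivAt (fun s : ℝ => F (a + s * b)) (F' * b) t := by
  have h2 : HasDerivAt (fun s : ℝ => a + s * b) b t := by
    have := ((hasDerivAt_id t).ofReal_comp.mul_const b).const_add a
    simpa using this
  exact h.comp t h2

theorem im_div_eq {u v : ℂ} :
    (u / v).im * Complex.normSq v = (u * (starRingEnd ℂ) v).im := by
  by_cases hv : v = 0
  · simp [hv]
  have : Complex.normSq v ≠ 0 := (Complex.normSq_pos.2 hv).ne'
  rw [Complex.div_im]
  field_simp
  simp
  ring

theorem im_div_nonneg_iff {u v : ℂ} (hv : v ≠ 0) :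
    0 ≤ (u / v).im ↔ 0 ≤ (u * (starRingEnd ℂ) v).im := by
  rw [← im_div_eq, mul_nonneg_iff_of_pos_right (Complex.normSq_pos.2 hv)]

/-! ### Case of a finite limit along the imaginary axis, normalized to `0` -/

namespace IsConvexMap

variable {α : ℂ} {U : Set ℂ} {q : ℂ → ℂ}

/-- Were `0 = q z`, continuity of the inverse at `0` would give `i Y k → z`, while `Y k → ∞`. -/
theorem apply_ne_zero_of_axis (h : IsConvexMap α U q) {Y : ℕ → ℝ} (hY : Tendsto Y atTop atTop)
    (hlim : Tendsto (fun k => q (Y k * Complex.I)) atTop (𝓝 0)) {z : ℂ}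
    (hz : z ∈ puncturedClosedHalfPlane α) : q z ≠ 0 := by
  intro h0
  rw [← h0] at hlim
  have h1 := (h.hasDerivAt_inv (h.subset hz)).continuousAt.tendsto.comp hlim
  rw [h.inv_apply (h.subset hz)] at h1
  have h2 := (Complex.continuous_im.tendsto z).comp h1
  have h3 : Tendsto Y atTop (𝓝 z.im) := by
    refine h2.congr' ?_
    filter_upwards [hY.eventually_gt_atTop 0] with k hk
    have hmem : (Y k * Complex.I : ℂ) ∈ U :=
      h.upperHalf_subset (by simpa [mem_upperHalf] using hk)
    simp [h.inv_apply hmem]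
  exact not_tendsto_atTop_of_tendsto_nhds h3 hY

/-- The displacement from `q w` towards the limit is `-q w`, so `Im (-q / q') ≥ 0`, and inversion
flips the sign. Thus `arg q` increases to the right and `|q|` decreases upwards. -/
theorem im_logDeriv_nonneg (h : IsConvexMap α U q) {Y : ℕ → ℝ} (hY : Tendsto Y atTop atTop)
    (hlim : Tendsto (fun k => q (Y k * Complex.I)) atTop (𝓝 0)) {z : ℂ}
    (hz : z ∈ puncturedClosedHalfPlane α) : 0 ≤ (deriv q z / q z).im := by
  refine le_of_continuousAt_of_upperHalf (u := fun _ => 0) (v := fun z => (deriv q z / q z).im)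
    hz continuousAt_const ?_ fun w hw => ?_
  · have h1 : ContinuousAt (deriv q) z :=
      (h.holomorphic.analyticAt (h.isOpen.mem_nhds (h.subset hz))).deriv.continuousAt
    exact Complex.continuous_im.continuousAt.comp
      (h1.div (h.differentiableAt (h.subset hz)).continuousAt (h.apply_ne_zero_of_axis hY hlim hz))
  · have h1 := h.im_div_deriv_nonneg_of_axis (t := fun _ => 1) (d₀ := -q w) hw hY
      (by simp) (by simp) (by simpa using hlim.sub_const (q w))
    have hq := h.apply_ne_zero_of_axis hY hlim (h.upperHalf_subset_punctured hw)
    rw [im_div_nonneg_iff (h.deriv_ne_zero (h.upperHalf_subset hw))] at h1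
    rw [im_div_nonneg_iff hq]
    simp at h1 ⊢
    linarith

theorem norm_antitone_vertical (h : IsConvexMap α U q) {Y : ℕ → ℝ} (hY : Tendsto Y atTop atTop)
    (hlim : Tendsto (fun k => q (Y k * Complex.I)) atTop (𝓝 0)) {x s t : ℝ}
    (hmem : ∀ y, s ≤ y → (x + y * Complex.I : ℂ) ∈ puncturedClosedHalfPlane α) (hst : s ≤ t) :
    ‖q (x + t * Complex.I)‖ ≤ ‖q (x + s * Complex.I)‖ := by
  have hder : ∀ y, s ≤ y → HasDerivAt (fun y : ℝ => Complex.normSq (q (x + y * Complex.I)))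
      (2 * (deriv q (x + y * Complex.I) * Complex.I *
        (starRingEnd ℂ) (q (x + y * Complex.I))).re) y := by
    intro y hy
    exact hasDerivAt_normSq_comp
      (hasDerivAt_line (h.differentiableAt (h.subset (hmem y hy))).hasDerivAt)
  have hanti : AntitoneOn (fun y : ℝ => Complex.normSq (q (x + y * Complex.I))) (Set.Ici s) := by
    apply antitoneOn_of_deriv_nonpos (convex_Ici s)
    · intro y hy
      exact (hder y hy).continuousAt.continuousWithinAt
    · intro y hy
      exact (hder y (interior_subset hy)).differentiableAt.differentiableWithinAt
    · intro y hy
      have hy' : s ≤ y := interior_subset (s := Set.Ici s) hy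
      rw [(hder y hy').deriv]
      have h1 := h.im_logDeriv_nonneg hY hlim (hmem y hy')
      rw [im_div_nonneg_iff (h.apply_ne_zero_of_axis hY hlim (hmem y hy'))] at h1
      simp at h1 ⊢
      linarith
  have := hanti (Set.self_mem_Ici) (show t ∈ Set.Ici s from hst) hst
  simp only [Complex.normSq_eq_norm_sq] at this
  exact (sq_le_sq₀ (norm_nonneg _) (norm_nonneg _)).1 this

theorem tendsto_axis_zero (h : IsConvexMap α U q) {Y : ℕ → ℝ} (hY : Tendsto Y atTop atTop)
    (hlim : Tendsto (fun k => q (Y k * Complex.I)) atTop (𝓝 0)) :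
    Tendsto (fun y : ℝ => q (y * Complex.I)) atTop (𝓝 0) := by
  rw [Metric.tendsto_atTop]
  intro ε hε
  obtain ⟨k, hk1, hk2⟩ := ((hlim.eventually (Metric.ball_mem_nhds 0 hε)).and
    (hY.eventually_gt_atTop 0)).exists
  refine ⟨Y k, fun y hy => ?_⟩
  have := h.norm_antitone_vertical hY hlim (x := 0) (s := Y k) (t := y)
    (fun y hy => h.upperHalf_subset_punctured (by simpa [mem_upperHalf] using hk2.trans_le hy)) hy
  simp at this hk1 ⊢
  linarith

theorem re_nonneg_of_upperHalf (h : IsConvexMap α U q) (hre : ∀ z ∈ upperHalf, 0 < (q z).re)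
    {z : ℂ} (hz : z ∈ puncturedClosedHalfPlane α) : 0 ≤ (q z).re :=
  le_of_continuousAt_of_upperHalf (u := fun _ => 0) (v := fun z => (q z).re) hz continuousAt_const
    (Complex.continuous_re.continuousAt.comp (h.differentiableAt (h.subset hz)).continuousAt)
    fun w hw => (hre w hw).le

theorem mem_slitPlane_of_re_nonneg {w : ℂ} (hre : 0 ≤ w.re) (h0 : w ≠ 0) :
    w ∈ Complex.slitPlane := by
  rw [Complex.mem_slitPlane_iff]
  rcases hre.lt_or_eq with h | h
  · exact Or.inl h
  · refine Or.inr fun him => h0 (Complex.ext h.symm him)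

/-- Cauchy's theorem for `log q` on `[X, 2X] × [0, X]`: the integral of `log |q|` over the bottom
exceeds that over the top by at most `π X`, since `|arg q| ≤ π / 2` on the vertical sides. Harnack
bounds `|q|` on the top by `6 |q (iX)|`, so some point of the bottom satisfies the bound. -/
theorem exists_norm_le_axis (h : IsConvexMap α U q) (hre : ∀ z ∈ upperHalf, 0 < (q z).re)
    (hq0 : ∀ z ∈ puncturedClosedHalfPlane α, q z ≠ 0) {X : ℝ} (hX : ‖α‖ < X) :
    ∃ s ∈ Set.Icc X (2 * X), ‖q s‖ ≤ Real.exp (Real.pi) * (6 * ‖q (X * Complex.I)‖) := by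
  have hX0 : 0 < X := (norm_nonneg α).trans_lt hX
  have hmem : ∀ x ∈ Set.Icc X (2 * X), ∀ y : ℝ, 0 ≤ y →
      (x + y * Complex.I : ℂ) ∈ puncturedClosedHalfPlane α := by
    intro x hx y hy
    refine abs_lt_of_punctured ?_ hy
    rw [abs_of_pos (by linarith [hx.1])]
    linarith [hx.1]
  have hld : ∀ x ∈ Set.Icc X (2 * X), ∀ y : ℝ, 0 ≤ y →
      DifferentiableAt ℂ (fun z => Complex.log (q z)) (x + y * Complex.I) := by
    intro x hx y hy
    have hm := hmem x hx y hy
    exact (h.differentiableAt (h.subset hm)).clog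
      (mem_slitPlane_of_re_nonneg (h.re_nonneg_of_upperHalf hre hm) (hq0 _ hm))
  by_contra! hcon
  have hrect := integral_re_rect (F := fun z => Complex.log (q z)) (a := X) (b := 2 * X) (s := 0)
    (t := X) (by linarith) hX0.le
    (fun x hx y hy => (hld x hx y hy.1).continuousAt)
    (fun x hx y hy => hld x (Set.Ioo_subset_Icc_self hx) y hy.1.le)
  simp only [Complex.log_re, Complex.log_im, Complex.ofReal_zero, zero_mul, add_zero] at hrect
  have hXI : (X * Complex.I : ℂ) ∈ upperHalf := by simpa [mem_upperHalf] using hX0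
  have hpos : 0 < ‖q (X * Complex.I)‖ :=
    norm_pos_iff.2 (hq0 _ (h.upperHalf_subset_punctured hXI))
  have hcontre : ∀ y : ℝ, 0 ≤ y → ContinuousOn
      (fun x : ℝ => Real.log ‖q (x + y * Complex.I)‖) (Set.Icc X (2 * X)) := by
    intro y hy x hx
    have h1 : ContinuousAt (fun x : ℝ => (x + y * Complex.I : ℂ)) x := by fun_prop
    have h2 := (ContinuousAt.comp (f := fun x : ℝ => (x + y * Complex.I : ℂ))
      (hld x hx y hy).continuousAt h1)
    have h3 := Complex.continuous_re.continuousAt.comp h2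
    simpa [Function.comp_def, Complex.log_re] using h3.continuousWithinAt
  set M := Real.log (6 * ‖q (X * Complex.I)‖) with hM
  have hub : ∫ x in X..2 * X, Real.log ‖q (x + X * Complex.I)‖ ≤ X * M := by
    have := intervalIntegral.integral_mono_on (a := X) (b := 2 * X) (μ := volume)
      (f := fun x : ℝ => Real.log ‖q (x + X * Complex.I)‖) (g := fun _ => M) (by linarith)
      (by
        apply ContinuousOn.intervalIntegrable
        rw [Set.uIcc_of_le (by linarith)]
        exact hcontre X hX0.le) (by simp) (fun x hx => by
          apply Real.log_le_log (norm_pos_iff.2 (hq0 _ (hmem x hx X hX0.le)))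
          have := harnack_horizontal (p := q)
            (h.holomorphic.mono h.upperHalf_subset) hre (x := x) (x' := 0) (y := X) hX0 (by
              rw [sub_zero, abs_of_pos (by linarith [hx.1])]
              exact hx.2)
          simpa using this)
    refine this.trans (le_of_eq ?_)
    rw [intervalIntegral.integral_const, smul_eq_mul]
    ring
  have hub2 : ∫ y in (0 : ℝ)..X, ((q (↑(2 * X) + y * Complex.I)).arg -
      (q (X + y * Complex.I)).arg) ≤ X * Real.pi := by
    have hci : ∀ x ∈ Set.Icc X (2 * X),
        ContinuousOn (fun y : ℝ => (q (x + y * Complex.I)).arg) (Set.Icc 0 X) := by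
      intro x hx y hy
      have h1 : ContinuousAt (fun y : ℝ => (x + y * Complex.I : ℂ)) y := by fun_prop
      have h2 := (ContinuousAt.comp (f := fun y : ℝ => (x + y * Complex.I : ℂ))
        (hld x hx y hy.1).continuousAt h1)
      have h3 := Complex.continuous_im.continuousAt.comp h2
      simpa [Function.comp_def, Complex.log_im] using h3.continuousWithinAt
    have := intervalIntegral.integral_mono_on (a := 0) (b := X) (μ := volume)
      (f := fun y : ℝ => (q (↑(2 * X) + y * Complex.I)).arg - (q (X + y * Complex.I)).arg)
      (g := fun _ => Real.pi) hX0.le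
      (by
        apply ContinuousOn.intervalIntegrable
        rw [Set.uIcc_of_le hX0.le]
        exact (hci _ ⟨by linarith, le_rfl⟩).sub (hci _ ⟨le_rfl, by linarith⟩)) (by simp)
      (fun y hy => by
        have h1 := Complex.abs_arg_le_pi_div_two_iff.2 (h.re_nonneg_of_upperHalf hre
          (hmem (2 * X) ⟨by linarith, le_rfl⟩ y hy.1))
        have h2 := Complex.abs_arg_le_pi_div_two_iff.2 (h.re_nonneg_of_upperHalf hre
          (hmem X ⟨le_rfl, by linarith⟩ y hy.1))
        have := abs_le.1 h1
        have := abs_le.1 h2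
        linarith)
    refine this.trans (le_of_eq ?_)
    simp
  have hlb : X * (M + Real.pi) < ∫ x in X..2 * X, Real.log ‖q (x : ℂ)‖ := by
    have hc0 := hcontre 0 le_rfl
    simp only [Complex.ofReal_zero, zero_mul, add_zero] at hc0
    have hlt := intervalIntegral.integral_lt_integral_of_continuousOn_of_le_of_exists_lt
      (a := X) (b := 2 * X)
      (f := fun _ => M + Real.pi) (g := fun x : ℝ => Real.log ‖q (x : ℂ)‖) (by linarith)
      continuousOn_const hc0 (fun x hx => ?_) ⟨X, ⟨le_rfl, by linarith⟩, ?_⟩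
    · refine lt_of_eq_of_lt ?_ hlt
      rw [intervalIntegral.integral_const, smul_eq_mul]
      ring
    · have := Real.log_lt_log (by positivity) (hcon x ⟨hx.1.le, hx.2⟩)
      rw [Real.log_mul (Real.exp_pos _).ne' (by positivity), Real.log_exp] at this
      linarith
    · have := Real.log_lt_log (by positivity) (hcon X ⟨le_rfl, by linarith⟩)
      rw [Real.log_mul (Real.exp_pos _).ne' (by positivity), Real.log_exp] at this
      linarith
  rw [hrect] at hlb
  nlinarith

end IsConvexMap

theorem re_mul_conj_eq_cos (w p : ℂ) :
    (w * (starRingEnd ℂ) p).re = ‖w‖ * ‖p‖ * Real.cos (w.arg - p.arg) := by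
  rw [Real.cos_sub, Complex.mul_re, Complex.conj_re, Complex.conj_im,
    ← Complex.norm_mul_cos_arg w, ← Complex.norm_mul_cos_arg p, ← Complex.norm_mul_sin_arg w,
    ← Complex.norm_mul_sin_arg p]
  ring

/-- Every real-linear functional on `ℂ` is of the form `w ↦ Re (e w)`. -/
theorem exists_eq_re_mul (φ : ℂ →L[ℝ] ℝ) : ∃ e : ℂ, ∀ w, φ w = (e * w).re := by
  refine ⟨φ 1 - φ Complex.I * Complex.I, fun w => ?_⟩
  have : w = w.re • (1 : ℂ) + w.im • Complex.I := by
    simp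
  conv_lhs => rw [this]
  rw [map_add, map_smul, map_smul]
  simp
  ring

namespace IsConvexMap

variable {α : ℂ} {U : Set ℂ} {q f : ℂ → ℂ}

theorem monotoneOn_arg_real (h : IsConvexMap α U q) {Y : ℕ → ℝ} (hY : Tendsto Y atTop atTop)
    (hlim : Tendsto (fun k => q (Y k * Complex.I)) atTop (𝓝 0))
    (hre : ∀ z ∈ upperHalf, 0 < (q z).re) :
    MonotoneOn (fun x : ℝ => (q x).arg) (Set.Ioi ‖α‖) := by
  have hmem : ∀ x : ℝ, x ∈ Set.Ioi ‖α‖ → (x : ℂ) ∈ puncturedClosedHalfPlane α := by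
    intro x hx
    have hx' : ‖α‖ < x := hx
    have := abs_lt_of_punctured (α := α) (x := x) (y := 0)
      (by rwa [abs_of_pos ((norm_nonneg α).trans_lt hx')]) le_rfl
    simpa using this
  have hder : ∀ x : ℝ, x ∈ Set.Ioi ‖α‖ →
      HasDerivAt (fun x : ℝ => (q x).arg) (deriv q x / q x).im x := by
    intro x hx
    have hm := hmem x hx
    have h1 : HasDerivAt (fun z => Complex.log (q z)) (deriv q x / q x) (x : ℂ) :=
      (h.differentiableAt (h.subset hm)).hasDerivAt.clog
        (mem_slitPlane_of_re_nonneg (h.re_nonneg_of_upperHalf hre hm)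
          (h.apply_ne_zero_of_axis hY hlim hm))
    have h2 : HasDerivAt (fun x : ℝ => Complex.log (q x)) (deriv q x / q x) x :=
      h1.comp_ofReal
    have e : (fun x : ℝ => (q x).arg) = fun x : ℝ => (Complex.log (q x)).im := by
      ext x
      rw [Complex.log_im]
    rw [e]
    exact Complex.imCLM.hasFDerivAt.comp_hasDerivAt x h2
  apply monotoneOn_of_deriv_nonneg (convex_Ioi _)
  · exact fun x hx => (hder x hx).continuousAt.continuousWithinAt
  · rw [interior_Ioi]
    exact fun x hx => (hder x hx).differentiableAt.differentiableWithinAt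
  · rw [interior_Ioi]
    intro x hx
    rw [(hder x hx).deriv]
    exact h.im_logDeriv_nonneg hY hlim (hmem x hx)

/-- On the far real axis `arg q` is monotone and bounded, hence eventually within `π / 3` of its
supremum. -/
theorem exists_forall_arg_close (h : IsConvexMap α U q) {Y : ℕ → ℝ}
    (hY : Tendsto Y atTop atTop) (hlim : Tendsto (fun k => q (Y k * Complex.I)) atTop (𝓝 0))
    (hre : ∀ z ∈ upperHalf, 0 < (q z).re) :
    ∃ X₀, ‖α‖ < X₀ ∧ ∀ x y : ℝ, X₀ ≤ x → x ≤ y → |(q x).arg - (q y).arg| ≤ Real.pi / 3 := by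
  have hmono := h.monotoneOn_arg_real hY hlim hre
  set S := (fun x : ℝ => (q x).arg) '' Set.Ioi ‖α‖ with hS
  have hbdd : BddAbove S := ⟨Real.pi, by
    rintro _ ⟨x, _, rfl⟩
    exact Complex.arg_le_pi _⟩
  have hne : S.Nonempty := ⟨_, ‖α‖ + 1, by simp, rfl⟩
  obtain ⟨_, ⟨X₀, hX₀, rfl⟩, hlt⟩ := exists_lt_of_lt_csSup hne
    (show sSup S - Real.pi / 3 < sSup S by linarith [Real.pi_pos])
  have hX₀' : ‖α‖ < X₀ := hX₀
  refine ⟨X₀, hX₀', fun x y hx hxy => ?_⟩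
  have hxm : x ∈ Set.Ioi ‖α‖ := hX₀'.trans_le hx
  have hym : y ∈ Set.Ioi ‖α‖ := hX₀'.trans_le (hx.trans hxy)
  have h1 := hmono hX₀ hxm hx
  have h2 := hmono hxm hym hxy
  have h3 := le_csSup hbdd ⟨y, hym, rfl⟩
  simp only at h1 h2 h3 hlt
  rw [abs_le]
  constructor <;> linarith [Real.pi_pos]

/-- Points with small `|q|` exist arbitrarily far out. If `|q| ≥ δ` also recurred, `|q|` would have
a local minimum at some real `t` with `|q t| < δ / 2`, after a point `s₁` with `|q s₁| ≥ δ`. There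
`q'` is a positive multiple of `i q`, so the supporting line at `q t` forces `Re (q s₁ / q t) ≤ 1`.
But the modulus of this quotient exceeds `2` and its angle is at most `π / 3`. -/
theorem tendsto_real_atTop_zero (h : IsConvexMap α U q) {Y : ℕ → ℝ}
    (hY : Tendsto Y atTop atTop) (hlim : Tendsto (fun k => q (Y k * Complex.I)) atTop (𝓝 0))
    (hre : ∀ z ∈ upperHalf, 0 < (q z).re) :
    Tendsto (fun x : ℝ => q x) atTop (𝓝 0) := by
  have hmem : ∀ x : ℝ, ‖α‖ < x → (x : ℂ) ∈ puncturedClosedHalfPlane α := by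
    intro x hx
    have := abs_lt_of_punctured (α := α) (x := x) (y := 0)
      (by rwa [abs_of_pos ((norm_nonneg α).trans_lt hx)]) le_rfl
    simpa using this
  have hq0 : ∀ z ∈ puncturedClosedHalfPlane α, q z ≠ 0 :=
    fun z hz => h.apply_ne_zero_of_axis hY hlim hz
  obtain ⟨X₀, hX₀, harg⟩ := h.exists_forall_arg_close hY hlim hre
  have hX₀p : 0 < X₀ := (norm_nonneg α).trans_lt hX₀
  rw [Metric.tendsto_atTop]
  by_contra! hcon
  obtain ⟨δ, hδ, hfar⟩ := hcon
  obtain ⟨s₁, hs₁, hs₁δ⟩ := hfar X₀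
  have hax := (h.tendsto_axis_zero hY hlim).norm
  rw [norm_zero] at hax
  have hax2 : Tendsto (fun y : ℝ => Real.exp Real.pi * (6 * ‖q (y * Complex.I)‖)) atTop (𝓝 0) := by
    simpa using (hax.const_mul 6).const_mul (Real.exp Real.pi)
  obtain ⟨X, hXlt, hXs⟩ := ((hax2.eventually_lt_const (half_pos hδ)).and
    (eventually_gt_atTop s₁)).exists
  obtain ⟨s, hs, hsle⟩ := h.exists_norm_le_axis hre hq0 (hX₀.trans_le (hs₁.trans hXs.le))
  obtain ⟨x, hx, hxδ⟩ := hfar (2 * X)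
  rw [dist_zero_right] at hs₁δ hxδ
  have hcont : ContinuousOn (fun x : ℝ => Complex.normSq (q x)) (Set.Icc s₁ x) := by
    intro t ht
    have h1 := (h.differentiableAt (h.subset (hmem t (hX₀.trans_le (hs₁.trans ht.1))))).continuousAt
    have h2 : ContinuousAt (fun x : ℝ => q x) t :=
      ContinuousAt.comp (f := fun x : ℝ => (x : ℂ)) h1 Complex.continuous_ofReal.continuousAt
    exact (Complex.continuous_normSq.continuousAt.comp h2).continuousWithinAt
  have hsI : s ∈ Set.Icc s₁ x := ⟨by linarith [hs.1], by linarith [hs.2]⟩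
  obtain ⟨t, ht, hmin⟩ := isCompact_Icc.exists_isMinOn ⟨s, hsI⟩ hcont
  have hts : Complex.normSq (q t) ≤ Complex.normSq (q s) := hmin hsI
  have htδ : ‖q t‖ < δ / 2 := by
    rw [Complex.normSq_eq_norm_sq, Complex.normSq_eq_norm_sq,
      sq_le_sq₀ (norm_nonneg _) (norm_nonneg _)] at hts
    linarith
  have ht' : t ∈ Set.Ioo s₁ x := by
    refine ⟨ht.1.lt_of_ne ?_, ht.2.lt_of_ne ?_⟩
    · rintro rfl
      linarith
    · rintro rfl
      linarith
  have htX : X₀ ≤ t := hs₁.trans ht.1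
  have htm := hmem t (hX₀.trans_le htX)
  have hloc : IsLocalMin (fun x : ℝ => Complex.normSq (q x)) t :=
    hmin.isLocalMin (Icc_mem_nhds ht'.1 ht'.2)
  have hd := hasDerivAt_normSq_comp (γ := fun x : ℝ => q x)
    (h.differentiableAt (h.subset htm)).hasDerivAt.comp_ofReal
  have hre0 := hloc.hasDerivAt_eq_zero hd
  have him := h.im_logDeriv_nonneg hY hlim htm
  rw [im_div_nonneg_iff (hq0 _ htm)] at him
  have hd0 := h.deriv_ne_zero (h.subset htm)
  have hs₁m := hmem s₁ (hX₀.trans_le hs₁)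
  have hsup := h.im_sub_div_deriv_nonneg_of_boundary htm (by simp) hs₁m
  rw [im_div_nonneg_iff hd0] at hsup
  have hcos : 1 / 2 ≤ Real.cos ((q s₁).arg - (q t).arg) := by
    rw [← Real.cos_abs, ← Real.cos_pi_div_three]
    exact Real.cos_le_cos_of_nonneg_of_le_pi (abs_nonneg _) (by linarith [Real.pi_pos])
      (harg s₁ t hs₁ ht.1)
  have hrew := re_mul_conj_eq_cos (q s₁) (q t)
  have hqt : 0 < ‖q t‖ := norm_pos_iff.2 (hq0 _ htm)
  have hbig : ‖q t‖ ^ 2 < (q s₁ * (starRingEnd ℂ) (q t)).re := by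
    rw [hrew]
    have h1 : δ * ‖q t‖ * (1 / 2) ≤ ‖q s₁‖ * ‖q t‖ * Real.cos ((q s₁).arg - (q t).arg) := by
      gcongr
    nlinarith
  set d := deriv q t
  set p := q t
  set w := q s₁
  have hnp : ‖p‖ ^ 2 = p.re * p.re + p.im * p.im := by
    rw [← Complex.normSq_eq_norm_sq, Complex.normSq_apply]
  rw [hnp] at hbig
  have hpp : 0 < p.re * p.re + p.im * p.im := by
    rw [← hnp]
    positivity
  simp only [Complex.mul_re, Complex.mul_im, Complex.conj_re, Complex.conj_im, Complex.sub_re,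
    Complex.sub_im] at hre0 him hsup hbig
  have hkey : (p.re * p.re + p.im * p.im) * ((w.re - p.re) * -d.im + (w.im - p.im) * d.re) =
      -(w.re * p.re - w.im * -p.im - (p.re * p.re + p.im * p.im)) *
        (d.re * -p.im + d.im * p.re) + (w.im * p.re - w.re * p.im) *
        (d.re * p.re - d.im * -p.im) := by
    ring
  have hz1 : d.re * p.re - d.im * -p.im = 0 := by linarith
  rw [hz1, mul_zero, add_zero] at hkey
  -- With `hz1` this makes both parts of `d * conj p` vanish, hence `d = 0`, against univalence.
  have hz2 : d.re * -p.im + d.im * p.re = 0 := by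
    by_contra hne
    have hpos : 0 < d.re * -p.im + d.im * p.re := lt_of_le_of_ne him (Ne.symm hne)
    nlinarith [mul_pos (sub_pos.2 hbig) hpos, mul_nonneg hpp.le hsup]
  have hdre : d.re * (p.re * p.re + p.im * p.im) = 0 := by linear_combination p.re * hz1 - p.im * hz2
  have hdim : d.im * (p.re * p.re + p.im * p.im) = 0 := by linear_combination p.im * hz1 + p.re * hz2
  exact hd0 (Complex.ext ((mul_eq_zero.1 hdre).resolve_right hpp.ne')
    ((mul_eq_zero.1 hdim).resolve_right hpp.ne'))

/-- In the sector `|x| ≤ 2y` Harnack compares with the imaginary axis; outside it `|q|` is bounded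
by its value at the real point below, where it tends to `0`. -/
theorem exists_forall_norm_lt (h : IsConvexMap α U q) {Y : ℕ → ℝ}
    (hY : Tendsto Y atTop atTop) (hlim : Tendsto (fun k => q (Y k * Complex.I)) atTop (𝓝 0))
    (hre : ∀ z ∈ upperHalf, 0 < (q z).re) {ε : ℝ} (hε : 0 < ε) :
    ∃ R, ∀ z ∈ puncturedClosedHalfPlane α, R ≤ ‖z‖ → ‖q z‖ < ε := by
  obtain ⟨X₁, hX₁⟩ := Metric.tendsto_atTop.1 (h.tendsto_real_atTop_zero hY hlim hre) ε hε
  have hax := Metric.tendsto_atTop.1 (h.tendsto_axis_zero hY hlim) (ε / 6) (by positivity)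
  obtain ⟨Y₁, hY₁⟩ := hax
  -- The negative real axis comes from the reflection; the factor `-1` restores a positive real
  -- part.
  have hrefl : ∀ z, -1 * reflectMap q z = (starRingEnd ℂ) (q (-(starRingEnd ℂ) z)) := by
    intro z
    simp [reflectMap]
  have h' := h.reflect.smul (e := -1) (by norm_num)
  have hl := h'.tendsto_real_atTop_zero hY (by
      simp only [hrefl]
      have := (Complex.continuous_conj.tendsto 0).comp hlim
      simpa [Function.comp_def] using this) (by
      intro z hz
      rw [hrefl, Complex.conj_re]
      exact hre _ (by simpa [mem_upperHalf] using hz))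
  obtain ⟨X₂, hX₂⟩ := Metric.tendsto_atTop.1 hl ε hε
  simp only [hrefl] at hX₂
  refine ⟨3 * (|X₁| + |X₂| + |Y₁| + ‖α‖ + 1), fun z hz hR => ?_⟩
  have hy0 := (mem_punctured.1 hz).1
  have hnz : ‖z‖ ≤ |z.re| + z.im := by
    have := Complex.norm_le_abs_re_add_abs_im z
    rwa [abs_of_nonneg hy0] at this
  have hzz : z = z.re + z.im * Complex.I := (Complex.re_add_im z).symm
  have a1 := abs_nonneg X₁
  have a2 := abs_nonneg X₂
  have a3 := abs_nonneg Y₁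
  have a4 := norm_nonneg α
  by_cases hc : |z.re| ≤ 2 * z.im
  · have hy : 0 < z.im := by linarith
    have h1 := harnack_horizontal (h.holomorphic.mono h.upperHalf_subset) hre (x := z.re) (x' := 0)
      hy (by simpa using hc)
    rw [← hzz] at h1
    have h2 := hY₁ z.im (by linarith [le_abs_self Y₁])
    rw [dist_zero_right] at h2
    simp only [Complex.ofReal_zero, zero_add] at h1
    linarith
  · push Not at hc
    have hxb : |X₁| + |X₂| + |Y₁| + ‖α‖ + 1 ≤ |z.re| := by linarith
    have hxα : ‖α‖ < |z.re| := by linarith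
    have h1 := h.norm_antitone_vertical hY hlim (x := z.re) (s := 0) (t := z.im)
      (fun y hy => abs_lt_of_punctured hxα hy) hy0
    rw [← hzz] at h1
    refine h1.trans_lt ?_
    simp only [Complex.ofReal_zero, zero_mul, add_zero]
    rcases le_total 0 z.re with h0 | h0
    · rw [abs_of_nonneg h0] at hxb
      have := hX₁ z.re (by linarith [le_abs_self X₁])
      rwa [dist_zero_right] at this
    · rw [abs_of_nonpos h0] at hxb
      have := hX₂ (-z.re) (by linarith [le_abs_self X₂])
      rw [dist_zero_right] at this
      simpa using this

theorem sub_const (h : IsConvexMap α U f) (c : ℂ) : IsConvexMap α U (fun z => f z - c) where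
  im_nonpos := h.im_nonpos
  isOpen := h.isOpen
  subset := h.subset
  holomorphic := h.holomorphic.sub_const c
  injective := fun z hz w hw hzw => h.injective hz hw (sub_left_injective hzw)
  convex_image := by
    have e : (fun z => f z - c) '' puncturedClosedHalfPlane α =
        (fun w => -c + w) '' (f '' puncturedClosedHalfPlane α) := by
      rw [Set.image_image]
      ext w
      simp [sub_eq_neg_add]
    rw [e]
    exact h.convex_image.translate _

/-- If `f` has a finite limit point `c` along the imaginary axis, then `c` is not in the image and
`f` tends to `c` at infinity in the closed half-plane. -/
theorem exists_forall_norm_sub_lt (h : IsConvexMap α U f) {Y : ℕ → ℝ} {c : ℂ}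
    (hY : Tendsto Y atTop atTop) (hlim : Tendsto (fun k => f (Y k * Complex.I)) atTop (𝓝 c)) :
    c ∉ f '' puncturedClosedHalfPlane α ∧ ∀ ε : ℝ, 0 < ε →
      ∃ R, ∀ z ∈ puncturedClosedHalfPlane α, R ≤ ‖z‖ → ‖f z - c‖ < ε := by
  have h1 := h.sub_const c
  have hlim1 : Tendsto (fun k => f (Y k * Complex.I) - c) atTop (𝓝 0) := by
    simpa using hlim.sub_const c
  have hc : c ∉ f '' puncturedClosedHalfPlane α := by
    rintro ⟨z, hz, hzc⟩
    exact h1.apply_ne_zero_of_axis hY hlim1 hz (sub_eq_zero.2 hzc)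
  refine ⟨hc, fun ε hε => ?_⟩
  -- Since `c` lies outside the open convex image, some `e` makes `e (f - c)` have positive real
  -- part, which is the normalization of the preceding lemmas.
  obtain ⟨φ, hφ⟩ := geometric_hahn_banach_point_open h.convex_image_upperHalf
    h.isOpen_image_upperHalf (x := c) (fun hcc => hc
      (Set.image_mono h.upperHalf_subset_punctured hcc))
  obtain ⟨e, he⟩ := exists_eq_re_mul φ
  have hI : Complex.I ∈ upperHalf := by simp [mem_upperHalf]
  have he0 : e ≠ 0 := by
    rintro rfl
    have := hφ _ ⟨Complex.I, hI, rfl⟩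
    simp [he] at this
  have h2 := h1.smul he0
  obtain ⟨R, hR⟩ := h2.exists_forall_norm_lt hY (by simpa using hlim1.const_mul e) (by
    intro z hz
    have := hφ _ ⟨z, hz, rfl⟩
    rw [he, he] at this
    rw [mul_sub, Complex.sub_re]
    linarith) (ε := ‖e‖ * ε) (by positivity)
  refine ⟨R, fun z hz hzR => ?_⟩
  have := hR z hz hzR
  rw [norm_mul] at this
  exact lt_of_mul_lt_mul_left this (norm_nonneg e)

end IsConvexMap

/-! ### Growth of `f` when `Re f' > 0` -/

namespace IsConvexMap

variable {α : ℂ} {U : Set ℂ} {f : ℂ → ℂ}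

theorem analyticAt_deriv (h : IsConvexMap α U f) {z : ℂ} (hz : z ∈ U) :
    AnalyticAt ℂ (deriv f) z :=
  (h.holomorphic.analyticAt (h.isOpen.mem_nhds hz)).deriv

theorem differentiableOn_deriv (h : IsConvexMap α U f) : DifferentiableOn ℂ (deriv f) upperHalf :=
  fun _ hz => (h.analyticAt_deriv (h.upperHalf_subset hz)).differentiableAt.differentiableWithinAt

theorem line_mem {x y : ℝ} (hy : 0 < y) : (x + y * Complex.I : ℂ) ∈ upperHalf := by
  simpa [mem_upperHalf] using hy

theorem hasDerivAt_horizontal (h : IsConvexMap α U f) {x y : ℝ}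
    (hm : (x + y * Complex.I : ℂ) ∈ U) :
    HasDerivAt (fun s : ℝ => f (s + y * Complex.I)) (deriv f (x + y * Complex.I)) x := by
  have h1 := hasDerivAt_line (a := y * Complex.I) (b := 1) (t := x) (F := f)
    (F' := deriv f (x + y * Complex.I)) (by
      have := (h.differentiableAt hm).hasDerivAt
      rwa [mul_one, add_comm (y * Complex.I : ℂ)])
  simpa only [mul_one, add_comm ((y : ℂ) * Complex.I)] using h1

theorem hasDerivAt_vertical (h : IsConvexMap α U f) {x y : ℝ}
    (hm : (x + y * Complex.I : ℂ) ∈ U) :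
    HasDerivAt (fun s : ℝ => f (x + s * Complex.I)) (deriv f (x + y * Complex.I) * Complex.I) y :=
  hasDerivAt_line (h.differentiableAt hm).hasDerivAt

theorem re_strictMono_horizontal (h : IsConvexMap α U f)
    (hre : ∀ z ∈ upperHalf, 0 < (deriv f z).re) {y : ℝ} (hy : 0 < y) :
    StrictMono fun x : ℝ => (f (x + y * Complex.I)).re := by
  apply strictMono_of_deriv_pos
  intro x
  have h1 := Complex.reCLM.hasFDerivAt.comp_hasDerivAt x
    (h.hasDerivAt_horizontal (h.upperHalf_subset (line_mem (x := x) hy)))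
  have h2 : HasDerivAt (fun x : ℝ => (f (x + y * Complex.I)).re)
      (deriv f (x + y * Complex.I)).re x := h1
  rw [h2.deriv]
  exact hre _ (line_mem hy)

theorem im_monotoneOn_vertical (h : IsConvexMap α U f)
    (hre : ∀ z ∈ upperHalf, 0 < (deriv f z).re) (x : ℝ) :
    MonotoneOn (fun y : ℝ => (f (x + y * Complex.I)).im) (Set.Ioi 0) := by
  have hder : ∀ y : ℝ, y ∈ Set.Ioi (0 : ℝ) → HasDerivAt (fun y : ℝ => (f (x + y * Complex.I)).im)
      (deriv f (x + y * Complex.I)).re y := by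
    intro y hy
    have h1 := Complex.imCLM.hasFDerivAt.comp_hasDerivAt y
      (h.hasDerivAt_vertical (h.upperHalf_subset (line_mem (x := x) hy)))
    have e : (deriv f (x + y * Complex.I) * Complex.I).im = (deriv f (x + y * Complex.I)).re := by
      simp
    rw [← e]
    exact h1
  apply monotoneOn_of_deriv_nonneg (convex_Ioi _)
  · exact fun y hy => (hder y hy).continuousAt.continuousWithinAt
  · rw [interior_Ioi]
    exact fun y hy => (hder y hy).differentiableAt.differentiableWithinAt
  · rw [interior_Ioi]
    intro y hy
    rw [(hder y hy).deriv]
    exact (hre _ (line_mem hy)).le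

/-- The tangent direction turns to the left along horizontal lines. -/
theorem im_deriv_mul_conj_nonneg (h : IsConvexMap α U f)
    (hre : ∀ z ∈ upperHalf, 0 < (deriv f z).re) {z : ℂ} (hz : z ∈ upperHalf) {a : ℝ}
    (ha : 0 ≤ a) : 0 ≤ (deriv f (z + a) * (starRingEnd ℂ) (deriv f z)).im := by
  rcases ha.eq_or_lt with rfl | ha
  · simp [Complex.mul_im]
    linarith [mul_comm (deriv f z).re (deriv f z).im]
  have hza : z + a ∈ upperHalf := by simpa [mem_upperHalf] using hz
  -- The chord turns left of the tangent at `z`, and the tangent at `z + a` turns left of the chord.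
  -- All three have positive real part, so the two turns add up.
  have h1 := h.im_sub_div_deriv_nonneg hz a
  have h2 := h.im_sub_div_deriv_nonneg hza (-a)
  rw [im_div_nonneg_iff (h.deriv_ne_zero (h.upperHalf_subset hz))] at h1
  rw [im_div_nonneg_iff (h.deriv_ne_zero (h.upperHalf_subset hza))] at h2
  have e : z + a + (-a : ℝ) = z := by simp
  rw [e] at h2
  have hD : 0 < (f (z + a) - f z).re := by
    have h3 := h.re_strictMono_horizontal hre (y := z.im) hz (show z.re < z.re + a by linarith)
    simp only [Complex.ofReal_add] at h3
    have e1 : (z.re + z.im * Complex.I : ℂ) = z := Complex.re_add_im z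
    have e2 : (z.re + a + z.im * Complex.I : ℂ) = z + a := by
      rw [add_right_comm, e1]
    rw [e1, e2] at h3
    rw [Complex.sub_re]
    linarith
  have hp := hre z hz
  have hq := hre _ hza
  set D := f (z + a) - f z
  have e3 : f z - f (z + a) = -D := by simp [D]
  rw [e3] at h2
  set p := deriv f z
  set q := deriv f (z + a)
  simp only [Complex.mul_im, Complex.conj_re, Complex.conj_im, Complex.neg_re,
    Complex.neg_im] at h1 h2 ⊢
  have key : D.re * (q.re * -p.im + q.im * p.re) =
      q.re * (D.re * -p.im + D.im * p.re) + p.re * (-D.re * -q.im + -D.im * q.re) := by ring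
  by_contra! hneg
  nlinarith [mul_nonneg hq.le h1, mul_nonneg hp.le h2, mul_pos_of_neg_of_neg hneg (neg_lt_zero.2 hD)]

theorem sin_arg_sub_arg (q p : ℂ) :
    ‖q‖ * ‖p‖ * Real.sin (q.arg - p.arg) = (q * (starRingEnd ℂ) p).im := by
  rw [Real.sin_sub, Complex.mul_im, Complex.conj_re, Complex.conj_im,
    ← Complex.norm_mul_cos_arg q, ← Complex.norm_mul_cos_arg p, ← Complex.norm_mul_sin_arg q,
    ← Complex.norm_mul_sin_arg p]
  ring

theorem arg_deriv_mono (h : IsConvexMap α U f)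
    (hre : ∀ z ∈ upperHalf, 0 < (deriv f z).re) {z : ℂ} (hz : z ∈ upperHalf) {a : ℝ}
    (ha : 0 ≤ a) : (deriv f z).arg ≤ (deriv f (z + a)).arg := by
  have hza : z + a ∈ upperHalf := by simpa [mem_upperHalf] using hz
  have h1 := h.im_deriv_mul_conj_nonneg hre hz ha
  rw [← sin_arg_sub_arg] at h1
  have hp := abs_lt.1 (Complex.abs_arg_lt_pi_div_two_iff.2 (Or.inl (hre z hz)))
  have hq := abs_lt.1 (Complex.abs_arg_lt_pi_div_two_iff.2 (Or.inl (hre _ hza)))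
  by_contra! hlt
  have h2 := Real.sin_neg_of_neg_of_neg_pi_lt (x := (deriv f (z + a)).arg - (deriv f z).arg)
    (by linarith) (by linarith)
  have h3 : 0 < ‖deriv f (z + a)‖ * ‖deriv f z‖ :=
    mul_pos (norm_pos_iff.2 (h.deriv_ne_zero (h.upperHalf_subset hza)))
      (norm_pos_iff.2 (h.deriv_ne_zero (h.upperHalf_subset hz)))
  nlinarith

/-- Since `arg f'` increases to the right, `Im (f'' / f') ≥ 0`; by Cauchy–Riemann for `log f'` this
says that `log |f'|` decreases upwards. -/
theorem norm_deriv_antitone (h : IsConvexMap α U f)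
    (hre : ∀ z ∈ upperHalf, 0 < (deriv f z).re) {x s t : ℝ} (hs : 0 < s) (hst : s ≤ t) :
    ‖deriv f (x + t * Complex.I)‖ ≤ ‖deriv f (x + s * Complex.I)‖ := by
  have hmem : ∀ y : ℝ, s ≤ y → (x + y * Complex.I : ℂ) ∈ upperHalf :=
    fun y hy => line_mem (hs.trans_le hy)
  have hdd : ∀ z ∈ upperHalf, HasDerivAt (deriv f) (deriv (deriv f) z) z := fun z hz =>
    (h.analyticAt_deriv (h.upperHalf_subset hz)).differentiableAt.hasDerivAt
  have hder : ∀ y : ℝ, s ≤ y → HasDerivAt (fun y : ℝ => Complex.normSq (deriv f (x + y * Complex.I)))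
      (2 * (deriv (deriv f) (x + y * Complex.I) * Complex.I *
        (starRingEnd ℂ) (deriv f (x + y * Complex.I))).re) y := by
    intro y hy
    exact hasDerivAt_normSq_comp (hasDerivAt_line (hdd _ (hmem y hy)))
  have hN : ∀ z ∈ upperHalf, 0 ≤ (deriv (deriv f) z * (starRingEnd ℂ) (deriv f z)).im := by
    intro z hz
    have h1 : HasDerivAt (fun a : ℝ => deriv f (z + a * 1)) (deriv (deriv f) z * 1) 0 :=
      hasDerivAt_line (by simpa using hdd z hz)
    have h2 := h1.mul_const ((starRingEnd ℂ) (deriv f z))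
    have h3 : HasDerivAt (fun a : ℝ => (deriv f (z + a * 1) * (starRingEnd ℂ) (deriv f z)).im)
        (deriv (deriv f) z * 1 * (starRingEnd ℂ) (deriv f z)).im 0 :=
      Complex.imCLM.hasFDerivAt.comp_hasDerivAt (0 : ℝ) h2
    simp only [mul_one] at h3
    have h5 := hasDerivAt_iff_tendsto_slope.1 h3
    refine ge_of_tendsto (h5.mono_left (nhdsWithin_mono (0 : ℝ) (s := Set.Ioi 0) ?_)) ?_
    · intro t ht
      exact ne_of_gt (show (0 : ℝ) < t from ht)
    · filter_upwards [self_mem_nhdsWithin] with τ hpos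
      have hpos' : (0 : ℝ) < τ := hpos
      rw [slope_def_field]
      have h6 := h.im_deriv_mul_conj_nonneg hre hz hpos'.le
      have h7 : (deriv f (z + (0 : ℝ)) * (starRingEnd ℂ) (deriv f z)).im = 0 := by
        simp [Complex.mul_im]
        ring
      rw [h7, sub_zero, sub_zero]
      exact div_nonneg h6 hpos'.le
  have hanti : AntitoneOn (fun y : ℝ => Complex.normSq (deriv f (x + y * Complex.I)))
      (Set.Ici s) := by
    apply antitoneOn_of_deriv_nonpos (convex_Ici s)
    · intro y hy
      exact (hder y hy).continuousAt.continuousWithinAt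
    · intro y hy
      exact (hder y (interior_subset hy)).differentiableAt.differentiableWithinAt
    · intro y hy
      have hy' : s ≤ y := interior_subset (s := Set.Ici s) hy
      rw [(hder y hy').deriv]
      have h1 := hN _ (hmem y hy')
      simp at h1 ⊢
      linarith
  have := hanti (Set.self_mem_Ici) (show t ∈ Set.Ici s from hst) hst
  simp only [Complex.normSq_eq_norm_sq] at this
  exact (sq_le_sq₀ (norm_nonneg _) (norm_nonneg _)).1 this

theorem norm_deriv_high_le (h : IsConvexMap α U f)
    (hre : ∀ z ∈ upperHalf, 0 < (deriv f z).re) {r Y x : ℝ} (hr : 0 < r) (hY : r ≤ Y)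
    (hx : |x| ≤ 2 * Y) :
    ‖deriv f (x + Y * Complex.I)‖ ≤ 6 * ‖deriv f (r * Complex.I)‖ := by
  have h1 := harnack_horizontal h.differentiableOn_deriv hre (x := x) (x' := 0) (hr.trans_le hY)
    (by simpa using hx)
  have h2 := h.norm_deriv_antitone hre (x := 0) hr hY
  simp only [Complex.ofReal_zero, zero_add] at h1 h2
  linarith

/-- Climbing the axis from `ir` to `iY` costs a factor `Y / r`, crossing at height `Y` a factor `6`,
and descending to `x + iy` nothing. -/
theorem norm_deriv_lower (h : IsConvexMap α U f)
    (hre : ∀ z ∈ upperHalf, 0 < (deriv f z).re) {r Y x y : ℝ} (hr : 0 < r) (hrY : r ≤ Y)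
    (hx : |x| ≤ 2 * Y) (hy : 0 < y) (hyY : y ≤ Y) :
    r * ‖deriv f (r * Complex.I)‖ ≤ 6 * Y * ‖deriv f (x + y * Complex.I)‖ := by
  have h1 := (harnack_vertical h.differentiableOn_deriv hre 0 hr hrY).1
  have h2 := harnack_horizontal h.differentiableOn_deriv hre (x := 0) (x' := x) (hr.trans_le hrY)
    (by simpa using hx)
  have h3 := h.norm_deriv_antitone hre (x := x) hy hyY
  simp only [Complex.ofReal_zero, zero_add] at h1 h2
  have hY : 0 < Y := hr.trans_le hrY
  nlinarith

/-- `13 = 12 + 1`: at height `Y` a length at most `2Y` with `|f'| ≤ 6 |f' (ir)|`, and on the axis a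
length at most `Y` with `|f'| ≤ |f' (ir)|`. -/
theorem norm_sub_high_le (h : IsConvexMap α U f)
    (hre : ∀ z ∈ upperHalf, 0 < (deriv f z).re) {r Y x : ℝ} (hr : 0 < r) (hY : r ≤ Y)
    (hx : |x| ≤ 2 * Y) :
    ‖f (x + Y * Complex.I) - f (r * Complex.I)‖ ≤ 13 * Y * ‖deriv f (r * Complex.I)‖ := by
  have hY0 : 0 < Y := hr.trans_le hY
  set M := ‖deriv f (r * Complex.I)‖
  have h1 : ‖f (x + Y * Complex.I) - f ((0 : ℝ) + Y * Complex.I)‖ ≤ 6 * M * ‖x - 0‖ := by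
    refine Convex.norm_image_sub_le_of_norm_hasDerivWithin_le (𝕜 := ℝ)
      (f := fun s : ℝ => f (s + Y * Complex.I)) (s := Set.Icc (-(2 * Y)) (2 * Y))
      (f' := fun s : ℝ => deriv f (s + Y * Complex.I))
      (fun s _ => (h.hasDerivAt_horizontal
        (h.upperHalf_subset (line_mem hY0))).hasDerivWithinAt)
      (fun s hs => h.norm_deriv_high_le hre hr hY (abs_le.2 hs)) (convex_Icc _ _)
      ⟨by linarith, by linarith⟩ (abs_le.1 hx)
  have h2 : ‖f ((0 : ℝ) + Y * Complex.I) - f ((0 : ℝ) + r * Complex.I)‖ ≤ M * ‖Y - r‖ := by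
    refine Convex.norm_image_sub_le_of_norm_hasDerivWithin_le (𝕜 := ℝ)
      (f := fun s : ℝ => f ((0 : ℝ) + s * Complex.I)) (s := Set.Ici r)
      (f' := fun s : ℝ => deriv f ((0 : ℝ) + s * Complex.I) * Complex.I)
      (fun s hs => (h.hasDerivAt_vertical
        (h.upperHalf_subset (line_mem (hr.trans_le hs)))).hasDerivWithinAt)
      (fun s hs => ?_) (convex_Ici _) Set.self_mem_Ici hY
    rw [norm_mul, Complex.norm_I, mul_one]
    simpa using h.norm_deriv_antitone hre (x := 0) hr hs
  have hM : 0 ≤ M := norm_nonneg _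
  rw [Real.norm_eq_abs] at h1 h2
  rw [abs_of_nonneg (sub_nonneg.2 hY)] at h2
  rw [sub_zero] at h1
  simp only [Complex.ofReal_zero, zero_add] at h1 h2
  have h3 := norm_sub_le_norm_sub_add_norm_sub (f (x + Y * Complex.I)) (f (Y * Complex.I))
    (f (r * Complex.I))
  have h4 : 6 * M * |x| ≤ 6 * M * (2 * Y) := by gcongr
  have h5 : M * (Y - r) ≤ M * Y := by
    gcongr
    linarith
  linarith

/-- A bound uniform down to the real axis, where `f'` is not controlled from above. In Cauchy's
theorem on `[x, x + Y] × [y, Y]`, the bottom integral dominates `Y Re f (x + iy)` because `Re f`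
increases to the right. The top costs `13`; the right side costs `13` because `Im f` increases
upwards. The left side is integrated by parts, costing `13 + 6`, as Harnack bounds `t |f' (x + it)|`
by `Y |f' (x + iY)|`. In total `45`. -/
theorem re_sub_le_of_upperHalf (h : IsConvexMap α U f)
    (hre : ∀ z ∈ upperHalf, 0 < (deriv f z).re) {r Y x y : ℝ} (hr : 0 < r) (hrY : r ≤ Y)
    (hx : |x| ≤ Y) (hy : 0 < y) (hyY : y ≤ Y) :
    (f (x + y * Complex.I)).re - (f (r * Complex.I)).re ≤
      45 * Y * ‖deriv f (r * Complex.I)‖ := by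
  have hY0 : 0 < Y := hr.trans_le hrY
  set M := ‖deriv f (r * Complex.I)‖ with hM
  have hM0 : 0 ≤ M := norm_nonneg _
  set w₀ := f (r * Complex.I)
  have hmU : ∀ {s t : ℝ}, 0 < t → (s + t * Complex.I : ℂ) ∈ U :=
    fun ht => h.upperHalf_subset (line_mem ht)
  have hrect := integral_re_rect (F := f) (a := x) (b := x + Y) (s := y) (t := Y) (by linarith) hyY
    (fun s _ t ht => (h.differentiableAt (hmU (hy.trans_le ht.1))).continuousAt)
    (fun s _ t ht => h.differentiableAt (hmU (hy.trans ht.1)))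
  have hx' := abs_le.1 hx
  have hhigh : ∀ s ∈ Set.Icc x (x + Y), ‖f (s + Y * Complex.I) - w₀‖ ≤ 13 * Y * M := by
    intro s hs
    exact h.norm_sub_high_le hre hr hrY (abs_le.2 ⟨by linarith [hs.1], by linarith [hs.2]⟩)
  have hcx : ∀ t : ℝ, 0 < t → Continuous fun s : ℝ => (f (s + t * Complex.I)).re := by
    intro t ht
    refine Complex.continuous_re.comp (continuous_iff_continuousAt.2 fun s => ?_)
    exact (h.hasDerivAt_horizontal (hmU ht)).continuousAt
  have hcy : ∀ s : ℝ, ContinuousOn (fun t : ℝ => (f (s + t * Complex.I)).im) (Set.Icc y Y) := by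
    intro s t ht
    exact (Complex.continuous_im.continuousAt.comp
      (h.hasDerivAt_vertical (hmU (hy.trans_le ht.1))).continuousAt).continuousWithinAt
  have hiy : ∀ s : ℝ, IntervalIntegrable (fun t : ℝ => (f (s + t * Complex.I)).im) volume y Y := by
    intro s
    apply ContinuousOn.intervalIntegrable
    rw [Set.uIcc_of_le hyY]
    exact hcy s
  have i1 : Y * (f (x + y * Complex.I)).re ≤ ∫ s in x..x + Y, (f (s + y * Complex.I)).re := by
    have := intervalIntegral.integral_mono_on (a := x) (b := x + Y) (μ := volume)
      (f := fun _ => (f (x + y * Complex.I)).re) (g := fun s : ℝ => (f (s + y * Complex.I)).re)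
      (by linarith) (by simp) ((hcx y hy).intervalIntegrable _ _)
      (fun s hs => (h.re_strictMono_horizontal hre hy).monotone hs.1)
    rw [intervalIntegral.integral_const, smul_eq_mul] at this
    simpa using this
  have i2 : ∫ s in x..x + Y, (f (s + Y * Complex.I)).re ≤ Y * (w₀.re + 13 * Y * M) := by
    have := intervalIntegral.integral_mono_on (a := x) (b := x + Y) (μ := volume)
      (g := fun _ => w₀.re + 13 * Y * M) (f := fun s : ℝ => (f (s + Y * Complex.I)).re)
      (by linarith) ((hcx Y hY0).intervalIntegrable _ _) (by simp)
      (fun s hs => by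
        have h1 := (Complex.re_le_norm _).trans (hhigh s hs)
        rw [Complex.sub_re] at h1
        linarith)
    rw [intervalIntegral.integral_const, smul_eq_mul] at this
    simpa using this
  have i3 : ∫ t in y..Y, (f (↑(x + Y) + t * Complex.I)).im ≤ (Y - y) * (w₀.im + 13 * Y * M) := by
    have := intervalIntegral.integral_mono_on (a := y) (b := Y) (μ := volume)
      (g := fun _ => w₀.im + 13 * Y * M) (f := fun t : ℝ => (f (↑(x + Y) + t * Complex.I)).im)
      hyY (hiy _) (by simp)
      (fun t ht => by
        have h1 := (Complex.im_le_norm _).trans (hhigh (x + Y) ⟨by linarith, le_rfl⟩)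
        rw [Complex.sub_im] at h1
        have h2 := h.im_monotoneOn_vertical hre (x + Y) (show t ∈ Set.Ioi 0 from hy.trans_le ht.1)
          (show Y ∈ Set.Ioi 0 from hY0) ht.2
        simp only at h2
        linarith)
    rwa [intervalIntegral.integral_const, smul_eq_mul] at this
  have i4 : (Y - y) * (f (x + Y * Complex.I)).im ≤
      (∫ t in y..Y, (f (x + t * Complex.I)).im) + (Y - y) * (6 * Y * M) := by
    have hder : ∀ t : ℝ, y ≤ t → HasDerivAt (fun t : ℝ => (t - y) * (f (x + t * Complex.I)).im)
        (1 * (f (x + t * Complex.I)).im + (t - y) * (deriv f (x + t * Complex.I)).re) t := by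
      intro t ht
      have h1 := Complex.imCLM.hasFDerivAt.comp_hasDerivAt t
        (h.hasDerivAt_vertical (hmU (s := x) (hy.trans_le ht)))
      have e : (deriv f (x + t * Complex.I) * Complex.I).im =
          (deriv f (x + t * Complex.I)).re := by simp
      have h2 : HasDerivAt (fun t : ℝ => (f (x + t * Complex.I)).im)
          (deriv f (x + t * Complex.I)).re t := by
        rw [← e]
        exact h1
      exact ((hasDerivAt_id t).sub_const y).mul h2
    have := intervalIntegral.sub_le_integral_of_hasDeriv_right_of_le hyY
      (g := fun t : ℝ => (t - y) * (f (x + t * Complex.I)).im)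
      (φ := fun t : ℝ => (f (x + t * Complex.I)).im + 6 * Y * M)
      (fun t ht => (hder t ht.1).continuousAt.continuousWithinAt)
      (fun t ht => (hder t ht.1.le).hasDerivWithinAt)
      (by
        apply IntegrableOn.add
        · exact (hcy x).integrableOn_Icc
        · exact continuousOn_const.integrableOn_Icc)
      (fun t ht => by
        have ht0 : 0 < t := hy.trans ht.1
        have h1 := (harnack_vertical h.differentiableOn_deriv hre x ht0 ht.2.le).1
        have h2 := h.norm_deriv_high_le hre (x := x) hr hrY (hx.trans (by linarith))
        have h3 := Complex.re_le_norm (deriv f (x + t * Complex.I))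
        have h4 := hre _ (line_mem (x := x) ht0)
        have h5 : Y * ‖deriv f (x + Y * Complex.I)‖ ≤ Y * (6 * M) := by gcongr
        have h6 : (t - y) * (deriv f (x + t * Complex.I)).re ≤
            t * ‖deriv f (x + t * Complex.I)‖ := by
          apply mul_le_mul (by linarith) h3 h4.le ht0.le
        linarith)
    rw [intervalIntegral.integral_add (hiy x) (by simp), intervalIntegral.integral_const,
      smul_eq_mul] at this
    simpa using this
  rw [intervalIntegral.integral_sub (hiy _) (hiy _)] at hrect
  have h5 := (Complex.abs_im_le_norm _).trans (hhigh x ⟨le_rfl, by linarith⟩)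
  rw [Complex.sub_im] at h5
  have h6 := (abs_le.1 h5).1
  have h7 : (Y - y) * (w₀.im - 13 * Y * M) ≤ (Y - y) * (f (x + Y * Complex.I)).im := by
    gcongr
    linarith
  have h8 : (Y - y) * (32 * Y * M) ≤ Y * (32 * Y * M) := by
    gcongr
    linarith
  have h9 : Y * ((f (x + y * Complex.I)).re - w₀.re) ≤ Y * (45 * Y * M) := by
    nlinarith
  exact le_of_mul_le_mul_left h9 hY0

theorem re_deriv_reflectMap_pos (h : IsConvexMap α U f)
    (hre : ∀ z ∈ upperHalf, 0 < (deriv f z).re) :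
    ∀ z ∈ upperHalf, 0 < (deriv (reflectMap f) z).re := by
  intro z hz
  have hz' : -(starRingEnd ℂ) z ∈ upperHalf := by simpa [mem_upperHalf] using hz
  rw [h.deriv_reflectMap (h.upperHalf_subset hz'), Complex.conj_re]
  exact hre _ hz'

theorem abs_re_sub_le (h : IsConvexMap α U f)
    (hre : ∀ z ∈ upperHalf, 0 < (deriv f z).re) {r : ℝ} (hr : 0 < r) {z : ℂ}
    (hz : z ∈ puncturedClosedHalfPlane α) :
    |(f z).re - (f (r * Complex.I)).re| ≤ 45 * max ‖z‖ r * ‖deriv f (r * Complex.I)‖ := by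
  have hfc : ContinuousAt f z := (h.differentiableAt (h.subset hz)).continuousAt
  refine le_of_continuousAt_of_upperHalf
    (u := fun z => |(f z).re - (f (r * Complex.I)).re|)
    (v := fun z => 45 * max ‖z‖ r * ‖deriv f (r * Complex.I)‖) hz ?_ ?_ fun w hw => ?_
  · exact ((Complex.continuous_re.continuousAt.comp hfc).sub continuousAt_const).abs
  · fun_prop
  · have hw' : 0 < w.im := hw
    have hn1 := Complex.abs_re_le_norm w
    have hn2 := Complex.im_le_norm w
    have hmx := le_max_left ‖w‖ r
    rw [abs_le']
    constructor
    · have := h.re_sub_le_of_upperHalf hre hr (le_max_right ‖w‖ r) (hn1.trans hmx) hw'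
        (hn2.trans hmx)
      rwa [Complex.re_add_im] at this
    · have hmU : (r * Complex.I : ℂ) ∈ U :=
        h.upperHalf_subset (by simpa [mem_upperHalf] using hr)
      have := h.reflect.re_sub_le_of_upperHalf (h.re_deriv_reflectMap_pos hre) (x := -w.re)
        hr (le_max_right ‖w‖ r) (by rw [abs_neg]; exact hn1.trans hmx) hw'
        (hn2.trans hmx)
      rw [h.deriv_reflectMap (by simpa using hmU)] at this
      have e : -(starRingEnd ℂ) (((-w.re : ℝ) : ℂ) + w.im * Complex.I) = w := by
        apply Complex.ext <;> simp
      simp only [reflectMap] at this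
      rw [e] at this
      simp at this
      linarith

/-- Upward monotonicity of `Im f` compares with height `max ‖z‖ r`. It gives no lower bound, which
is why `re_mul_sub_le` asks for `E.im ≤ 0`. -/
theorem im_sub_le (h : IsConvexMap α U f)
    (hre : ∀ z ∈ upperHalf, 0 < (deriv f z).re) {r : ℝ} (hr : 0 < r) {z : ℂ}
    (hz : z ∈ puncturedClosedHalfPlane α) :
    (f z).im - (f (r * Complex.I)).im ≤ 13 * max ‖z‖ r * ‖deriv f (r * Complex.I)‖ := by
  have hfc : ContinuousAt f z := (h.differentiableAt (h.subset hz)).continuousAt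
  refine le_of_continuousAt_of_upperHalf
    (u := fun z => (f z).im - (f (r * Complex.I)).im)
    (v := fun z => 13 * max ‖z‖ r * ‖deriv f (r * Complex.I)‖) hz ?_ ?_ fun w hw => ?_
  · exact (Complex.continuous_im.continuousAt.comp hfc).sub continuousAt_const
  · fun_prop
  · have hw' : 0 < w.im := hw
    have hmx := le_max_left ‖w‖ r
    have hY0 : 0 < max ‖w‖ r := hr.trans_le (le_max_right _ _)
    have h1 := h.im_monotoneOn_vertical hre w.re (show w.im ∈ Set.Ioi 0 from hw')
      (show max ‖w‖ r ∈ Set.Ioi 0 from hY0) ((Complex.im_le_norm w).trans hmx)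
    simp only [Complex.re_add_im] at h1
    have h2 := h.norm_sub_high_le hre hr (le_max_right ‖w‖ r) (x := w.re)
      (by linarith [Complex.abs_re_le_norm w])
    have h3 := (Complex.im_le_norm _).trans h2
    rw [Complex.sub_im] at h3
    linarith

end IsConvexMap

/-! ### The argument of `f'` -/

namespace IsConvexMap

variable {α : ℂ} {U : Set ℂ} {f : ℂ → ℂ}

theorem re_deriv_nonneg (h : IsConvexMap α U f) (hre : ∀ z ∈ upperHalf, 0 < (deriv f z).re)
    {z : ℂ} (hz : z ∈ puncturedClosedHalfPlane α) : 0 ≤ (deriv f z).re :=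
  le_of_continuousAt_of_upperHalf (u := fun _ => 0) (v := fun z => (deriv f z).re) hz
    continuousAt_const
    (Complex.continuous_re.continuousAt.comp (h.analyticAt_deriv (h.subset hz)).continuousAt)
    fun w hw => (hre w hw).le

theorem deriv_mem_slitPlane (h : IsConvexMap α U f)
    (hre : ∀ z ∈ upperHalf, 0 < (deriv f z).re) {z : ℂ} (hz : z ∈ puncturedClosedHalfPlane α) :
    deriv f z ∈ Complex.slitPlane :=
  mem_slitPlane_of_re_nonneg (h.re_deriv_nonneg hre hz) (h.deriv_ne_zero (h.subset hz))

theorem abs_arg_deriv_le (h : IsConvexMap α U f)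
    (hre : ∀ z ∈ upperHalf, 0 < (deriv f z).re) {z : ℂ} (hz : z ∈ puncturedClosedHalfPlane α) :
    |(deriv f z).arg| ≤ Real.pi / 2 :=
  Complex.abs_arg_le_pi_div_two_iff.2 (h.re_deriv_nonneg hre hz)

theorem abs_arg_deriv_lt (hre : ∀ z ∈ upperHalf, 0 < (deriv f z).re) {z : ℂ}
    (hz : z ∈ upperHalf) : |(deriv f z).arg| < Real.pi / 2 :=
  Complex.abs_arg_lt_pi_div_two_iff.2 (Or.inl (hre z hz))

theorem continuousAt_arg_deriv (h : IsConvexMap α U f)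
    (hre : ∀ z ∈ upperHalf, 0 < (deriv f z).re) {z : ℂ} (hz : z ∈ puncturedClosedHalfPlane α) :
    ContinuousAt (fun z => (deriv f z).arg) z :=
  (Complex.continuousAt_arg (h.deriv_mem_slitPlane hre hz)).comp
    (h.analyticAt_deriv (h.subset hz)).continuousAt

theorem differentiableAt_log_deriv (h : IsConvexMap α U f)
    (hre : ∀ z ∈ upperHalf, 0 < (deriv f z).re) {z : ℂ} (hz : z ∈ puncturedClosedHalfPlane α) :
    DifferentiableAt ℂ (fun z => Complex.log (deriv f z)) z :=
  (h.analyticAt_deriv (h.subset hz)).differentiableAt.clog (h.deriv_mem_slitPlane hre hz)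

theorem arg_deriv_mono_closed (h : IsConvexMap α U f)
    (hre : ∀ z ∈ upperHalf, 0 < (deriv f z).re) {z : ℂ} {a : ℝ} (ha : 0 ≤ a)
    (hz : z ∈ puncturedClosedHalfPlane α) (hza : z + a ∈ puncturedClosedHalfPlane α) :
    (deriv f z).arg ≤ (deriv f (z + a)).arg :=
  le_of_continuousAt_of_upperHalf (u := fun z => (deriv f z).arg)
    (v := fun z => (deriv f (z + a)).arg) hz (h.continuousAt_arg_deriv hre hz)
    ((h.continuousAt_arg_deriv hre hza).comp (f := fun z : ℂ => z + a) (by fun_prop))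
    fun _ hw => h.arg_deriv_mono hre hw ha

/-- On the imaginary axis above `I` the argument of `f'` stays away from `-π / 2`. -/
theorem arg_deriv_axis_ge (h : IsConvexMap α U f)
    (hre : ∀ z ∈ upperHalf, 0 < (deriv f z).re) {y : ℝ} (hy : 1 ≤ y) :
    -(Real.pi / 2) + ((deriv f Complex.I).arg + Real.pi / 2) / 2 ≤
      (deriv f (y * Complex.I)).arg := by
  have hI : Complex.I ∈ upperHalf := by simp [mem_upperHalf]
  have hκ0 := abs_lt.1 (abs_arg_deriv_lt hre hI)
  set κ : ℝ := (deriv f Complex.I).arg + Real.pi / 2 with hκ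
  have hpi := Real.pi_pos
  have hmem : ∀ s : ℂ, 0 ≤ s.re → Complex.I * s + Complex.I ∈ upperHalf := by
    intro s hs
    simp only [mem_upperHalf, Complex.add_im, Complex.mul_im, Complex.I_re, Complex.I_im]
    linarith
  rcases hy.eq_or_lt with rfl | hy
  · simp only [Complex.ofReal_one, one_mul]
    linarith
  -- A two-constants argument. On the line `Im = 1`, `arg f'` is at least `κ - π/2` to the right of
  -- `i` and at least `-π/2` to the left; adding `(κ/π) arg s`, which is `∓κ/2` there, makes both
  -- bounds `κ/2 - π/2`. On the axis `arg s = 0`.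
  set G : ℂ → ℂ := fun s => Complex.exp (Complex.I *
    (Complex.log (deriv f (Complex.I * s + Complex.I)) + ((κ / Real.pi : ℝ) : ℂ) * Complex.log s))
    with hG
  have hnorm : ∀ s, ‖G s‖ = Real.exp (-((deriv f (Complex.I * s + Complex.I)).arg +
      κ / Real.pi * s.arg)) := by
    intro s
    rw [hG, Complex.norm_exp]
    congr 1
    simp only [Complex.mul_re, Complex.I_re, Complex.I_im, Complex.add_im, Complex.log_im,
      Complex.im_ofReal_mul]
    ring
  have hslit : ∀ s : ℂ, 0 ≤ s.re → s ≠ 0 → s ∈ Complex.slitPlane :=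
    fun s hs h0 => mem_slitPlane_of_re_nonneg hs h0
  have hd : ∀ s : ℂ, 0 ≤ s.re → s ≠ 0 → DifferentiableAt ℂ G s := by
    intro s hs h0
    have h1 : DifferentiableAt ℂ (fun s => Complex.log (deriv f (Complex.I * s + Complex.I))) s :=
      (h.differentiableAt_log_deriv hre (h.upperHalf_subset_punctured (hmem s hs))).comp s
        (f := fun s : ℂ => Complex.I * s + Complex.I) (by fun_prop)
    exact ((h1.add ((differentiableAt_id.clog (hslit s hs h0)).const_mul _)).const_mul _).cexp
  have hkey := norm_le_of_bounded_of_exceptional (G := G) (q := 0)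
    (A := Real.exp (Real.pi / 2 - κ / 2)) (B := Real.exp (Real.pi / 2 + κ / 2)) (Real.exp_pos _)
    (fun s hs => (hd s (le_of_lt hs) (by
      rintro rfl
      simp at hs)).differentiableWithinAt)
    (fun s hs h0 => (hd s hs (by simpa using h0)).continuousAt.continuousWithinAt)
    (fun s hs _ => by
      rw [hnorm, Real.exp_le_exp]
      have h1 := abs_lt.1 (abs_arg_deriv_lt hre (hmem s hs))
      have h2 := abs_le.1 (Complex.abs_arg_le_pi_div_two_iff.2 hs)
      have h3 : κ / Real.pi * -(Real.pi / 2) ≤ κ / Real.pi * s.arg :=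
        mul_le_mul_of_nonneg_left h2.1 (by apply div_nonneg <;> linarith)
      have h4 : κ / Real.pi * -(Real.pi / 2) = -(κ / 2) := by field_simp
      linarith)
    (fun t ht => by
      rw [hnorm, Real.exp_le_exp]
      have e : Complex.I * (t * Complex.I) + Complex.I = Complex.I + ((-t : ℝ) : ℂ) := by
        rw [mul_left_comm, Complex.I_mul_I]
        push_cast
        ring
      rcases lt_or_gt_of_ne ht with ht | ht
      · have h1 : (t * Complex.I).arg = -(Real.pi / 2) := by
          rw [Complex.arg_eq_neg_pi_div_two_iff]
          simpa using ht
        have h2 := h.arg_deriv_mono hre hI (a := -t) (by linarith)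
        rw [h1, e]
        have h4 : κ / Real.pi * -(Real.pi / 2) = -(κ / 2) := by field_simp
        linarith
      · have h1 : (t * Complex.I).arg = Real.pi / 2 := by
          rw [Complex.arg_eq_pi_div_two_iff]
          simpa using ht
        have h2 := abs_lt.1 (abs_arg_deriv_lt hre (hmem (t * Complex.I) (by simp)))
        rw [h1]
        have h4 : κ / Real.pi * (Real.pi / 2) = κ / 2 := by field_simp
        linarith)
    (s := ((y - 1 : ℝ) : ℂ)) (by simpa using hy)
  rw [hnorm, Real.exp_le_exp, Complex.arg_ofReal_of_nonneg (by linarith)] at hkey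
  have e : Complex.I * ((y - 1 : ℝ) : ℂ) + Complex.I = y * Complex.I := by
    push_cast
    ring
  rw [e] at hkey
  linarith

/-- Otherwise monotonicity gives `arg f' ≤ -π/2` on all of the real line except possibly at `α`, and
Phragmén–Lindelöf carries this to `i`, against `Re f' > 0`. -/
theorem exists_real_arg_deriv_gt (h : IsConvexMap α U f)
    (hre : ∀ z ∈ upperHalf, 0 < (deriv f z).re) :
    ∃ x : ℝ, ‖α‖ < x ∧ -(Real.pi / 2) < (deriv f x).arg := by
  by_contra! hcon
  have hle : ∀ x : ℝ, (x : ℂ) ≠ α → (deriv f x).arg ≤ -(Real.pi / 2) := by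
    intro x hx
    have hbig : ‖α‖ < ‖α‖ + 1 + |x| := by linarith [abs_nonneg x]
    have hαre := Complex.re_le_norm α
    have h1 := h.arg_deriv_mono_closed hre (z := x) (a := ‖α‖ + 1 + |x| - x)
      (by linarith [le_abs_self x, norm_nonneg α]) (ofReal_mem x hx) (by
        rw [← Complex.ofReal_add, add_sub_cancel]
        exact ofReal_mem _ (ne_of_re_lt (hαre.trans_lt hbig)))
    rw [← Complex.ofReal_add, add_sub_cancel] at h1
    exact h1.trans (hcon _ hbig)
  set G : ℂ → ℂ := fun s => Complex.exp (-Complex.I * Complex.log (deriv f (Complex.I * s)))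
    with hG
  have hnorm : ∀ s, ‖G s‖ = Real.exp (deriv f (Complex.I * s)).arg := by
    intro s
    rw [hG, Complex.norm_exp]
    congr 1
    simp [Complex.log_im]
  have hmem : ∀ s : ℂ, 0 ≤ s.re → s ≠ (-α.re : ℝ) * Complex.I →
      Complex.I * s ∈ puncturedClosedHalfPlane α := by
    intro s hs hne
    refine mem_punctured.2 ⟨by simpa using hs, fun h0 => hne ?_⟩
    have hre0 := congrArg Complex.re h0
    have him0 := congrArg Complex.im h0
    have := h.im_nonpos
    simp at hre0 him0
    apply Complex.ext
    · simp
      linarith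
    · simp
      linarith
  have hd : ∀ s : ℂ, 0 ≤ s.re → s ≠ (-α.re : ℝ) * Complex.I → DifferentiableAt ℂ G s := by
    intro s hs h0
    have h1 : DifferentiableAt ℂ (fun s => Complex.log (deriv f (Complex.I * s))) s :=
      (h.differentiableAt_log_deriv hre (hmem s hs h0)).comp s
        (f := fun s : ℂ => Complex.I * s) (by fun_prop)
    exact (h1.const_mul _).cexp
  have hkey := norm_le_of_bounded_of_exceptional (G := G) (q := -α.re)
    (A := Real.exp (-(Real.pi / 2))) (B := Real.exp (Real.pi / 2)) (Real.exp_pos _)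
    (fun s hs => (hd s (le_of_lt hs) (by
      rintro rfl
      simp at hs)).differentiableWithinAt)
    (fun s hs h0 => (hd s hs h0).continuousAt.continuousWithinAt)
    (fun s hs h0 => by
      rw [hnorm, Real.exp_le_exp]
      exact (abs_le.1 (h.abs_arg_deriv_le hre (hmem s hs h0))).2)
    (fun t ht => by
      rw [hnorm, Real.exp_le_exp]
      have e : Complex.I * (t * Complex.I) = ((-t : ℝ) : ℂ) := by
        rw [mul_left_comm, Complex.I_mul_I]
        push_cast
        ring
      rw [e]
      refine hle _ fun h0 => ht ?_
      have := congrArg Complex.re h0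
      simp at this
      linarith)
    (s := 1) (by simp)
  rw [hnorm, Real.exp_le_exp, mul_one] at hkey
  have := abs_lt.1 (abs_arg_deriv_lt hre (z := Complex.I) (by simp [mem_upperHalf]))
  linarith

/-- Away from the left part of the real axis the argument of `f'` stays away from `-π / 2`. -/
theorem exists_arg_deriv_ge (h : IsConvexMap α U f)
    (hre : ∀ z ∈ upperHalf, 0 < (deriv f z).re) :
    ∃ c x₁ : ℝ, 0 < c ∧ c ≤ Real.pi / 8 ∧ 0 < x₁ ∧ ∀ z ∈ upperHalf,
      (0 ≤ z.re ∧ 1 ≤ z.im) ∨ x₁ ≤ z.re → -(Real.pi / 2) + 2 * c ≤ (deriv f z).arg := by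
  obtain ⟨x₁, hx₁, hx₁'⟩ := h.exists_real_arg_deriv_gt hre
  have hx0 : 0 < x₁ := (norm_nonneg α).trans_lt hx₁
  have hmem : ∀ y ∈ Set.Icc (0 : ℝ) 1,
      (x₁ + y * Complex.I : ℂ) ∈ puncturedClosedHalfPlane α := fun y hy =>
    abs_lt_of_punctured (by rwa [abs_of_pos hx0]) hy.1
  -- By the choice of `x₁` the minimum over the closed segment exceeds `-π/2` even if attained on
  -- the real axis; monotonicity spreads it to the right.
  obtain ⟨y₀, hy₀, hmin⟩ := isCompact_Icc.exists_isMinOn (s := Set.Icc (0 : ℝ) 1)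
    ⟨0, by simp⟩ (f := fun y : ℝ => (deriv f (x₁ + y * Complex.I)).arg) (fun y hy =>
      ((h.continuousAt_arg_deriv hre (hmem y hy)).comp
        (f := fun y : ℝ => (x₁ + y * Complex.I : ℂ)) (by fun_prop)).continuousWithinAt)
  have hy₀' : -(Real.pi / 2) < (deriv f (x₁ + y₀ * Complex.I)).arg := by
    rcases hy₀.1.eq_or_lt with h0 | h0
    · rw [← h0]
      simpa using hx₁'
    · exact (abs_lt.1 (abs_arg_deriv_lt hre (line_mem h0))).1
  have hI := abs_lt.1 (abs_arg_deriv_lt hre (z := Complex.I) (by simp [mem_upperHalf]))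
  set a := ((deriv f Complex.I).arg + Real.pi / 2) / 2 with ha
  set b := (deriv f (x₁ + y₀ * Complex.I)).arg + Real.pi / 2 with hb
  have ha0 : 0 < a := by rw [ha]; linarith
  have hb0 : 0 < b := by rw [hb]; linarith
  have hpi := Real.pi_pos
  refine ⟨min (min a b / 2) (Real.pi / 8), x₁, lt_min (half_pos (lt_min ha0 hb0)) (by linarith),
    min_le_right _ _, hx0, fun z hz hreg => ?_⟩
  have hz' : 0 < z.im := hz
  have hc1 : min (min a b / 2) (Real.pi / 8) ≤ min a b / 2 := min_le_left _ _
  have hc2 : min a b ≤ a := min_le_left _ _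
  have hc3 : min a b ≤ b := min_le_right _ _
  have hshift : ∀ x : ℝ, x ≤ z.re →
      (deriv f (x + z.im * Complex.I)).arg ≤ (deriv f z).arg := by
    intro x hx
    have h1 := h.arg_deriv_mono hre (line_mem (x := x) hz') (sub_nonneg.2 hx)
    have e : (x + z.im * Complex.I + ((z.re - x : ℝ) : ℂ) : ℂ) = z := by
      apply Complex.ext <;> simp
    rwa [e] at h1
  have htop : 1 ≤ z.im → 0 ≤ z.re → -(Real.pi / 2) + a ≤ (deriv f z).arg := by
    intro h1 h0
    have h2 := h.arg_deriv_axis_ge hre h1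
    have h3 := hshift 0 h0
    simp only [Complex.ofReal_zero, zero_add] at h3
    linarith
  by_cases h1 : 1 ≤ z.im
  · have h0 : 0 ≤ z.re := by
      rcases hreg with h | h
      · exact h.1
      · linarith
    linarith [htop h1 h0]
  · have hx : x₁ ≤ z.re := by
      rcases hreg with h | h
      · exact absurd h.2 h1
      · exact h
    have h2 := hshift x₁ hx
    have h3 := hmin (show z.im ∈ Set.Icc (0 : ℝ) 1 from ⟨hz'.le, (not_le.1 h1).le⟩)
    have h4 : (deriv f (x₁ + y₀ * Complex.I)).arg ≤
      (deriv f (x₁ + z.im * Complex.I)).arg := h3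
    linarith

end IsConvexMap

/-! ### The mean bound -/

/-- A point of the punctured half-plane whose image is a convex combination of images is bounded
by the corresponding convex combination of norms. -/
def HasMeanBound (α : ℂ) (f : ℂ → ℂ) : Prop :=
  ∃ C : ℝ, 0 ≤ C ∧ ∀ z₀ ∈ puncturedClosedHalfPlane α, ∀ (s : Finset ℕ) (w : ℕ → ℝ) (z : ℕ → ℂ),
    (∀ i ∈ s, 0 ≤ w i) → ∑ i ∈ s, w i = 1 → (∀ i ∈ s, z i ∈ puncturedClosedHalfPlane α) →
    f z₀ = ∑ i ∈ s, (w i : ℂ) * f (z i) → ‖z₀‖ ≤ C * (1 + ∑ i ∈ s, w i * ‖z i‖)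

namespace IsConvexMap

variable {α : ℂ} {U : Set ℂ} {f : ℂ → ℂ}

/-- Tilting by `c` makes the range symmetric: `|θ - c| ≤ π/2 - c`. -/
theorem sin_le_cos_sub {θ c : ℝ} (hc : 0 ≤ c) (h1 : -(Real.pi / 2) + 2 * c ≤ θ)
    (h2 : θ ≤ Real.pi / 2) : Real.sin c ≤ Real.cos (θ - c) := by
  rw [← Real.cos_pi_div_two_sub c, ← Real.cos_abs (θ - c)]
  refine Real.cos_le_cos_of_nonneg_of_le_pi (abs_nonneg _) (by linarith [Real.pi_pos]) ?_
  exact abs_le.2 ⟨by linarith, by linarith⟩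

/-- Along the segment `ir + t d` from `ir` to `z₀`, the factor in front turns the derivative into
`|d| Re (e^(-ic) f')`, at least `|d| sin c |f'|`. By `norm_deriv_lower`, `|f'| ≥ r |f' (ir)| / (6 (r
+ t |d|))`, and integrating this gives the logarithm. -/
theorem log_le_re_sub (h : IsConvexMap α U f) (hre : ∀ z ∈ upperHalf, 0 < (deriv f z).re)
    {c r : ℝ} (hc : 0 < c) (hc' : c ≤ Real.pi / 8) (hr : 0 < r) {z₀ : ℂ}
    (hz₀ : z₀ ∈ puncturedClosedHalfPlane α) (hne : z₀ ≠ r * Complex.I)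
    (harg : ∀ t ∈ Set.Ioo (0 : ℝ) 1, -(Real.pi / 2) + 2 * c ≤
      (deriv f (r * Complex.I + t * (z₀ - r * Complex.I))).arg) :
    Real.sin c / 6 * (r * ‖deriv f (r * Complex.I)‖) *
        Real.log ((r + ‖z₀ - r * Complex.I‖) / r) ≤
      (Complex.exp (-(c * Complex.I)) * ((starRingEnd ℂ) (z₀ - r * Complex.I) /
        ‖z₀ - r * Complex.I‖) * (f z₀ - f (r * Complex.I))).re := by
  set d := z₀ - r * Complex.I with hd
  set l := ‖d‖ with hl
  have hl0 : 0 < l := norm_pos_iff.2 (sub_ne_zero.2 hne)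
  set M := ‖deriv f (r * Complex.I)‖ with hM
  set E := Complex.exp (-(c * Complex.I)) * ((starRingEnd ℂ) d / l) with hE
  have hz0im : 0 ≤ z₀.im := hz₀.1
  have hcoord : ∀ t : ℝ, (r * Complex.I + t * d : ℂ) =
      ((t * z₀.re : ℝ) : ℂ) + (((1 - t) * r + t * z₀.im : ℝ) : ℂ) * Complex.I := by
    intro t
    apply Complex.ext
    · simp [hd]
    · simp [hd]
      ring
  have hmem : ∀ t ∈ Set.Ico (0 : ℝ) 1, (r * Complex.I + t * d : ℂ) ∈ upperHalf := by
    intro t ht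
    rw [hcoord]
    apply line_mem
    have := mul_pos (sub_pos.2 ht.2) hr
    have := mul_nonneg ht.1 hz0im
    linarith
  have hmemU : ∀ t ∈ Set.Icc (0 : ℝ) 1, (r * Complex.I + t * d : ℂ) ∈ U := by
    intro t ht
    rcases ht.2.eq_or_lt with rfl | h1
    · have : (r * Complex.I + ((1 : ℝ) : ℂ) * d : ℂ) = z₀ := by simp [hd]
      rw [this]
      exact h.subset hz₀
    · exact h.upperHalf_subset (hmem t ⟨ht.1, h1⟩)
  have hder : ∀ t ∈ Set.Icc (0 : ℝ) 1, HasDerivAt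
      (fun t : ℝ => (E * f (r * Complex.I + t * d)).re -
        Real.sin c / 6 * (r * M) * Real.log (r + t * l))
      ((E * (deriv f (r * Complex.I + t * d) * d)).re -
        Real.sin c / 6 * (r * M) * (l / (r + t * l))) t := by
    intro t ht
    have h1 := (hasDerivAt_line (h.differentiableAt (hmemU t ht)).hasDerivAt).const_mul E
    have h2 : HasDerivAt (fun t : ℝ => (E * f (r * Complex.I + t * d)).re)
        (E * (deriv f (r * Complex.I + t * d) * d)).re t :=
      Complex.reCLM.hasFDerivAt.comp_hasDerivAt t h1
    have h3 : HasDerivAt (fun t : ℝ => r + t * l) l t := by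
      simpa using ((hasDerivAt_id t).mul_const l).const_add r
    have hpos : r + t * l ≠ 0 := by
      have := mul_nonneg ht.1 hl0.le
      linarith
    exact h2.sub ((h3.log hpos).const_mul _)
  have hmono : MonotoneOn (fun t : ℝ => (E * f (r * Complex.I + t * d)).re -
        Real.sin c / 6 * (r * M) * Real.log (r + t * l)) (Set.Icc 0 1) := by
    apply monotoneOn_of_deriv_nonneg (convex_Icc _ _)
    · exact fun t ht => (hder t ht).continuousAt.continuousWithinAt
    · exact fun t ht => (hder t (interior_subset ht)).differentiableAt.differentiableWithinAt
    · rw [interior_Icc]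
      intro t ht
      rw [(hder t ⟨ht.1.le, ht.2.le⟩).deriv]
      set p := deriv f (r * Complex.I + t * d) with hp
      have hY : r ≤ r + t * l := by
        have := mul_nonneg ht.1.le hl0.le
        linarith
      have hYpos : 0 < r + t * l := hr.trans_le hY
      have hdre : |z₀.re| ≤ l := by
        have := Complex.abs_re_le_norm d
        simpa [hd] using this
      have hdim : z₀.im - r ≤ l := by
        have := Complex.im_le_norm d
        simpa [hd] using this
      have hmt := hmem t ⟨ht.1.le, ht.2⟩
      have hlow := h.norm_deriv_lower hre (x := t * z₀.re) (y := (1 - t) * r + t * z₀.im) hr hY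
        (by
          rw [abs_mul, abs_of_pos ht.1]
          have := mul_le_mul_of_nonneg_left hdre ht.1.le
          linarith)
        (by
          rw [hcoord] at hmt
          simpa [mem_upperHalf] using hmt)
        (by
          have := mul_le_mul_of_nonneg_left hdim ht.1.le
          linarith)
      rw [← hcoord, ← hp] at hlow
      have hE1 : E * (p * d) = l * (Complex.exp (-(c * Complex.I)) * p) := by
        have : (starRingEnd ℂ) d * d = (l : ℂ) ^ 2 := by
          rw [mul_comm, Complex.mul_conj, Complex.normSq_eq_norm_sq]
          norm_cast
        have hl' : (l : ℂ) ≠ 0 := by exact_mod_cast hl0.ne'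
        rw [hE]
        field_simp
        linear_combination p * this
      have hE2 : (Complex.exp (-(c * Complex.I)) * p).re = ‖p‖ * Real.cos (p.arg - c) := by
        rw [Real.cos_sub, Complex.mul_re, ← neg_mul, ← Complex.ofReal_neg,
          Complex.exp_ofReal_mul_I_re, Complex.exp_ofReal_mul_I_im, Real.cos_neg, Real.sin_neg,
          ← Complex.norm_mul_cos_arg p, ← Complex.norm_mul_sin_arg p]
        ring
      rw [hE1, Complex.re_ofReal_mul, hE2]
      have hs : Real.sin c ≤ Real.cos (p.arg - c) :=
        sin_le_cos_sub hc.le (harg t ht) (abs_lt.1 (abs_arg_deriv_lt hre hmt)).2.le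
      have hs0 : 0 < Real.sin c := Real.sin_pos_of_pos_of_lt_pi hc (by linarith [Real.pi_pos])
      have h1 : r * M / (6 * (r + t * l)) ≤ ‖p‖ := by
        rw [div_le_iff₀ (by linarith)]
        linarith
      have h2 : r * M / (6 * (r + t * l)) * Real.sin c ≤ ‖p‖ * Real.cos (p.arg - c) :=
        mul_le_mul h1 hs hs0.le (norm_nonneg _)
      have h3 := mul_le_mul_of_nonneg_left h2 hl0.le
      have e : Real.sin c / 6 * (r * M) * (l / (r + t * l)) =
          l * (r * M / (6 * (r + t * l)) * Real.sin c) := by field_simp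
      rw [e]
      linarith
  have hfin := hmono (Set.left_mem_Icc.2 zero_le_one) (Set.right_mem_Icc.2 zero_le_one) zero_le_one
  have e1 : (r * Complex.I + ((1 : ℝ) : ℂ) * d : ℂ) = z₀ := by simp [hd]
  have e0 : (r * Complex.I + ((0 : ℝ) : ℂ) * d : ℂ) = r * Complex.I := by simp
  simp only [e1, e0, one_mul, zero_mul, add_zero] at hfin
  rw [Real.log_div (by positivity) hr.ne', mul_sub, mul_sub E, Complex.sub_re]
  linarith

/-- `58 = 45 + 13`, from the real and imaginary parts; the sign of `E.im` selects the available side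
of the bound on `Im f`. -/
theorem re_mul_sub_le (h : IsConvexMap α U f) (hre : ∀ z ∈ upperHalf, 0 < (deriv f z).re)
    {r : ℝ} (hr : 0 < r) {E : ℂ} (hE : ‖E‖ ≤ 1) (hE' : E.im ≤ 0) {z : ℂ}
    (hz : z ∈ puncturedClosedHalfPlane α) :
    (E * (f z - f (r * Complex.I))).re ≤ 58 * (‖z‖ + r) * ‖deriv f (r * Complex.I)‖ := by
  have h1 := h.abs_re_sub_le hre hr hz
  have h2 := h.im_sub_le hre hr hz
  set M := ‖deriv f (r * Complex.I)‖
  have hM : 0 ≤ M := norm_nonneg _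
  have hmx : max ‖z‖ r ≤ ‖z‖ + r := max_le (by linarith) (by linarith [norm_nonneg z])
  have hmx0 : 0 < max ‖z‖ r := hr.trans_le (le_max_right _ _)
  have hEr := (Complex.abs_re_le_norm E).trans hE
  have hEi := (Complex.abs_im_le_norm E).trans hE
  rw [abs_of_nonpos hE'] at hEi
  rw [Complex.mul_re, Complex.sub_re, Complex.sub_im]
  have h3 : E.re * ((f z).re - (f (r * Complex.I)).re) ≤ 45 * max ‖z‖ r * M := by
    refine (le_abs_self _).trans ?_
    rw [abs_mul]
    calc _ ≤ 1 * (45 * max ‖z‖ r * M) := mul_le_mul hEr h1 (abs_nonneg _) zero_le_one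
      _ = _ := one_mul _
  have h4 : -E.im * ((f z).im - (f (r * Complex.I)).im) ≤ 1 * (13 * max ‖z‖ r * M) :=
    (mul_le_mul_of_nonneg_left h2 (by linarith)).trans
      (mul_le_mul_of_nonneg_right hEi (by positivity))
  have h5 : max ‖z‖ r * M ≤ (‖z‖ + r) * M := by gcongr
  linarith

/-- Take `r = |z₀| / κ`, `M = |f' (ir)|`, `S = ∑ w i |z i|`. For `κ` large, `log_le_re_sub` bounds
`Re (E (f z₀ - f (ir)))` below by `59 r M`, while averaging `re_mul_sub_le` bounds it above by `58
(S + r) M`. Hence `r ≤ 58 S`. -/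
theorem exists_mean_bound_right (h : IsConvexMap α U f)
    (hre : ∀ z ∈ upperHalf, 0 < (deriv f z).re) :
    ∃ C : ℝ, 0 ≤ C ∧ ∀ z₀ ∈ puncturedClosedHalfPlane α, 0 ≤ z₀.re →
      ∀ (s : Finset ℕ) (w : ℕ → ℝ) (z : ℕ → ℂ), (∀ i ∈ s, 0 ≤ w i) → ∑ i ∈ s, w i = 1 →
      (∀ i ∈ s, z i ∈ puncturedClosedHalfPlane α) →
      f z₀ = ∑ i ∈ s, (w i : ℂ) * f (z i) → ‖z₀‖ ≤ C * (1 + ∑ i ∈ s, w i * ‖z i‖) := by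
  obtain ⟨c, x₁, hc, hc', hx₁, hreg⟩ := h.exists_arg_deriv_ge hre
  have hs0 : 0 < Real.sin c := Real.sin_pos_of_pos_of_lt_pi hc (by linarith [Real.pi_pos])
  have hs1 := Real.sin_le_one c
  -- The first term makes `sin c / 6 * log κ ≥ 59`, as `354 = 6 * 59`; the second secures `E.im ≤
  -- 0`.
  set κ := max (Real.exp (354 / Real.sin c)) (1 + 1 / Real.sin c) with hκ
  have hκ1 : 1 + 1 / Real.sin c ≤ κ := le_max_right _ _
  have hκ2 : 354 / Real.sin c ≤ Real.log κ := by
    rw [← Real.log_exp (354 / Real.sin c)]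
    exact Real.log_le_log (Real.exp_pos _) (le_max_left _ _)
  have hinv : 1 ≤ 1 / Real.sin c := by
    rw [le_div_iff₀ hs0]
    linarith
  have hκ0 : 2 ≤ κ := by linarith
  refine ⟨58 * κ + (1 + 2 * x₁), by linarith, fun z₀ hz₀ hz0re s w z hw hw1 hz hsum => ?_⟩
  set S := ∑ i ∈ s, w i * ‖z i‖ with hS
  have hS0 : 0 ≤ S := Finset.sum_nonneg fun i hi => mul_nonneg (hw i hi) (norm_nonneg _)
  have hz0im : 0 ≤ z₀.im := hz₀.1
  by_cases hsmall : ‖z₀‖ ≤ 2 * κ + (1 + 2 * x₁)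
  · have : 58 * κ * 1 ≤ 58 * κ * (1 + S) := by
      gcongr
      linarith
    have : (1 + 2 * x₁) * 1 ≤ (1 + 2 * x₁) * (1 + S) := by
      gcongr
      linarith
    linarith
  push Not at hsmall
  set r := ‖z₀‖ / κ with hr
  have hz0r : ‖z₀‖ = κ * r := by
    rw [hr]
    field_simp
  have hr2 : 2 ≤ r := by
    rw [hr, le_div_iff₀ (by linarith)]
    linarith
  have hr0 : 0 < r := by linarith
  set d := z₀ - r * Complex.I with hd
  have hdn : κ * r ≤ r + ‖d‖ := by
    rw [← hz0r]
    have := norm_le_norm_add_norm_sub (r * Complex.I : ℂ) z₀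
    rw [norm_mul, Complex.norm_I, mul_one, Complex.norm_real, Real.norm_of_nonneg hr0.le, norm_sub_rev] at this
    exact this
  have hd0 : 0 < ‖d‖ := by
    have : 2 * r ≤ κ * r := by gcongr
    linarith
  have hne : z₀ ≠ r * Complex.I := sub_ne_zero.1 (norm_pos_iff.1 hd0)
  -- Keeps the segment in the region where `arg f'` is controlled: if `Im z₀ ≥ 1` it stays at height
  -- at least `1`; otherwise its first half does, because `r ≥ 2`, and its second half has real part
  -- at least `x₁`.
  have hcase : 1 ≤ z₀.im ∨ 2 * x₁ ≤ z₀.re := by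
    by_contra! hcon
    have := Complex.norm_le_abs_re_add_abs_im z₀
    rw [abs_of_nonneg hz0re, abs_of_nonneg hz0im] at this
    linarith
  have harg : ∀ t ∈ Set.Ioo (0 : ℝ) 1, -(Real.pi / 2) + 2 * c ≤
      (deriv f (r * Complex.I + t * d)).arg := by
    intro t ht
    have hpre : (r * Complex.I + t * d).re = t * z₀.re := by simp [hd]
    have hpim : (r * Complex.I + t * d).im = (1 - t) * r + t * z₀.im := by
      simp [hd]
      ring
    have h1 : 0 < (1 - t) * r := mul_pos (sub_pos.2 ht.2) hr0
    have h2 : 0 ≤ t * z₀.im := mul_nonneg ht.1.le hz0im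
    have h3 : 0 ≤ t * z₀.re := mul_nonneg ht.1.le hz0re
    refine hreg _ (mem_upperHalf.2 (by rw [hpim]; linarith)) ?_
    rw [hpre, hpim]
    rcases hcase with h4 | h4
    · left
      refine ⟨h3, ?_⟩
      have := mul_le_mul_of_nonneg_left h4 ht.1.le
      have := mul_le_mul_of_nonneg_left hr2 (sub_pos.2 ht.2).le
      linarith [ht.2]
    · rcases le_total t (1 / 2) with h5 | h5
      · left
        refine ⟨h3, ?_⟩
        have := mul_le_mul_of_nonneg_left hr2 (sub_pos.2 ht.2).le
        linarith
      · right
        have := mul_le_mul_of_nonneg_left h4 ht.1.le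
        nlinarith
  have hlow := h.log_le_re_sub hre hc hc' hr0 hz₀ hne harg
  rw [← hd] at hlow
  set M := ‖deriv f (r * Complex.I)‖ with hM
  have hM0 : 0 < M := norm_pos_iff.2 (h.deriv_ne_zero
    (h.upperHalf_subset (by simpa [mem_upperHalf] using hr0)))
  set E := Complex.exp (-(c * Complex.I)) * ((starRingEnd ℂ) d / ‖d‖) with hE
  have hEn : ‖E‖ ≤ 1 := by
    rw [hE, norm_mul, ← neg_mul, ← Complex.ofReal_neg, Complex.norm_exp_ofReal_mul_I, norm_div,
      Complex.norm_real, norm_norm, Complex.norm_conj, div_self hd0.ne', mul_one]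
  have hEim : E.im ≤ 0 := by
    have e : E.im = -(Real.sin c * z₀.re + Real.cos c * (z₀.im - r)) / ‖d‖ := by
      have e1 : E = Complex.exp (((-c : ℝ) : ℂ) * Complex.I) * (starRingEnd ℂ) d *
          ((‖d‖⁻¹ : ℝ) : ℂ) := by
        rw [hE]
        push_cast
        rw [neg_mul]
        ring
      rw [e1, Complex.im_mul_ofReal, Complex.mul_im, Complex.exp_ofReal_mul_I_re,
        Complex.exp_ofReal_mul_I_im, Real.cos_neg, Real.sin_neg]
      simp [hd]
      ring
    rw [e]
    refine div_nonpos_of_nonpos_of_nonneg ?_ hd0.le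
    rw [neg_nonpos]
    have hcos0 : 0 ≤ Real.cos c :=
      Real.cos_nonneg_of_mem_Icc ⟨by linarith [Real.pi_pos], by linarith [Real.pi_pos]⟩
    have hcos1 := Real.cos_le_one c
    rcases le_total r z₀.im with h1 | h1
    · have := mul_nonneg hs0.le hz0re
      have := mul_nonneg hcos0 (sub_nonneg.2 h1)
      linarith
    · have h2 := Complex.norm_le_abs_re_add_abs_im z₀
      rw [abs_of_nonneg hz0re, abs_of_nonneg hz0im, hz0r] at h2
      have h3 : (1 + 1 / Real.sin c) * r ≤ κ * r := by gcongr
      have h4 : 1 / Real.sin c * r ≤ z₀.re + z₀.im - r + r - z₀.im := by linarith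
      have h5 : Real.sin c * (1 / Real.sin c * r) ≤ Real.sin c * z₀.re := by
        gcongr
        linarith
      have h6 : Real.sin c * (1 / Real.sin c * r) = r := by field_simp
      nlinarith
  have hlog : Real.log κ ≤ Real.log ((r + ‖d‖) / r) := by
    apply Real.log_le_log (by linarith)
    rwa [le_div_iff₀ hr0]
  have hup : (E * (f z₀ - f (r * Complex.I))).re ≤ 58 * (S + r) * M := by
    have e : E * (f z₀ - f (r * Complex.I)) =
        ∑ i ∈ s, (w i : ℂ) * (E * (f (z i) - f (r * Complex.I))) := by
      have h1 : ∑ i ∈ s, (w i : ℂ) = 1 := by exact_mod_cast hw1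
      calc E * (f z₀ - f (r * Complex.I))
          = E * (∑ i ∈ s, (w i : ℂ) * f (z i) - (∑ i ∈ s, (w i : ℂ)) * f (r * Complex.I)) := by
            rw [hsum, h1, one_mul]
        _ = _ := by
            rw [Finset.sum_mul, ← Finset.sum_sub_distrib, Finset.mul_sum]
            exact Finset.sum_congr rfl fun i _ => by ring
    rw [e, Complex.re_sum]
    have h1 : ∀ i ∈ s, ((w i : ℂ) * (E * (f (z i) - f (r * Complex.I)))).re ≤
        w i * (58 * (‖z i‖ + r) * M) := by
      intro i hi
      rw [Complex.re_ofReal_mul]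
      exact mul_le_mul_of_nonneg_left (h.re_mul_sub_le hre hr0 hEn hEim (hz i hi)) (hw i hi)
    refine (Finset.sum_le_sum h1).trans_eq ?_
    calc ∑ i ∈ s, w i * (58 * (‖z i‖ + r) * M)
        = 58 * M * ∑ i ∈ s, w i * ‖z i‖ + 58 * M * r * ∑ i ∈ s, w i := by
          rw [Finset.mul_sum, Finset.mul_sum, ← Finset.sum_add_distrib]
          exact Finset.sum_congr rfl fun i _ => by ring
      _ = _ := by
          rw [hw1, ← hS]
          ring
  have h59 : 59 * (r * M) ≤ Real.sin c / 6 * (r * M) * Real.log ((r + ‖d‖) / r) := by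
    have h1 : 59 = Real.sin c / 6 * (354 / Real.sin c) := by
      field_simp
      norm_num
    calc 59 * (r * M) = Real.sin c / 6 * (r * M) * (354 / Real.sin c) := by
          rw [h1]
          ring
      _ ≤ _ := by
          gcongr
          exact hκ2.trans hlog
  have hfin : r * M ≤ 58 * S * M := by linarith
  have hrS : r ≤ 58 * S := le_of_mul_le_mul_right hfin hM0
  have h7 : κ * r ≤ κ * (58 * S) := by gcongr
  have h8 : 0 ≤ (1 + 2 * x₁) * (1 + S) := by positivity
  rw [hz0r]
  linarith

theorem hasMeanBound_of_re_pos (h : IsConvexMap α U f)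
    (hre : ∀ z ∈ upperHalf, 0 < (deriv f z).re) : HasMeanBound α f := by
  obtain ⟨C₁, hC₁, h₁⟩ := h.exists_mean_bound_right hre
  obtain ⟨C₂, hC₂, h₂⟩ := h.reflect.exists_mean_bound_right (h.re_deriv_reflectMap_pos hre)
  refine ⟨max C₁ C₂, le_max_of_le_left hC₁, fun z₀ hz₀ s w z hw hw1 hz hsum => ?_⟩
  have hS0 : 0 ≤ 1 + ∑ i ∈ s, w i * ‖z i‖ :=
    add_nonneg zero_le_one (Finset.sum_nonneg fun i hi => mul_nonneg (hw i hi) (norm_nonneg _))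
  rcases le_total 0 z₀.re with h0 | h0
  · exact (h₁ z₀ hz₀ h0 s w z hw hw1 hz hsum).trans
      (mul_le_mul_of_nonneg_right (le_max_left _ _) hS0)
  · have hconj : ∀ z ∈ puncturedClosedHalfPlane α,
        -(starRingEnd ℂ) z ∈ puncturedClosedHalfPlane (-(starRingEnd ℂ) α) := by
      intro z hz
      rw [← neg_conj_mem_punctured]
      simpa using hz
    have h3 := h₂ (-(starRingEnd ℂ) z₀) (hconj _ hz₀) (by simpa using h0) s w
      (fun i => -(starRingEnd ℂ) (z i)) hw hw1 (fun i hi => hconj _ (hz i hi)) (by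
        simp [reflectMap, hsum])
    simp only [norm_neg, RCLike.norm_conj] at h3
    exact h3.trans (mul_le_mul_of_nonneg_right (le_max_right _ _) hS0)

theorem hasMeanBound_of_smul {e : ℂ} (h : HasMeanBound α fun z => e * f z) :
    HasMeanBound α f := by
  obtain ⟨C, hC, hC'⟩ := h
  refine ⟨C, hC, fun z₀ hz₀ s w z hw hw1 hz hsum => hC' z₀ hz₀ s w z hw hw1 hz ?_⟩
  simp only [hsum, Finset.mul_sum]
  exact Finset.sum_congr rfl fun i _ => by ring

/-- Here `f` is affine, so `z₀` is itself the weighted mean of the `z i`. -/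
theorem hasMeanBound_of_deriv_const (h : IsConvexMap α U f) {p : ℂ} (hp : p ≠ 0)
    (hd : ∀ z ∈ upperHalf, deriv f z = p) : HasMeanBound α f := by
  have hI : Complex.I ∈ upperHalf := by simp [mem_upperHalf]
  have hH : ∀ z ∈ upperHalf, f z - p * z = f Complex.I - p * Complex.I := by
    intro z hz
    refine isOpen_upperHalf.is_const_of_deriv_eq_zero (f := fun z => f z - p * z)
      convex_upperHalf.isPreconnected (fun z hz => ?_) (fun z hz => ?_) hz hI
    · exact ((h.differentiableAt (h.upperHalf_subset hz)).sub
        (by fun_prop)).differentiableWithinAt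
    · have h1 := (h.differentiableAt (h.upperHalf_subset hz)).hasDerivAt.sub
        ((hasDerivAt_id z).const_mul p)
      rw [hd z hz, mul_one, sub_self] at h1
      exact h1.deriv
  set b := f Complex.I - p * Complex.I
  have hK : ∀ z ∈ puncturedClosedHalfPlane α, f z = p * z + b := by
    intro z hz
    have hc := (h.differentiableAt (h.subset hz)).continuousAt
    have h1 := le_of_continuousAt_of_upperHalf (u := fun z => ‖f z - p * z - b‖)
      (v := fun _ => 0) hz (by fun_prop) continuousAt_const
      (fun w hw => by simp [hH w hw])
    have h2 := norm_le_zero_iff.1 h1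
    linear_combination h2
  refine ⟨1, zero_le_one, fun z₀ hz₀ s w z hw hw1 hz hsum => ?_⟩
  have hz0 : z₀ = ∑ i ∈ s, (w i : ℂ) * z i := by
    have h1 : ∑ i ∈ s, (w i : ℂ) = 1 := by exact_mod_cast hw1
    have h2 : ∑ i ∈ s, (w i : ℂ) * f (z i) = p * ∑ i ∈ s, (w i : ℂ) * z i + b := by
      calc ∑ i ∈ s, (w i : ℂ) * f (z i) = ∑ i ∈ s, (p * ((w i : ℂ) * z i) + (w i : ℂ) * b) :=
            Finset.sum_congr rfl fun i hi => by
              rw [hK _ (hz i hi)]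
              ring
        _ = _ := by rw [Finset.sum_add_distrib, ← Finset.mul_sum, ← Finset.sum_mul, h1, one_mul]
    rw [hK z₀ hz₀, h2] at hsum
    exact mul_left_cancel₀ hp (add_right_cancel hsum)
  have h3 : ‖z₀‖ ≤ ∑ i ∈ s, w i * ‖z i‖ := by
    rw [hz0]
    refine (norm_sum_le _ _).trans (Finset.sum_le_sum fun i hi => ?_)
    rw [norm_mul, Complex.norm_real, Real.norm_of_nonneg (hw i hi)]
  linarith

/-- Let `e` be a cluster point of the unit vectors `f (ik) / |f (ik)|`. The axis lemma with weights
`1 / |f (ik)|` gives `Im (e / f') ≥ 0`, that is, `Re ((i / e) f') ≥ 0`. By the open mapping theorem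
this is strict unless `f'` is constant. -/
theorem hasMeanBound_of_tendsto_atTop (h : IsConvexMap α U f)
    (hlim : Tendsto (fun k : ℕ => ‖f ((k : ℝ) * Complex.I)‖) atTop atTop) :
    HasMeanBound α f := by
  obtain ⟨e, -, φ, hφ, hφlim⟩ := tendsto_subseq_of_frequently_bounded
    (s := Metric.closedBall (0 : ℂ) 1) Metric.isBounded_closedBall
    (x := fun k : ℕ => f ((k : ℝ) * Complex.I) / ‖f ((k : ℝ) * Complex.I)‖)
    (Frequently.of_forall fun k => by
      rw [mem_closedBall_zero_iff, norm_div, Complex.norm_real, norm_norm]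
      exact div_self_le_one _)
  have hnorm : Tendsto (fun k => ‖f ((φ k : ℝ) * Complex.I)‖) atTop atTop :=
    hlim.comp hφ.tendsto_atTop
  have hinv := tendsto_inv_atTop_zero.comp hnorm
  have he1 : ‖e‖ = 1 := by
    refine tendsto_nhds_unique hφlim.norm (tendsto_const_nhds.congr' ?_)
    filter_upwards [hnorm.eventually_gt_atTop 0] with k hk
    simp only [Function.comp_apply, norm_div, Complex.norm_real, norm_norm]
    rw [div_self hk.ne']
  have he0 : e ≠ 0 := norm_pos_iff.1 (by rw [he1]; exact one_pos)
  have hdir : ∀ z ∈ upperHalf, 0 ≤ (e / deriv f z).im := by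
    intro z hz
    refine h.im_div_deriv_nonneg_of_axis (Y := fun k => (φ k : ℝ))
      (t := fun k => ‖f ((φ k : ℝ) * Complex.I)‖⁻¹) hz
      (tendsto_natCast_atTop_atTop.comp hφ.tendsto_atTop)
      (Eventually.of_forall fun k => inv_nonneg.2 (norm_nonneg _)) ?_ ?_
    · filter_upwards [hnorm.eventually_ge_atTop 1] with k hk
      exact inv_le_one_of_one_le₀ hk
    · have h1 : Tendsto (fun k => ((‖f ((φ k : ℝ) * Complex.I)‖⁻¹ : ℝ) : ℂ) * f z) atTop
          (𝓝 (((0 : ℝ) : ℂ) * f z)) :=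
        ((Complex.continuous_ofReal.tendsto _).comp hinv).mul_const _
      have h2 := hφlim.sub h1
      rw [Complex.ofReal_zero, zero_mul, sub_zero] at h2
      refine h2.congr fun k => ?_
      simp only [Function.comp_apply]
      push_cast
      rw [div_eq_inv_mul, mul_sub]
  have hl0 : Complex.I / e ≠ 0 := div_ne_zero Complex.I_ne_zero he0
  refine hasMeanBound_of_smul (e := Complex.I / e) ?_
  have h' := h.smul hl0
  have hder : ∀ z ∈ upperHalf,
      deriv (fun z => Complex.I / e * f z) z = Complex.I / e * deriv f z := fun z hz =>
    ((h.differentiableAt (h.upperHalf_subset hz)).hasDerivAt.const_mul _).deriv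
  have hnonneg : ∀ z ∈ upperHalf, 0 ≤ (deriv (fun z => Complex.I / e * f z) z).re := by
    intro z hz
    rw [hder z hz]
    have h1 := hdir z hz
    have h2 : e / deriv f z = (deriv f z / e)⁻¹ := by rw [inv_div]
    rw [h2, Complex.inv_im] at h1
    have h3 : 0 < Complex.normSq (deriv f z / e) :=
      Complex.normSq_pos.2 (div_ne_zero (h.deriv_ne_zero (h.upperHalf_subset hz)) he0)
    have h4 := (div_nonneg_iff.1 h1).resolve_right fun h5 => by linarith [h5.2]
    have e1 : Complex.I / e * deriv f z = Complex.I * (deriv f z / e) := by ring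
    rw [e1, Complex.I_mul_re]
    exact h4.1
  have han : AnalyticOnNhd ℂ (deriv fun z => Complex.I / e * f z) upperHalf :=
    fun z hz => h'.analyticAt_deriv (h'.upperHalf_subset hz)
  rcases han.is_constant_or_isOpen convex_upperHalf.isPreconnected with ⟨p, hp⟩ | hopen
  · have hI : Complex.I ∈ upperHalf := by simp [mem_upperHalf]
    refine h'.hasMeanBound_of_deriv_const (p := p) ?_ hp
    rw [← hp _ hI]
    exact h'.deriv_ne_zero (h'.upperHalf_subset hI)
  · refine h'.hasMeanBound_of_re_pos fun z hz => ?_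
    have hO := hopen upperHalf subset_rfl isOpen_upperHalf
    have h1 : deriv (fun z => Complex.I / e * f z) '' upperHalf ⊆ {w : ℂ | 0 ≤ w.re} := by
      rintro _ ⟨z, hz, rfl⟩
      exact hnonneg z hz
    have h2 := interior_mono h1 (hO.interior_eq.symm ▸ Set.mem_image_of_mem _ hz)
    rw [Complex.interior_setOfPred_le_re] at h2
    exact h2

/-- Either `f` has a limit outside the image at infinity, or the mean bound holds. -/
theorem tendsto_or_hasMeanBound (h : IsConvexMap α U f) :
    (∃ c, c ∉ f '' puncturedClosedHalfPlane α ∧ ∀ ε : ℝ, 0 < ε →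
      ∃ R, ∀ z ∈ puncturedClosedHalfPlane α, R ≤ ‖z‖ → ‖f z - c‖ < ε) ∨ HasMeanBound α f := by
  by_cases hlim : Tendsto (fun k : ℕ => ‖f ((k : ℝ) * Complex.I)‖) atTop atTop
  · exact Or.inr (h.hasMeanBound_of_tendsto_atTop hlim)
  · left
    -- If `|f (ik)|` does not tend to infinity, a bounded subsequence provides a finite limit point
    -- along the axis.
    rw [tendsto_atTop] at hlim
    push Not at hlim
    obtain ⟨b, hb⟩ := hlim
    obtain ⟨c, -, φ, hφ, hφlim⟩ := tendsto_subseq_of_frequently_bounded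
      (s := Metric.closedBall (0 : ℂ) b) Metric.isBounded_closedBall
      (x := fun k : ℕ => f ((k : ℝ) * Complex.I))
      (hb.mono fun k hk => mem_closedBall_zero_iff.2 (le_of_lt (by simpa using hk)))
    exact ⟨c, h.exists_forall_norm_sub_lt (Y := fun k => (φ k : ℝ))
      (tendsto_natCast_atTop_atTop.comp hφ.tendsto_atTop) hφlim⟩

end IsConvexMap

/-! ### Independence of blocks and real sample means -/

/-- Regrouping an independent family indexed by pairs gives an independent family of tuples. -/
theorem iIndepFun_curry {Ω ι κ 𝓧 : Type*} [MeasurableSpace Ω] [MeasurableSpace 𝓧]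
    {P : Measure Ω} {X : ι → κ → Ω → 𝓧} (mX : ∀ i j, Measurable (X i j))
    (h : iIndepFun (fun (p : ι × κ) ω => X p.1 p.2 ω) P) :
    iIndepFun (fun i ω => (X i · ω)) P := by
  have := h.isProbabilityMeasure
  have h1 : ∀ i j, IsProbabilityMeasure (P.map (X i j)) :=
    fun i j => Measure.isProbabilityMeasure_map (mX i j).aemeasurable
  have h2 : ∀ i, iIndepFun (X i) P := fun i =>
    h.precomp (g := fun j : κ => (i, j)) fun _ _ hj => (Prod.ext_iff.1 hj).2
  rw [iIndepFun_iff_map_fun_eq_infinitePi_map (by fun_prop)]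
  have h3 := (iIndepFun_iff_map_fun_eq_infinitePi_map (by fun_prop)).1 h
  have h4 := congrArg (Measure.map (MeasurableEquiv.curry ι κ 𝓧)) h3
  rw [Measure.infinitePi_map_curry (fun i j => P.map (X i j)),
    Measure.map_map (by fun_prop) (by fun_prop)] at h4
  refine Eq.trans ?_ (h4.trans ?_)
  · rfl
  · congrm Measure.infinitePi fun i => ?_
    rw [(iIndepFun_iff_map_fun_eq_infinitePi_map (by fun_prop)).1 (h2 i)]

/-- The arithmetic mean of the first `n` members of a sequence of functions. -/
noncomputable def sampleMean {Ω 𝕜 : Type*} [Field 𝕜] (W : ℕ → Ω → 𝕜) (n : ℕ) (ω : Ω) : 𝕜 :=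
  1 / (n : 𝕜) * ∑ j ∈ Finset.range n, W j ω

section Real

variable {Ω : Type*} [MeasurableSpace Ω] {P : Measure Ω} {V : ℕ → Ω → ℝ}

theorem memLp_sampleMean (hV : MemLp (V 0) 2 P) (hid : ∀ i, IdentDistrib (V i) (V 0) P P)
    (n : ℕ) : MemLp (sampleMean V n) 2 P :=
  (memLp_finsetSum _ fun i _ => (hid i).memLp_iff.2 hV).const_mul _

variable [IsProbabilityMeasure P]

theorem integrable_sampleMean_sub_sq (hV : MemLp (V 0) 2 P)
    (hid : ∀ i, IdentDistrib (V i) (V 0) P P) (n : ℕ) (c : ℝ) :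
    Integrable (fun ω => (sampleMean V n ω - c) ^ 2) P :=
  ((memLp_sampleMean hV hid n).sub (memLp_const c)).integrable_sq

theorem integral_sampleMean (hV : MemLp (V 0) 2 P) (hid : ∀ i, IdentDistrib (V i) (V 0) P P)
    {n : ℕ} (hn : 1 ≤ n) : ∫ ω, sampleMean V n ω ∂P = ∫ ω, V 0 ω ∂P := by
  have hn0 : (n : ℝ) ≠ 0 := by positivity
  simp only [sampleMean]
  rw [integral_const_mul, integral_finsetSum _ fun i _ =>
    ((hid i).memLp_iff.2 hV).integrable one_le_two]
  simp only [(hid _).integral_eq, Finset.sum_const, Finset.card_range, nsmul_eq_mul]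
  field_simp

theorem mul_variance_sampleMean (hV : MemLp (V 0) 2 P) (hind : iIndepFun V P)
    (hid : ∀ i, IdentDistrib (V i) (V 0) P P) {n : ℕ} (hn : 1 ≤ n) :
    (n : ℝ) * ∫ ω, (sampleMean V n ω - ∫ ω', V 0 ω' ∂P) ^ 2 ∂P = Var[V 0; P] := by
  have hn0 : (n : ℝ) ≠ 0 := by positivity
  have h1 := variance_eq_integral (memLp_sampleMean hV hid n).aemeasurable
  rw [integral_sampleMean hV hid hn] at h1
  rw [← h1]
  have h2 : sampleMean V n = fun ω => (1 / (n : ℝ)) * (∑ j ∈ Finset.range n, V j) ω := by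
    ext ω
    simp [sampleMean]
  rw [h2, variance_const_mul, IndepFun.variance_sum (fun i _ => (hid i).memLp_iff.2 hV)
    (fun i _ j _ hij => hind.indepFun hij)]
  simp only [(hid _).variance_eq, Finset.sum_const, Finset.card_range, nsmul_eq_mul]
  field_simp

theorem tendsto_integral_min_sq_gaussianReal (v : NNReal) :
    Tendsto (fun l : ℕ => ∫ y, min (y ^ 2) (l : ℝ) ∂(gaussianReal 0 v)) atTop (𝓝 v) := by
  have h2 : MemLp (fun y : ℝ => y) 2 (gaussianReal 0 v) := memLp_id_gaussianReal 2
  have hv : ∫ y, y ^ 2 ∂(gaussianReal 0 v) = v := by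
    have h1 := variance_fun_id_gaussianReal (μ := 0) (v := v)
    rw [variance_eq_integral h2.aemeasurable, integral_id_gaussianReal] at h1
    simpa using h1
  rw [← hv]
  refine tendsto_integral_of_dominated_convergence (fun y : ℝ => y ^ 2) (fun l => ?_)
    h2.integrable_sq (fun l => Eventually.of_forall fun y => ?_)
    (Eventually.of_forall fun y => ?_)
  · exact (by fun_prop : Measurable fun y : ℝ => min (y ^ 2) (l : ℝ)).aestronglyMeasurable
  · rw [Real.norm_of_nonneg (le_min (sq_nonneg _) (Nat.cast_nonneg _))]
    exact min_le_left _ _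
  · refine tendsto_const_nhds.congr' ?_
    filter_upwards [tendsto_natCast_atTop_atTop.eventually_ge_atTop (y ^ 2)] with l hl
    exact (min_eq_left hl).symm

/-- The central limit theorem tested on the bounded continuous function `min (y²) l`. -/
theorem tendsto_integral_min_sq (hV : MemLp (V 0) 2 P) (hind : iIndepFun V P)
    (hid : ∀ i, IdentDistrib (V i) (V 0) P P) (l : ℕ) :
    Tendsto (fun n : ℕ => ∫ ω, min ((n : ℝ) * (sampleMean V n ω - ∫ ω', V 0 ω' ∂P) ^ 2) (l : ℝ) ∂P)
      atTop (𝓝 (∫ y, min (y ^ 2) (l : ℝ) ∂(gaussianReal 0 Var[V 0; P].toNNReal))) := by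
  have hclt := tendstoInDistribution_inv_sqrt_mul_sum_sub
    (P' := gaussianReal 0 Var[V 0; P].toNNReal) HasLaw.id hV hind hid
  have h1 := ProbabilityMeasure.tendsto_iff_forall_integral_tendsto.1 hclt.tendsto
    (BoundedContinuousFunction.ofNormedAddCommGroup (fun y : ℝ => min (y ^ 2) (l : ℝ))
      (by fun_prop) l fun y => by
        rw [Real.norm_of_nonneg (le_min (sq_nonneg _) (Nat.cast_nonneg _))]
        exact min_le_right _ _)
  simp only [BoundedContinuousFunction.coe_ofNormedAddCommGroup, ProbabilityMeasure.coe_mk,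
    Measure.map_id] at h1
  have hmeas : Measurable fun y : ℝ => min (y ^ 2) (l : ℝ) := by fun_prop
  refine h1.congr' ?_
  filter_upwards [eventually_ge_atTop 1] with n hn
  rw [integral_map (hclt.forall_aemeasurable n) hmeas.aestronglyMeasurable]
  refine integral_congr_ae (Eventually.of_forall fun ω => ?_)
  have hn0 : (0 : ℝ) < n := by positivity
  simp only [sampleMean]
  congr 1
  rw [mul_pow, inv_pow, Real.sq_sqrt hn0.le]
  field_simp

/-- The normalized squared deviation of the sample mean is uniformly integrable. -/
theorem tendsto_mul_setIntegral_sq (hV : MemLp (V 0) 2 P) (hind : iIndepFun V P)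
    (hid : ∀ i, IdentDistrib (V i) (V 0) P P) {ν : ℕ → ℕ} (hν : Tendsto ν atTop atTop)
    {A : ℕ → Set Ω} (hA : Tendsto (fun n => P.real (A n)) atTop (𝓝 0)) :
    Tendsto (fun n : ℕ => (ν n : ℝ) *
      ∫ ω in A n, (sampleMean V (ν n) ω - ∫ ω', V 0 ω' ∂P) ^ 2 ∂P) atTop (𝓝 0) := by
  set μ := ∫ ω', V 0 ω' ∂P
  have hi : ∀ n : ℕ, Integrable (fun ω => (n : ℝ) * (sampleMean V n ω - μ) ^ 2) P := fun n =>
    (integrable_sampleMean_sub_sq hV hid n μ).const_mul _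
  have him : ∀ (n l : ℕ),
      Integrable (fun ω => min ((n : ℝ) * (sampleMean V n ω - μ) ^ 2) (l : ℝ)) P := fun n l =>
    (hi n).inf (integrable_const _)
  have hisub : ∀ (n l : ℕ), Integrable (fun ω => (n : ℝ) * (sampleMean V n ω - μ) ^ 2 -
      min ((n : ℝ) * (sampleMean V n ω - μ) ^ 2) (l : ℝ)) P := fun n l => (hi n).sub (him n l)
  -- Split the normalized square at level `l`. The excess has expectation exactly `Var - E min (·,
  -- l)`, in the limit the Gaussian excess, small for large `l`; the capped part costs `l * P S`.
  have hbound : ∀ (n l : ℕ) (S : Set Ω), 1 ≤ n →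
      (n : ℝ) * ∫ ω in S, (sampleMean V n ω - μ) ^ 2 ∂P ≤
        Var[V 0; P] - (∫ ω, min ((n : ℝ) * (sampleMean V n ω - μ) ^ 2) (l : ℝ) ∂P) +
          l * P.real S := by
    intro n l S hn
    rw [← integral_const_mul, ← mul_variance_sampleMean hV hind hid hn, ← integral_const_mul,
      ← integral_sub (hi n) (him n l)]
    have h1 : ∫ ω in S, (n : ℝ) * (sampleMean V n ω - μ) ^ 2 ∂P ≤ ∫ ω in S,
        (((n : ℝ) * (sampleMean V n ω - μ) ^ 2 -
          min ((n : ℝ) * (sampleMean V n ω - μ) ^ 2) (l : ℝ)) + l) ∂P := by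
      refine integral_mono (hi n).integrableOn
        ((hisub n l).add (integrable_const _)).integrableOn fun ω => ?_
      have := min_le_right ((n : ℝ) * (sampleMean V n ω - μ) ^ 2) (l : ℝ)
      simp only
      linarith
    rw [integral_add (hisub n l).integrableOn (integrable_const _).integrableOn,
      setIntegral_const, smul_eq_mul, mul_comm (P.real _)] at h1
    refine h1.trans (add_le_add_left ?_ _)
    refine setIntegral_le_integral (hisub n l) (Eventually.of_forall fun ω => ?_)
    exact sub_nonneg.2 (min_le_left _ _)
  rw [Metric.tendsto_atTop']
  intro ε hε
  have hg := tendsto_integral_min_sq_gaussianReal Var[V 0; P].toNNReal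
  rw [Real.coe_toNNReal _ (variance_nonneg _ _)] at hg
  obtain ⟨l, hl⟩ := (hg.eventually (lt_mem_nhds (sub_lt_self _ (half_pos hε)))).exists
  have h2 := (((tendsto_integral_min_sq hV hind hid l).comp hν).const_sub Var[V 0; P]).add
    (hA.const_mul (l : ℝ))
  have h3 := h2.eventually_lt_const (u := ε) (by linarith)
  obtain ⟨N, hN⟩ := eventually_atTop.1 (h3.and (hν.eventually_ge_atTop 1))
  refine ⟨N, fun n hn => ?_⟩
  obtain ⟨h4, h5⟩ := hN n hn.le
  rw [Real.dist_eq, sub_zero, abs_of_nonneg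
    (mul_nonneg (Nat.cast_nonneg _) (integral_nonneg fun _ => sq_nonneg _))]
  exact (hbound (ν n) l (A n) h5).trans_lt h4

end Real

/-! ### Complex sample means -/

section Complex

variable {Ω : Type*} {W : ℕ → Ω → ℂ}

theorem re_sampleMean (n : ℕ) (ω : Ω) :
    (sampleMean W n ω).re = sampleMean (fun j ω => (W j ω).re) n ω := by
  simp only [sampleMean]
  rw [← Complex.ofReal_natCast, ← Complex.ofReal_one, ← Complex.ofReal_div, Complex.re_ofReal_mul,
    Complex.re_sum]

theorem im_sampleMean (n : ℕ) (ω : Ω) :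
    (sampleMean W n ω).im = sampleMean (fun j ω => (W j ω).im) n ω := by
  simp only [sampleMean]
  rw [← Complex.ofReal_natCast, ← Complex.ofReal_one, ← Complex.ofReal_div, Complex.im_ofReal_mul,
    Complex.im_sum]

theorem norm_sub_sq_eq (n : ℕ) (ω : Ω) (m : ℂ) : ‖sampleMean W n ω - m‖ ^ 2 =
    (sampleMean (fun j ω => (W j ω).re) n ω - m.re) ^ 2 +
      (sampleMean (fun j ω => (W j ω).im) n ω - m.im) ^ 2 := by
  rw [← re_sampleMean, ← im_sampleMean, ← Complex.normSq_eq_norm_sq, Complex.normSq_apply,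
    Complex.sub_re, Complex.sub_im]
  ring

variable [MeasurableSpace Ω] {P : Measure Ω}

theorem integral_re_eq (hW : Integrable (W 0) P) :
    ∫ ω, (W 0 ω).re ∂P = (∫ ω, W 0 ω ∂P).re := integral_re hW

theorem integral_im_eq (hW : Integrable (W 0) P) :
    ∫ ω, (W 0 ω).im ∂P = (∫ ω, W 0 ω ∂P).im := integral_im hW

theorem memLp_sampleMean_complex (hW : MemLp (W 0) 2 P)
    (hid : ∀ i, IdentDistrib (W i) (W 0) P P) (n : ℕ) : MemLp (sampleMean W n) 2 P :=
  (memLp_finsetSum _ fun i _ => (hid i).memLp_iff.2 hW).const_mul _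

variable [IsProbabilityMeasure P]

theorem integral_sampleMean_complex (hW : MemLp (W 0) 2 P)
    (hid : ∀ i, IdentDistrib (W i) (W 0) P P) {n : ℕ} (hn : 1 ≤ n) :
    ∫ ω, sampleMean W n ω ∂P = ∫ ω, W 0 ω ∂P := by
  have hn0 : (n : ℂ) ≠ 0 := by exact_mod_cast (by lia : n ≠ 0)
  simp only [sampleMean]
  rw [integral_const_mul, integral_finsetSum _ fun i _ =>
    ((hid i).memLp_iff.2 hW).integrable one_le_two]
  simp only [(hid _).integral_eq, Finset.sum_const, Finset.card_range, nsmul_eq_mul]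
  field_simp

theorem tendsto_mul_setIntegral_norm_sq (hW : MemLp (W 0) 2 P) (hind : iIndepFun W P)
    (hid : ∀ i, IdentDistrib (W i) (W 0) P P) {A : ℕ → Set Ω}
    (hA : Tendsto (fun n => P.real (A n)) atTop (𝓝 0)) :
    Tendsto (fun n : ℕ => (n : ℝ) * ∫ ω in A n, ‖sampleMean W n ω - ∫ ω', W 0 ω' ∂P‖ ^ 2 ∂P)
      atTop (𝓝 0) := by
  have hWi := hW.integrable one_le_two
  have hre : ∀ i, IdentDistrib (fun ω => (W i ω).re) (fun ω => (W 0 ω).re) P P := fun i =>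
    (hid i).comp Complex.measurable_re
  have him : ∀ i, IdentDistrib (fun ω => (W i ω).im) (fun ω => (W 0 ω).im) P P := fun i =>
    (hid i).comp Complex.measurable_im
  have h1 := tendsto_mul_setIntegral_sq (V := fun j ω => (W j ω).re) hW.re
    (hind.comp (fun _ => Complex.re) fun _ => Complex.measurable_re) hre tendsto_id hA
  have h2 := tendsto_mul_setIntegral_sq (V := fun j ω => (W j ω).im) hW.im
    (hind.comp (fun _ => Complex.im) fun _ => Complex.measurable_im) him tendsto_id hA
  have h3 := h1.add h2
  simp only [add_zero, id_eq] at h3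
  refine h3.congr fun n => ?_
  rw [← mul_add, ← integral_add
    (integrable_sampleMean_sub_sq (V := fun j ω => (W j ω).re) hW.re hre n _).integrableOn
    (integrable_sampleMean_sub_sq (V := fun j ω => (W j ω).im) hW.im him n _).integrableOn]
  simp only [norm_sub_sq_eq, integral_re_eq hWi, integral_im_eq hWi]

theorem mul_integral_norm_sub_sq (hW : MemLp (W 0) 2 P) (hind : iIndepFun W P)
    (hid : ∀ i, IdentDistrib (W i) (W 0) P P) {n : ℕ} (hn : 1 ≤ n) :
    (n : ℝ) * ∫ ω, ‖sampleMean W n ω - ∫ ω', W 0 ω' ∂P‖ ^ 2 ∂P =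
      ∫ ω, ‖W 0 ω - ∫ ω', W 0 ω' ∂P‖ ^ 2 ∂P := by
  have hWi := hW.integrable one_le_two
  have hre : ∀ i, IdentDistrib (fun ω => (W i ω).re) (fun ω => (W 0 ω).re) P P := fun i =>
    (hid i).comp Complex.measurable_re
  have him : ∀ i, IdentDistrib (fun ω => (W i ω).im) (fun ω => (W 0 ω).im) P P := fun i =>
    (hid i).comp Complex.measurable_im
  have h1 := mul_variance_sampleMean (V := fun j ω => (W j ω).re) hW.re
    (hind.comp (fun _ => Complex.re) fun _ => Complex.measurable_re) hre hn
  have h2 := mul_variance_sampleMean (V := fun j ω => (W j ω).im) hW.im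
    (hind.comp (fun _ => Complex.im) fun _ => Complex.measurable_im) him hn
  have i1 := integrable_sampleMean_sub_sq (V := fun j ω => (W j ω).re) hW.re hre n
    (∫ ω', W 0 ω' ∂P).re
  have i2 := integrable_sampleMean_sub_sq (V := fun j ω => (W j ω).im) hW.im him n
    (∫ ω', W 0 ω' ∂P).im
  have j1 : Integrable (fun ω => ((W 0 ω).re - (∫ ω', W 0 ω' ∂P).re) ^ 2) P :=
    ((MemLp.re hW).sub (memLp_const (∫ ω', W 0 ω' ∂P).re)).integrable_sq
  have j2 : Integrable (fun ω => ((W 0 ω).im - (∫ ω', W 0 ω' ∂P).im) ^ 2) P :=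
    ((MemLp.im hW).sub (memLp_const (∫ ω', W 0 ω' ∂P).im)).integrable_sq
  have e : ∀ ω, ‖W 0 ω - ∫ ω', W 0 ω' ∂P‖ ^ 2 = ((W 0 ω).re - (∫ ω', W 0 ω' ∂P).re) ^ 2 +
      ((W 0 ω).im - (∫ ω', W 0 ω' ∂P).im) ^ 2 := by
    intro ω
    rw [← Complex.normSq_eq_norm_sq, Complex.normSq_apply, Complex.sub_re, Complex.sub_im]
    ring
  rw [variance_eq_integral (hre 0).aemeasurable_snd, integral_re_eq hWi] at h1
  rw [variance_eq_integral (him 0).aemeasurable_snd, integral_im_eq hWi] at h2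
  simp only [norm_sub_sq_eq, e]
  rw [integral_add i1 i2, mul_add]
  refine (congrArg₂ (· + ·) h1 h2).trans (integral_add j1 j2).symm

theorem tendsto_measureReal_deviation (hW : MemLp (W 0) 2 P) (hind : iIndepFun W P)
    (hid : ∀ i, IdentDistrib (W i) (W 0) P P) {δ : ℝ} (hδ : 0 < δ) :
    Tendsto (fun n : ℕ => P.real {ω | δ ≤ ‖sampleMean W n ω - ∫ ω', W 0 ω' ∂P‖})
      atTop (𝓝 0) := by
  set m := ∫ ω', W 0 ω' ∂P
  have h1 : Tendsto (fun n : ℕ => (∫ ω, ‖W 0 ω - m‖ ^ 2 ∂P) / δ ^ 2 * (n : ℝ)⁻¹) atTop (𝓝 0) := by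
    have := (tendsto_inv_atTop_nhds_zero_nat (𝕜 := ℝ)).const_mul
      ((∫ ω, ‖W 0 ω - m‖ ^ 2 ∂P) / δ ^ 2)
    rwa [mul_zero] at this
  refine squeeze_zero' (Eventually.of_forall fun _ => measureReal_nonneg) ?_ h1
  filter_upwards [eventually_ge_atTop 1] with n hn
  have hn0 : (0 : ℝ) < n := by positivity
  have hi : Integrable (fun ω => ‖sampleMean W n ω - m‖ ^ 2) P :=
    ((memLp_sampleMean_complex hW hid n).sub (memLp_const m)).integrable_norm_pow (by simp)
  have h2 := mul_meas_ge_le_integral_of_nonneg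
    (Eventually.of_forall fun ω => sq_nonneg ‖sampleMean W n ω - m‖) hi (δ ^ 2)
  have h3 : {ω | δ ^ 2 ≤ ‖sampleMean W n ω - m‖ ^ 2} = {ω | δ ≤ ‖sampleMean W n ω - m‖} := by
    ext ω
    exact sq_le_sq₀ hδ.le (norm_nonneg _)
  rw [h3] at h2
  rw [← mul_integral_norm_sub_sq hW hind hid hn]
  have h4 : (n : ℝ) * (∫ ω, ‖sampleMean W n ω - m‖ ^ 2 ∂P) / δ ^ 2 * (n : ℝ)⁻¹ =
      (∫ ω, ‖sampleMean W n ω - m‖ ^ 2 ∂P) / δ ^ 2 := by field_simp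
  rw [h4, le_div_iff₀ (by positivity)]
  linarith

/-- Plain Chebyshev only gives a bounded quantity. Keeping the integral restricted to the deviation
event and using uniform integrability improves this to `o(1)`. -/
theorem tendsto_mul_measureReal_deviation (hW : MemLp (W 0) 2 P) (hWm : ∀ i, Measurable (W i))
    (hind : iIndepFun W P) (hid : ∀ i, IdentDistrib (W i) (W 0) P P) {δ : ℝ} (hδ : 0 < δ) :
    Tendsto (fun n : ℕ => (n : ℝ) * P.real {ω | δ ≤ ‖sampleMean W n ω - ∫ ω', W 0 ω' ∂P‖})
      atTop (𝓝 0) := by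
  set m := ∫ ω', W 0 ω' ∂P with hm
  have hSm : ∀ n, Measurable (sampleMean W n) := fun n => by
    unfold sampleMean
    fun_prop
  have hAm : ∀ n, MeasurableSet {ω | δ ≤ ‖sampleMean W n ω - m‖} := fun n =>
    measurableSet_le measurable_const ((hSm n).sub_const m).norm
  have h1 := tendsto_mul_setIntegral_norm_sq hW hind hid
    (tendsto_measureReal_deviation hW hind hid hδ)
  have h2 := h1.const_mul (δ ^ 2)⁻¹
  rw [mul_zero] at h2
  refine squeeze_zero (fun n => mul_nonneg (Nat.cast_nonneg _) measureReal_nonneg) (fun n => ?_) h2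
  have hi : Integrable (fun ω => ‖sampleMean W n ω - m‖ ^ 2) P :=
    ((memLp_sampleMean_complex hW hid n).sub (memLp_const m)).integrable_norm_pow (by simp)
  have h3 : δ ^ 2 * P.real {ω | δ ≤ ‖sampleMean W n ω - m‖} ≤
      ∫ ω in {ω | δ ≤ ‖sampleMean W n ω - m‖}, ‖sampleMean W n ω - m‖ ^ 2 ∂P := by
    have := setIntegral_mono_on (f := fun _ => δ ^ 2) (integrable_const _).integrableOn
      hi.integrableOn (hAm n) (fun ω hω => pow_le_pow_left₀ hδ.le hω 2)
    rwa [setIntegral_const, smul_eq_mul, mul_comm] at this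
  have h4 : P.real {ω | δ ≤ ‖sampleMean W n ω - m‖} ≤
      (δ ^ 2)⁻¹ * ∫ ω in {ω | δ ≤ ‖sampleMean W n ω - m‖}, ‖sampleMean W n ω - m‖ ^ 2 ∂P := by
    rw [inv_mul_eq_div, le_div_iff₀ (by positivity)]
    linarith
  calc _ ≤ (n : ℝ) * ((δ ^ 2)⁻¹ *
        ∫ ω in {ω | δ ≤ ‖sampleMean W n ω - m‖}, ‖sampleMean W n ω - m‖ ^ 2 ∂P) := by gcongr
    _ = _ := by ring

end Complex

/-! ### Separating an omitted point from the mean -/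

section Separation

variable {Ω : Type*} [MeasurableSpace Ω] {P : Measure Ω} [IsProbabilityMeasure P]

theorem lt_integral_or_ae_eq {T : Ω → ℝ} {c : ℝ} (hT : Integrable T P) (h : ∀ᵐ ω ∂P, c ≤ T ω) :
    c < ∫ ω, T ω ∂P ∨ ∀ᵐ ω ∂P, T ω = c := by
  have h0 : 0 ≤ᵐ[P] fun ω => T ω - c := h.mono fun ω hω => sub_nonneg.2 hω
  have hi : ∫ ω, (T ω - c) ∂P = (∫ ω, T ω ∂P) - c := by
    rw [integral_sub hT (integrable_const _)]
    simp
  have h1 := integral_nonneg_of_ae h0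
  rw [hi] at h1
  rcases h1.eq_or_lt with h2 | h2
  · right
    rw [← hi] at h2
    filter_upwards [(integral_eq_zero_iff_of_nonneg_ae h0
      (hT.sub (integrable_const _))).1 h2.symm] with ω hω
    exact sub_eq_zero.1 hω
  · left
    linarith

theorem lt_integral_of_ae_lt {T : Ω → ℝ} {c : ℝ} (hT : Integrable T P)
    (h : ∀ᵐ ω ∂P, c < T ω) : c < ∫ ω, T ω ∂P := by
  refine (lt_integral_or_ae_eq hT (h.mono fun _ => le_of_lt)).resolve_right fun h1 => ?_
  obtain ⟨ω, h2, h3⟩ := (h.and h1).exists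
  exact h2.ne' h3

/-- A point outside a convex set with dense interior is strictly separated from the mean of any
random variable with values in the set. -/
theorem exists_separating {C O : Set ℂ} (hC : Convex ℝ C) (hO : IsOpen O) (hOc : Convex ℝ O)
    (hOC : O ⊆ C) (hcl : C ⊆ closure O) {c : ℂ} (hc : c ∉ C) {W : Ω → ℂ} (hW : Integrable W P)
    (hWC : ∀ᵐ ω ∂P, W ω ∈ C) :
    ∃ φ : ℂ →L[ℝ] ℝ, (∀ᵐ ω ∂P, φ c ≤ φ (W ω)) ∧ φ c < φ (∫ ω, W ω ∂P) := by
  have hcomp : ∀ φ : ℂ →L[ℝ] ℝ, ∫ ω, φ (W ω) ∂P = φ (∫ ω, W ω ∂P) := fun φ =>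
    φ.integral_comp_comm hW
  have hWne : ∃ w, w ∈ C := by
    obtain ⟨ω, hω⟩ := hWC.exists
    exact ⟨_, hω⟩
  obtain ⟨φ, hφ⟩ := geometric_hahn_banach_point_open hOc hO fun h => hc (hOC h)
  have hφC : ∀ w ∈ C, φ c ≤ φ w := fun w hw =>
    closure_minimal (t := {w | φ c ≤ φ w}) (fun b hb => (hφ b hb).le)
      (isClosed_le continuous_const φ.continuous) (hcl hw)
  have h1 : ∀ᵐ ω ∂P, φ c ≤ φ (W ω) := hWC.mono fun ω hω => hφC _ hω
  rcases lt_integral_or_ae_eq (φ.integrable_comp hW) h1 with h2 | h2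
  · exact ⟨φ, h1, by rwa [hcomp] at h2⟩
  -- Remaining case: `W` lies almost surely on the supporting line through `c`. The part of `C` on
  -- this line is convex and misses `c`, so it lies on one side of `c`; the coordinate `ψ` along the
  -- line, up to sign, separates.
  obtain ⟨e, he⟩ := exists_eq_re_mul φ
  have he0 : e ≠ 0 := by
    rintro rfl
    obtain ⟨w, hw⟩ := hWne
    obtain ⟨b, hb⟩ : O.Nonempty := by
      rw [← closure_nonempty_iff]
      exact ⟨w, hcl hw⟩
    have := hφ b hb
    simp [he] at this
  set ψ : ℂ →L[ℝ] ℝ := Complex.imCLM.comp (ContinuousLinearMap.mul ℝ ℂ e) with hψ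
  have hψe : ∀ w, ψ w = (e * w).im := fun w => rfl
  have hψT : (ψ '' (C ∩ {w | φ w = φ c})).OrdConnected := by
    have hl : Convex ℝ {w | φ w = φ c} := convex_hyperplane φ.isLinear (φ c)
    exact ((hC.inter hl).is_linear_image ψ.isLinear).ordConnected
  have hside : (∀ w ∈ C, φ w = φ c → ψ c < ψ w) ∨ (∀ w ∈ C, φ w = φ c → ψ w < ψ c) := by
    by_contra! hcon
    obtain ⟨⟨a, ha, ha1, ha2⟩, ⟨b, hb, hb1, hb2⟩⟩ := hcon
    obtain ⟨w, ⟨hw, hw1⟩, hw2⟩ := hψT.out (Set.mem_image_of_mem ψ ⟨ha, ha1⟩)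
      (Set.mem_image_of_mem ψ ⟨hb, hb1⟩) ⟨ha2, hb2⟩
    have hw1' : φ w = φ c := hw1
    rw [he, he] at hw1'
    rw [hψe, hψe] at hw2
    exact hc (mul_left_cancel₀ he0 (Complex.ext hw1' hw2) ▸ hw)
  rcases hside with hs | hs
  · have h3 : ∀ᵐ ω ∂P, ψ c < ψ (W ω) := by
      filter_upwards [hWC, h2] with ω hω hω' using hs _ hω hω'
    refine ⟨ψ, h3.mono fun _ => le_of_lt, ?_⟩
    rw [← hcomp]
    exact lt_integral_of_ae_lt (ψ.integrable_comp hW) h3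
  · have h3 : ∀ᵐ ω ∂P, (-ψ) c < (-ψ) (W ω) := by
      filter_upwards [hWC, h2] with ω hω hω' using neg_lt_neg (hs _ hω hω')
    refine ⟨-ψ, h3.mono fun _ => le_of_lt, ?_⟩
    rw [← hcomp]
    exact lt_integral_of_ae_lt ((-ψ).integrable_comp hW) h3

/-- If the mean were outside, separating it from itself would be absurd. -/
theorem integral_mem_of_ae_mem {C O : Set ℂ} (hC : Convex ℝ C) (hO : IsOpen O)
    (hOc : Convex ℝ O) (hOC : O ⊆ C) (hcl : C ⊆ closure O) {W : Ω → ℂ} (hW : Integrable W P)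
    (hWC : ∀ᵐ ω ∂P, W ω ∈ C) : ∫ ω, W ω ∂P ∈ C := by
  by_contra hc
  obtain ⟨φ, -, hφ⟩ := exists_separating hC hO hOc hOC hcl hc hW hWC
  exact lt_irrefl _ hφ

end Separation

/-! ### A one-sided exponential bound -/

section Chernoff

variable {Ω : Type*} [MeasurableSpace Ω] {P : Measure Ω} [IsProbabilityMeasure P]

/-- `(1 - x + x²/2) (1 + x + x²/2) = 1 + x⁴/4 ≥ 1`. -/
theorem exp_neg_le_quadratic {x : ℝ} (hx : 0 ≤ x) : Real.exp (-x) ≤ 1 - x + x ^ 2 / 2 := by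
  have h1 := Real.quadratic_le_exp_of_nonneg hx
  rw [Real.exp_neg, inv_le_iff_one_le_mul₀ (Real.exp_pos x)]
  have h2 : 0 ≤ 1 - x + x ^ 2 / 2 := by nlinarith [sq_nonneg (x - 1)]
  calc (1 : ℝ) ≤ (1 - x + x ^ 2 / 2) * (1 + x + x ^ 2 / 2) := by nlinarith [sq_nonneg (x ^ 2)]
    _ ≤ _ := by gcongr

/-- Lower deviations of the mean of nonnegative square-integrable variables are exponentially
unlikely. -/
theorem exists_measureReal_sampleMean_le {T : ℕ → Ω → ℝ} (hTm : ∀ i, Measurable (T i))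
    (hT : MemLp (T 0) 2 P) (hind : iIndepFun T P) (hid : ∀ i, IdentDistrib (T i) (T 0) P P)
    (h0 : ∀ᵐ ω ∂P, 0 ≤ T 0 ω) {δ : ℝ} (hδ : 0 < δ) (hmean : ∫ ω, T 0 ω ∂P = 2 * δ) :
    ∃ b : ℝ, 0 < b ∧ ∀ n : ℕ, 1 ≤ n →
      P.real {ω | sampleMean T n ω ≤ δ} ≤ Real.exp (-(n * b)) := by
  -- The `+ 1` keeps `v` positive. The rate `-t δ + t² v / 2` is minimal at `t = δ / v`, with value
  -- `-t δ / 2`. Nonnegativity of `T` makes the Laplace transform finite at `-t`.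
  set v : ℝ := (∫ ω, T 0 ω ^ 2 ∂P) + 1 with hv
  have hv0 : 0 < v := by
    have : 0 ≤ ∫ ω, T 0 ω ^ 2 ∂P := integral_nonneg fun ω => sq_nonneg _
    linarith
  set t : ℝ := δ / v with ht
  have ht0 : 0 < t := div_pos hδ hv0
  have hT1 : Integrable (T 0) P := hT.integrable one_le_two
  have hT2 : Integrable (fun ω => T 0 ω ^ 2) P := hT.integrable_sq
  have hall : ∀ i, ∀ᵐ ω ∂P, 0 ≤ T i ω := fun i =>
    (hid i).symm.ae_mem_snd measurableSet_Ici h0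
  have hmgf : mgf (T 0) P (-t) ≤ Real.exp (-(2 * t * δ) + t ^ 2 * v / 2) := by
    have hlin : Integrable (fun ω => 1 - t * T 0 ω) P :=
      (integrable_const 1).sub (hT1.const_mul t)
    have hquad : Integrable (fun ω => 1 - t * T 0 ω + t ^ 2 / 2 * T 0 ω ^ 2) P :=
      hlin.add (hT2.const_mul _)
    have h1 : mgf (T 0) P (-t) ≤ ∫ ω, (1 - t * T 0 ω + t ^ 2 / 2 * T 0 ω ^ 2) ∂P := by
      refine integral_mono_of_nonneg (Eventually.of_forall fun ω => (Real.exp_pos _).le) hquad ?_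
      filter_upwards [h0] with ω hω
      have := exp_neg_le_quadratic (mul_nonneg ht0.le hω)
      rw [neg_mul]
      linarith [mul_pow t (T 0 ω) 2]
    have h2 : ∫ ω, (1 - t * T 0 ω + t ^ 2 / 2 * T 0 ω ^ 2) ∂P =
        1 - t * (2 * δ) + t ^ 2 / 2 * (v - 1) := by
      rw [integral_add hlin (hT2.const_mul _),
        integral_sub (integrable_const 1) (hT1.const_mul t), integral_const_mul,
        integral_const_mul, hmean, hv]
      simp
    have h3 := Real.add_one_le_exp (-(2 * t * δ) + t ^ 2 * v / 2)
    nlinarith [sq_nonneg t]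
  refine ⟨t * δ / 2, by positivity, fun n hn => ?_⟩
  have hn0 : (0 : ℝ) < n := by positivity
  have hset : {ω | sampleMean T n ω ≤ δ} = {ω | (∑ i ∈ Finset.range n, T i) ω ≤ n * δ} := by
    ext ω
    simp only [sampleMean, Set.mem_ofPred_eq, Finset.sum_apply]
    rw [one_div, inv_mul_le_iff₀ hn0]
  have hint : Integrable (fun ω => Real.exp (-t * (∑ i ∈ Finset.range n, T i) ω)) P := by
    refine Integrable.of_bound (C := 1) (by fun_prop) ?_
    filter_upwards [ae_all_iff.2 hall] with ω hω
    rw [Real.norm_of_nonneg (Real.exp_pos _).le, Real.exp_le_one_iff, Finset.sum_apply]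
    have : 0 ≤ ∑ i ∈ Finset.range n, T i ω := Finset.sum_nonneg fun i _ => hω i
    nlinarith
  rw [hset]
  refine (measure_le_le_exp_mul_mgf (n * δ) (by linarith) hint).trans ?_
  rw [mgf_sum_of_identDistrib hTm hind (fun i _ j _ => (hid i).trans (hid j).symm)
    (Finset.mem_range.2 hn), Finset.card_range]
  calc Real.exp (- -t * (n * δ)) * mgf (T 0) P (-t) ^ n
      ≤ Real.exp (- -t * (n * δ)) * Real.exp (-(2 * t * δ) + t ^ 2 * v / 2) ^ n := by
        gcongr
        exact mgf_nonneg
    _ = Real.exp (-(n * (t * δ / 2))) := by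
        rw [← Real.exp_nat_mul, ← Real.exp_add]
        congr 1
        have : t * v = δ := by
          rw [ht]
          field_simp
        linear_combination (n * t / 2) * this

end Chernoff

/-! ### Measurability and elementary inequalities -/

namespace IsConvexMap

variable {α : ℂ} {U : Set ℂ} {f : ℂ → ℂ}

theorem measurable_comp_ofReal (h : IsConvexMap α U f) : Measurable fun x : ℝ => f x := by
  refine measurable_of_continuousOn_compl_singleton α.re fun x hx => ?_
  have hx' : (x : ℂ) ≠ α := by
    rintro rfl
    simp at hx
  exact ((h.differentiableAt (h.subset (ofReal_mem x hx'))).continuousAt.comp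
    Complex.continuous_ofReal.continuousAt).continuousWithinAt

/-- Off `f '' U`, `invFunOn` takes a single default value, so it is continuous on the open set `f ''
U` and constant elsewhere. -/
theorem measurable_inv (h : IsConvexMap α U f) : Measurable (Function.invFunOn f U) := by
  classical
  have hO := isOpen_image_of_injOn h.isOpen h.holomorphic h.injective h.isOpen subset_rfl
  by_cases hne : (f '' U)ᶜ.Nonempty
  · obtain ⟨b₀, hb₀⟩ := hne
    have h1 : Measurable ((f '' U).piecewise (Function.invFunOn f U)
        fun _ => Function.invFunOn f U b₀) := by
      refine ContinuousOn.measurable_piecewise ?_ continuousOn_const hO.measurableSet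
      rintro _ ⟨z, hz, rfl⟩
      exact (h.hasDerivAt_inv hz).continuousAt.continuousWithinAt
    convert! h1 using 1
    ext1 b
    by_cases hb : b ∈ f '' U
    · rw [Set.piecewise_eq_of_mem _ _ _ hb]
    · rw [Set.piecewise_eq_of_notMem _ _ _ hb]
      have h2 : ¬∃ a ∈ U, f a = b := hb
      have h3 : ¬∃ a ∈ U, f a = b₀ := hb₀
      simp only [Function.invFunOn, dif_neg h2, dif_neg h3]
  · rw [Set.not_nonempty_iff_eq_empty, Set.compl_empty_iff] at hne
    refine Continuous.measurable (continuous_iff_continuousAt.2 fun b => ?_)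
    obtain ⟨z, hz, rfl⟩ : b ∈ f '' U := hne ▸ Set.mem_univ b
    exact (h.hasDerivAt_inv hz).continuousAt

end IsConvexMap

theorem sampleMean_mem {Ω : Type*} {C : Set ℂ} (hC : Convex ℝ C) {W : ℕ → Ω → ℂ} {ω : Ω}
    (hW : ∀ j, W j ω ∈ C) {n : ℕ} (hn : 1 ≤ n) : sampleMean W n ω ∈ C := by
  have hn0 : (n : ℝ) ≠ 0 := by positivity
  have h1 := hC.sum_mem (t := Finset.range n) (w := fun _ => 1 / (n : ℝ)) (z := fun j => W j ω)
    (fun _ _ => by positivity) (by simp [hn0]) (fun j _ => hW j)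
  rw [← Finset.smul_sum, Complex.real_smul] at h1
  push_cast at h1
  exact h1

theorem sum_range_blocks {E : Type*} [AddCommMonoid E] (a : ℕ → E) (p k l : ℕ) :
    ∑ j ∈ Finset.range (p * k + l), a j =
      ∑ i ∈ Finset.range p, ∑ j ∈ Finset.range k, a (i * k + j) +
        ∑ j ∈ Finset.range l, a (p * k + j) := by
  rw [Finset.sum_range_add]
  congr 1
  induction p with
  | zero => simp
  | succ p ih => rw [Nat.succ_mul, Finset.sum_range_add, ih, Finset.sum_range_succ]

/-- Truncation at level `l`: a second moment costs `l ^ (-ε)` times a higher moment, plus `l ^ 2` on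
any event. -/
theorem sq_le_inv_rpow_mul_add {x l ε : ℝ} (hx : 0 ≤ x) (hl : 0 < l) (hε : 0 < ε) :
    x ^ 2 ≤ (l ^ ε)⁻¹ * x ^ (2 + ε) + l ^ 2 := by
  have h0 : 0 < l ^ ε := Real.rpow_pos_of_pos hl ε
  rcases le_total x l with h | h
  · have h1 : x ^ 2 ≤ l ^ 2 := by gcongr
    have h2 : 0 ≤ (l ^ ε)⁻¹ * x ^ (2 + ε) := by positivity
    linarith
  · have hx0 : 0 < x := hl.trans_le h
    have h1 : l ^ ε ≤ x ^ ε := Real.rpow_le_rpow hl.le h hε.le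
    have h2 : x ^ (2 + ε) = x ^ 2 * x ^ ε := by
      rw [Real.rpow_add hx0, Real.rpow_two]
    have h3 : x ^ 2 ≤ (l ^ ε)⁻¹ * x ^ (2 + ε) := by
      rw [inv_mul_eq_div, le_div_iff₀ h0, h2]
      gcongr
    linarith [sq_nonneg l]

theorem tendsto_mul_exp_neg {κ : ℝ} (hκ : 0 < κ) :
    Tendsto (fun n : ℕ => (n : ℝ) * Real.exp (-(n * κ))) atTop (𝓝 0) := by
  have := tendsto_self_mul_const_pow_of_lt_one (Real.exp_pos (-κ)).le
    (by simpa using hκ)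
  refine this.congr fun n => ?_
  rw [← Real.exp_nat_mul, mul_neg]

/-! ### Laws of block means; tail estimate when `f` has a finite limit -/

namespace IsConvexMap

variable {α : ℂ} {U : Set ℂ} {f : ℂ → ℂ} {Ω : Type*} [MeasurableSpace Ω] {P : Measure Ω}
  {W : ℕ → Ω → ℂ}

theorem image_subset_closure (h : IsConvexMap α U f) :
    f '' puncturedClosedHalfPlane α ⊆ closure (f '' upperHalf) := by
  rintro _ ⟨z, hz, rfl⟩
  exact h.mem_closure_image hz

theorem image_upperHalf_subset (h : IsConvexMap α U f) :
    f '' upperHalf ⊆ f '' puncturedClosedHalfPlane α :=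
  Set.image_mono h.upperHalf_subset_punctured

theorem apply_inv (h : IsConvexMap α U f) {w : ℂ} (hw : w ∈ f '' puncturedClosedHalfPlane α) :
    f (Function.invFunOn f U w) = w :=
  Function.invFunOn_eq (by
    obtain ⟨z, hz, rfl⟩ := hw
    exact ⟨z, h.subset hz, rfl⟩)

/-- The law of the mean of a block of variables depends only on the length of the block. -/
theorem identDistrib_inv_sampleMean_shift (h : IsConvexMap α U f) (hind : iIndepFun W P)
    (hid : ∀ i, IdentDistrib (W i) (W 0) P P) (s k : ℕ) :
    IdentDistrib (fun ω => Function.invFunOn f U (sampleMean (fun j => W (s + j)) k ω))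
      (fun ω => Function.invFunOn f U (sampleMean W k ω)) P P := by
  have h1 : IdentDistrib (fun ω (j : Fin k) => W (s + j) ω) (fun ω (j : Fin k) => W j ω) P P :=
    IdentDistrib.pi (X := fun (j : Fin k) => W (s + j)) (Y := fun (j : Fin k) => W j)
      (fun j => (hid _).trans (hid _).symm)
      (hind.precomp (g := fun j : Fin k => s + (j : ℕ)) fun i j hij =>
        Fin.ext (Nat.add_left_cancel hij))
      (hind.precomp (g := fun j : Fin k => (j : ℕ)) Fin.val_injective)
  have h2 := h1.comp (u := fun v => Function.invFunOn f U (1 / (k : ℂ) * ∑ j, v j))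
    (h.measurable_inv.comp (by fun_prop))
  convert! h2 using 1
  · ext ω
    simp only [sampleMean, Function.comp_apply, Finset.sum_range]
  · ext ω
    simp only [sampleMean, Function.comp_apply, Finset.sum_range]

theorem iIndepFun_inv_sampleMean_blocks (h : IsConvexMap α U f) (hWm : ∀ i, Measurable (W i))
    (hind : iIndepFun W P) (k : ℕ) :
    iIndepFun (fun i ω => Function.invFunOn f U (sampleMean (fun j => W (i * k + j)) k ω)) P := by
  have h1 : iIndepFun (fun (i : ℕ) ω => (fun j : Fin k => W (i * k + j) ω)) P := by
    refine iIndepFun_curry (X := fun (i : ℕ) (j : Fin k) => W (i * k + j)) (fun i j => hWm _) ?_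
    refine hind.precomp (g := fun p : ℕ × Fin k => p.1 * k + (p.2 : ℕ)) ?_
    rintro ⟨i, j⟩ ⟨i', j'⟩ hij
    have hj := j.2
    have hj' := j'.2
    have hk : 0 < k := by lia
    simp only at hij
    have e1 := congrArg (· / k) hij
    have e2 := congrArg (· % k) hij
    simp only [mul_comm _ k, Nat.mul_add_div hk, Nat.div_eq_of_lt hj, Nat.div_eq_of_lt hj',
      Nat.mul_add_mod, Nat.mod_eq_of_lt hj, Nat.mod_eq_of_lt hj', add_zero] at e1 e2
    exact Prod.ext e1 (Fin.ext e2)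
  have h2 := h1.comp (fun _ v => Function.invFunOn f U (1 / (k : ℂ) * ∑ j, v j))
    fun _ => h.measurable_inv.comp (by fun_prop)
  convert! h2 using 1
  ext i ω
  simp only [sampleMean, Function.comp_apply, Finset.sum_range]

variable [IsProbabilityMeasure P]

/-- Where `|M n| ≤ R₀` the contribution is at most `R₀² n P(A n)`. Elsewhere `S n` is close to `c`,
an event of probability at most `e^(-nb)`, and truncating at an exponentially growing level uses the
`2 + ε` moments. -/
theorem tendsto_tail_of_limit (h : IsConvexMap α U f) {c : ℂ}
    (hc : c ∉ f '' puncturedClosedHalfPlane α)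
    (hlim : ∀ ε : ℝ, 0 < ε → ∃ R, ∀ z ∈ puncturedClosedHalfPlane α, R ≤ ‖z‖ → ‖f z - c‖ < ε)
    (hWm : ∀ i, Measurable (W i)) (hW : MemLp (W 0) 2 P) (hind : iIndepFun W P)
    (hid : ∀ i, IdentDistrib (W i) (W 0) P P)
    (hWK : ∀ᵐ ω ∂P, ∀ j, W j ω ∈ f '' puncturedClosedHalfPlane α) {ε B : ℝ} {N : ℕ} (hε : 0 < ε)
    (hB : ∀ n, N ≤ n →
      Integrable (fun ω => ‖Function.invFunOn f U (sampleMean W n ω)‖ ^ (2 + ε)) P ∧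
      ∫ ω, ‖Function.invFunOn f U (sampleMean W n ω)‖ ^ (2 + ε) ∂P ≤ B)
    {A : ℕ → Set Ω} (hA : Tendsto (fun n : ℕ => (n : ℝ) * P.real (A n)) atTop (𝓝 0)) :
    Tendsto (fun n : ℕ => (n : ℝ) *
      ∫ ω in A n, ‖Function.invFunOn f U (sampleMean W n ω)‖ ^ 2 ∂P) atTop (𝓝 0) := by
  obtain ⟨φ, hφ1, hφ2⟩ := exists_separating h.convex_image h.isOpen_image_upperHalf
    h.convex_image_upperHalf h.image_upperHalf_subset h.image_subset_closure hc
    (hW.integrable one_le_two) (hWK.mono fun ω hω => hω 0)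
  set m := ∫ ω, W 0 ω ∂P with hm
  set δ := (φ m - φ c) / 2 with hδ
  have hδ0 : 0 < δ := by
    rw [hδ]
    linarith
  set T : ℕ → Ω → ℝ := fun j ω => φ (W j ω) - φ c with hT
  have hTid : ∀ i, IdentDistrib (T i) (T 0) P P := fun i =>
    (hid i).comp (u := fun w => φ w - φ c) (by fun_prop)
  have hTmean : ∫ ω, T 0 ω ∂P = 2 * δ := by
    simp only [hT]
    rw [integral_sub (φ.integrable_comp (hW.integrable one_le_two)) (integrable_const _),
      φ.integral_comp_comm (hW.integrable one_le_two)]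
    simp only [integral_const, probReal_univ, one_smul, hδ, hm]
    ring
  obtain ⟨b, hb, hch⟩ := exists_measureReal_sampleMean_le (T := T) (P := P)
    (fun i => by
      have := hWm i
      fun_prop)
    ((φ.comp_memLp' hW).sub (memLp_const _))
    (hind.comp (fun _ w => φ w - φ c) fun _ => by fun_prop) hTid
    (hφ1.mono fun ω hω => sub_nonneg.2 hω) hδ0 hTmean
  have hTS : ∀ n, 1 ≤ n → ∀ ω, sampleMean T n ω = φ (sampleMean W n ω) - φ c := by
    intro n hn ω
    have hn0 : (n : ℝ) ≠ 0 := by positivity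
    have e : sampleMean W n ω = (1 / (n : ℝ)) • ∑ j ∈ Finset.range n, W j ω := by
      rw [Complex.real_smul]
      push_cast
      rfl
    rw [e, map_smul, map_sum]
    simp only [sampleMean, hT, Finset.sum_sub_distrib, Finset.sum_const, Finset.card_range,
      nsmul_eq_mul, smul_eq_mul]
    field_simp
  -- Within this distance of `c`, `φ` exceeds `φ c` by at most `δ`, half its mean excess; the `+ 1`
  -- avoids dividing by zero.
  obtain ⟨R, hR⟩ := hlim (δ / (‖φ‖ + 1)) (by positivity)
  set R₀ := max R 0 with hR₀
  set M : ℕ → Ω → ℂ := fun n ω => Function.invFunOn f U (sampleMean W n ω) with hM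
  have hSm : ∀ n, Measurable (sampleMean T n) := fun n => by
    unfold sampleMean
    have : ∀ i, Measurable (T i) := fun i => by
      have := hWm i
      fun_prop
    fun_prop
  set D : ℕ → Set Ω := fun n => {ω | sampleMean T n ω ≤ δ} with hD
  have hDm : ∀ n, MeasurableSet (D n) := fun n => measurableSet_le (hSm n) measurable_const
  have hpt : ∀ n, 1 ≤ n → ∀ l : ℝ, 0 < l → ∀ᵐ ω ∂P, ‖M n ω‖ ^ 2 ≤ R₀ ^ 2 +
      ((l ^ ε)⁻¹ * ‖M n ω‖ ^ (2 + ε) + (D n).indicator (fun _ => l ^ 2) ω) := by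
    intro n hn l hl
    filter_upwards [hWK] with ω hω
    have hmem := sampleMean_mem h.convex_image hω hn
    have h1 : 0 ≤ (l ^ ε)⁻¹ * ‖M n ω‖ ^ (2 + ε) := by positivity
    have h2 : 0 ≤ (D n).indicator (fun _ => l ^ 2) ω :=
      Set.indicator_nonneg (fun _ _ => sq_nonneg l) ω
    rcases le_total ‖M n ω‖ R₀ with h3 | h3
    · have : ‖M n ω‖ ^ 2 ≤ R₀ ^ 2 := by gcongr
      linarith
    · have hDω : ω ∈ D n := by
        change sampleMean T n ω ≤ δ
        have h4 := hR (M n ω) (h.inv_mem_punctured hmem) ((le_max_left _ _).trans h3)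
        rw [h.apply_inv hmem] at h4
        rw [hTS n hn ω, ← map_sub]
        refine (le_abs_self _).trans ((φ.le_opNorm _).trans ?_)
        rw [lt_div_iff₀ (by positivity)] at h4
        nlinarith [norm_nonneg (sampleMean W n ω - c)]
      rw [Set.indicator_of_mem hDω]
      have := sq_le_inv_rpow_mul_add (norm_nonneg (M n ω)) hl hε
      linarith [sq_nonneg R₀]
  have hint : ∀ n, N ≤ n → 1 ≤ n → ∀ l : ℝ, 0 < l →
      ∫ ω in A n, ‖M n ω‖ ^ 2 ∂P ≤ R₀ ^ 2 * P.real (A n) +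
        ((l ^ ε)⁻¹ * B + l ^ 2 * Real.exp (-(n * b))) := by
    intro n hn hn1 l hl
    obtain ⟨hBi, hBle⟩ := hB n hn
    have i1 : Integrable (fun ω => (l ^ ε)⁻¹ * ‖M n ω‖ ^ (2 + ε)) P := hBi.const_mul _
    have i2 : Integrable ((D n).indicator fun _ => l ^ 2) P :=
      (integrable_const _).indicator (hDm n)
    have i3 : Integrable (fun ω => (l ^ ε)⁻¹ * ‖M n ω‖ ^ (2 + ε) +
      (D n).indicator (fun _ => l ^ 2) ω) P := i1.add i2
    have h1 : ∫ ω in A n, ‖M n ω‖ ^ 2 ∂P ≤ ∫ ω in A n, (R₀ ^ 2 +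
      ((l ^ ε)⁻¹ * ‖M n ω‖ ^ (2 + ε) + (D n).indicator (fun _ => l ^ 2) ω)) ∂P :=
      integral_mono_of_nonneg (Eventually.of_forall fun _ => sq_nonneg _)
        ((integrable_const _).add i3).integrableOn (ae_restrict_of_ae (hpt n hn1 l hl))
    rw [integral_add (integrable_const _).integrableOn i3.integrableOn, setIntegral_const,
      smul_eq_mul, mul_comm (P.real _)] at h1
    have h2 : ∫ ω in A n, ((l ^ ε)⁻¹ * ‖M n ω‖ ^ (2 + ε) +
        (D n).indicator (fun _ => l ^ 2) ω) ∂P ≤ ∫ ω, ((l ^ ε)⁻¹ * ‖M n ω‖ ^ (2 + ε) +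
        (D n).indicator (fun _ => l ^ 2) ω) ∂P :=
      setIntegral_le_integral i3 (Eventually.of_forall fun ω =>
        add_nonneg (by positivity) (Set.indicator_nonneg (fun _ _ => sq_nonneg l) ω))
    rw [integral_add i1 i2, integral_const_mul, integral_indicator_const _ (hDm n),
      smul_eq_mul, mul_comm (P.real _)] at h2
    have h3 : (l ^ ε)⁻¹ * ∫ ω, ‖M n ω‖ ^ (2 + ε) ∂P ≤ (l ^ ε)⁻¹ * B := by gcongr
    have h4 : l ^ 2 * P.real (D n) ≤ l ^ 2 * Real.exp (-(n * b)) := by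
      gcongr
      exact hch n hn1
    linarith
  have hl1 := (tendsto_mul_exp_neg (κ := ε * b / 4) (by positivity)).mul_const B
  have hl2 := tendsto_mul_exp_neg (κ := b / 2) (by positivity)
  have hl3 := (hA.const_mul (R₀ ^ 2)).add (hl1.add hl2)
  simp only [mul_zero, zero_mul, add_zero] at hl3
  refine squeeze_zero' (Eventually.of_forall fun n =>
    mul_nonneg (Nat.cast_nonneg _) (integral_nonneg fun _ => sq_nonneg _)) ?_ hl3
  filter_upwards [eventually_ge_atTop N, eventually_ge_atTop 1] with n hn hn1
  -- The level `l = e^(nb/4)` makes both `l ^ (-ε) B` and `l² e^(-nb)` decay exponentially.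
  have h1 := hint n hn hn1 (Real.exp (n * (b / 4))) (Real.exp_pos _)
  have e1 : (Real.exp (n * (b / 4)) ^ ε)⁻¹ = Real.exp (-(n * (ε * b / 4))) := by
    rw [← Real.exp_mul, ← Real.exp_neg]
    congr 1
    ring
  have e2 : Real.exp (n * (b / 4)) ^ 2 * Real.exp (-(n * b)) = Real.exp (-(n * (b / 2))) := by
    rw [← Real.exp_nat_mul, ← Real.exp_add]
    congr 1
    push_cast
    ring
  rw [e1, e2] at h1
  calc (n : ℝ) * ∫ ω in A n, ‖M n ω‖ ^ 2 ∂P ≤ n * (R₀ ^ 2 * P.real (A n) +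
        (Real.exp (-(n * (ε * b / 4))) * B + Real.exp (-(n * (b / 2))))) := by gcongr
    _ = _ := by ring

end IsConvexMap

/-! ### Tail estimate from the mean bound -/

namespace IsConvexMap

variable {α : ℂ} {U : Set ℂ} {f : ℂ → ℂ} {Ω : Type*} {W : ℕ → Ω → ℂ}

/-- The mean bound controls the inverse image of a sample mean by inverse images of block means. -/
theorem norm_inv_sampleMean_le (h : IsConvexMap α U f) {C : ℝ}
    (hC : ∀ z₀ ∈ puncturedClosedHalfPlane α, ∀ (s : Finset ℕ) (w : ℕ → ℝ) (z : ℕ → ℂ),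
      (∀ i ∈ s, 0 ≤ w i) → ∑ i ∈ s, w i = 1 → (∀ i ∈ s, z i ∈ puncturedClosedHalfPlane α) →
      f z₀ = ∑ i ∈ s, (w i : ℂ) * f (z i) → ‖z₀‖ ≤ C * (1 + ∑ i ∈ s, w i * ‖z i‖))
    {ω : Ω} (hω : ∀ j, W j ω ∈ f '' puncturedClosedHalfPlane α) {p k l : ℕ} (hk : 1 ≤ k)
    (hl : 1 ≤ l) :
    ‖Function.invFunOn f U (sampleMean W (p * k + l) ω)‖ ≤
      C * (1 + (∑ i ∈ Finset.range p, (k : ℝ) / (p * k + l : ℕ) *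
        ‖Function.invFunOn f U (sampleMean (fun j => W (i * k + j)) k ω)‖ +
        (l : ℝ) / (p * k + l : ℕ) *
          ‖Function.invFunOn f U (sampleMean (fun j => W (p * k + j)) l ω)‖)) := by
  set n := p * k + l with hn
  have hn1 : 1 ≤ n := by lia
  have hn0 : (n : ℝ) ≠ 0 := by positivity
  have hk0 : (k : ℂ) ≠ 0 := by exact_mod_cast (by lia : k ≠ 0)
  have hl0 : (l : ℂ) ≠ 0 := by exact_mod_cast (by lia : l ≠ 0)
  -- Indices below `p` are the full blocks; index `p` is the leftover block of length `l`.
  set w : ℕ → ℝ := fun i => if i < p then (k : ℝ) / n else (l : ℝ) / n with hw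
  set z : ℕ → ℂ := fun i => if i < p
    then Function.invFunOn f U (sampleMean (fun j => W (i * k + j)) k ω)
    else Function.invFunOn f U (sampleMean (fun j => W (p * k + j)) l ω) with hz
  have hwp : w p = (l : ℝ) / n := by simp [hw]
  have hzp : z p = Function.invFunOn f U (sampleMean (fun j => W (p * k + j)) l ω) := by simp [hz]
  have hwi : ∀ i ∈ Finset.range p, w i = (k : ℝ) / n := fun i hi => by
    simp [hw, Finset.mem_range.1 hi]
  have hzi : ∀ i ∈ Finset.range p, z i =
      Function.invFunOn f U (sampleMean (fun j => W (i * k + j)) k ω) := fun i hi => by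
    simp [hz, Finset.mem_range.1 hi]
  have hmk : ∀ i, sampleMean (fun j => W (i * k + j)) k ω ∈ f '' puncturedClosedHalfPlane α :=
    fun i => sampleMean_mem h.convex_image (fun j => hω _) hk
  have hml : sampleMean (fun j => W (p * k + j)) l ω ∈ f '' puncturedClosedHalfPlane α :=
    sampleMean_mem h.convex_image (fun j => hω _) hl
  have hmn := sampleMean_mem h.convex_image hω hn1
  have key := hC _ (h.inv_mem_punctured hmn) (Finset.range (p + 1)) w z
    (fun i _ => by
      simp only [hw]
      split_ifs <;> positivity)
    (by
      rw [Finset.sum_range_succ, Finset.sum_congr rfl hwi, hwp, Finset.sum_const,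
        Finset.card_range, nsmul_eq_mul]
      field_simp
      rw [hn]
      push_cast
      ring)
    (fun i _ => by
      simp only [hz]
      split_ifs
      · exact h.inv_mem_punctured (hmk i)
      · exact h.inv_mem_punctured hml)
    (by
      rw [h.apply_inv hmn, Finset.sum_range_succ, hwp, hzp, h.apply_inv hml]
      have e : ∀ i ∈ Finset.range p, (w i : ℂ) * f (z i) =
          1 / (n : ℂ) * ∑ j ∈ Finset.range k, W (i * k + j) ω := by
        intro i hi
        rw [hwi i hi, hzi i hi, h.apply_inv (hmk i)]
        simp only [sampleMean]
        push_cast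
        field_simp
      rw [Finset.sum_congr rfl e, ← Finset.mul_sum]
      simp only [sampleMean]
      rw [hn, sum_range_blocks (fun j => W j ω) p k l, ← hn]
      push_cast
      field_simp)
  rw [Finset.sum_range_succ, hwp, hzp] at key
  rwa [Finset.sum_congr rfl fun i hi => by rw [hwi i hi, hzi i hi]] at key

variable [MeasurableSpace Ω] {P : Measure Ω} [IsProbabilityMeasure P]

theorem measurable_inv_sampleMean (h : IsConvexMap α U f) (hWm : ∀ i, Measurable (W i)) (n : ℕ) :
    Measurable fun ω => Function.invFunOn f U (sampleMean W n ω) :=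
  h.measurable_inv.comp (by
    unfold sampleMean
    fun_prop)

theorem integrable_norm_sq_of_rpow {M : Ω → ℂ} (hM : Measurable M) {ε B : ℝ} (hε : 0 < ε)
    (hi : Integrable (fun ω => ‖M ω‖ ^ (2 + ε)) P) (hB : ∫ ω, ‖M ω‖ ^ (2 + ε) ∂P ≤ B) :
    Integrable (fun ω => ‖M ω‖ ^ 2) P ∧ ∫ ω, ‖M ω‖ ^ 2 ∂P ≤ B + 1 := by
  have hpt : ∀ ω, ‖M ω‖ ^ 2 ≤ ‖M ω‖ ^ (2 + ε) + 1 := fun ω => by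
    have := sq_le_inv_rpow_mul_add (norm_nonneg (M ω)) one_pos hε
    simpa using this
  have hi1 : Integrable (fun ω => ‖M ω‖ ^ (2 + ε) + 1) P := hi.add (integrable_const 1)
  have hi2 : Integrable (fun ω => ‖M ω‖ ^ 2) P := hi1.mono' (by fun_prop)
    (Eventually.of_forall fun ω => by
      rw [Real.norm_of_nonneg (sq_nonneg _)]
      exact hpt ω)
  refine ⟨hi2, (integral_mono hi2 hi1 hpt).trans ?_⟩
  rw [integral_add hi (integrable_const 1)]
  simpa using hB

/-- With `V` the i.i.d. norms of block means and `L` that of the leftover block, `|M n|²` is at most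
a constant times `(1 + μ)² + (mean V - μ)² + (2k/n)² L²`. After multiplication by `n` and
restriction to `A n`, the terms vanish by `n P(A n) → 0`, by uniform integrability, and as `O(1/n)`.
-/
theorem tendsto_tail_of_hasMeanBound (h : IsConvexMap α U f) (hbd : HasMeanBound α f)
    (hWm : ∀ i, Measurable (W i)) (hind : iIndepFun W P)
    (hid : ∀ i, IdentDistrib (W i) (W 0) P P)
    (hWK : ∀ᵐ ω ∂P, ∀ j, W j ω ∈ f '' puncturedClosedHalfPlane α) {B : ℝ} {N : ℕ}
    (hB : ∀ n, N ≤ n →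
      Integrable (fun ω => ‖Function.invFunOn f U (sampleMean W n ω)‖ ^ 2) P ∧
      ∫ ω, ‖Function.invFunOn f U (sampleMean W n ω)‖ ^ 2 ∂P ≤ B)
    {A : ℕ → Set Ω} (hA : Tendsto (fun n : ℕ => (n : ℝ) * P.real (A n)) atTop (𝓝 0)) :
    Tendsto (fun n : ℕ => (n : ℝ) *
      ∫ ω in A n, ‖Function.invFunOn f U (sampleMean W n ω)‖ ^ 2 ∂P) atTop (𝓝 0) := by
  obtain ⟨C, hC0, hC⟩ := hbd
  set g := Function.invFunOn f U with hg
  set k := max N 1 with hk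
  have hk1 : 1 ≤ k := le_max_right _ _
  have hkN : N ≤ k := le_max_left _ _
  set V : ℕ → Ω → ℝ := fun i ω => ‖g (sampleMean (fun j => W (i * k + j)) k ω)‖ with hV
  have hVdist : ∀ i, IdentDistrib (V i) (fun ω => ‖g (sampleMean W k ω)‖) P P := fun i =>
    (h.identDistrib_inv_sampleMean_shift hind hid (i * k) k).comp measurable_norm
  have hVid : ∀ i, IdentDistrib (V i) (V 0) P P := fun i => (hVdist i).trans (hVdist 0).symm
  have hVind : iIndepFun V P := (h.iIndepFun_inv_sampleMean_blocks hWm hind k).comp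
    (fun _ w => ‖w‖) fun _ => measurable_norm
  have hVL2 : MemLp (V 0) 2 P := by
    rw [(hVdist 0).memLp_iff, memLp_two_iff_integrable_sq
      (h.measurable_inv_sampleMean hWm k).norm.aestronglyMeasurable]
    exact (hB k hkN).1
  set μ := ∫ ω, V 0 ω ∂P with hμ
  have hμ0 : 0 ≤ μ := integral_nonneg fun ω => norm_nonneg _
  set L : ℕ → ℕ → Ω → ℝ := fun p l ω => ‖g (sampleMean (fun j => W (p * k + j)) l ω)‖ with hL
  have hLdist : ∀ p l, IdentDistrib (fun ω => L p l ω ^ 2)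
      (fun ω => ‖g (sampleMean W l ω)‖ ^ 2) P P := fun p l =>
    (h.identDistrib_inv_sampleMean_shift hind hid (p * k) l).comp (measurable_norm.pow_const 2)
  have hpt : ∀ p l, 1 ≤ p → 1 ≤ l → l ≤ 2 * k → ∀ᵐ ω ∂P, ‖g (sampleMean W (p * k + l) ω)‖ ^ 2 ≤
      3 * C ^ 2 * ((1 + μ) ^ 2 + ((sampleMean V p ω - μ) ^ 2 +
        (2 * k / (p * k + l : ℕ)) ^ 2 * L p l ω ^ 2)) := by
    intro p l hp hl hl2
    filter_upwards [hWK] with ω hω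
    have h1 := h.norm_inv_sampleMean_le hC hω (p := p) hk1 hl
    set n := p * k + l with hn
    have hn0 : (0 : ℝ) < n := by
      have : 1 ≤ n := by lia
      positivity
    have hl2' : (l : ℝ) ≤ 2 * k := by exact_mod_cast hl2
    have hL0 : 0 ≤ L p l ω := norm_nonneg _
    have h2 : ∑ i ∈ Finset.range p, (k : ℝ) / n * V i ω ≤ sampleMean V p ω := by
      rw [← Finset.mul_sum]
      simp only [sampleMean]
      refine mul_le_mul_of_nonneg_right ?_ (Finset.sum_nonneg fun i _ => norm_nonneg _)
      rw [div_le_div_iff₀ hn0 (by exact_mod_cast hp), hn]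
      push_cast
      have : (0 : ℝ) ≤ l := Nat.cast_nonneg l
      linarith
    have h3 : (l : ℝ) / n * L p l ω ≤ 2 * k / n * L p l ω := by gcongr
    set b := 2 * (k : ℝ) / n * L p l ω with hb
    have hb0 : 0 ≤ b := by positivity
    have h4 : ‖g (sampleMean W n ω)‖ ≤ C * ((1 + μ) + |sampleMean V p ω - μ| + b) := by
      refine h1.trans (mul_le_mul_of_nonneg_left ?_ hC0)
      have := le_abs_self (sampleMean V p ω - μ)
      linarith
    have h5 : ‖g (sampleMean W n ω)‖ ^ 2 ≤ (C * ((1 + μ) + |sampleMean V p ω - μ| + b)) ^ 2 := by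
      gcongr
    refine h5.trans ?_
    rw [mul_pow, ← mul_pow (2 * (k : ℝ) / n), ← hb, ← sq_abs (sampleMean V p ω - μ),
      mul_comm (3 : ℝ), mul_assoc]
    refine mul_le_mul_of_nonneg_left ?_ (sq_nonneg C)
    set a := |sampleMean V p ω - μ|
    nlinarith [sq_nonneg (1 + μ - a), sq_nonneg (1 + μ - b), sq_nonneg (a - b)]
  have hLi : ∀ p l, k ≤ l → Integrable (fun ω => L p l ω ^ 2) P ∧ ∫ ω, L p l ω ^ 2 ∂P ≤ B := by
    intro p l hl
    rw [(hLdist p l).integral_eq, (hLdist p l).integrable_iff]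
    exact hB l (hkN.trans hl)
  have hint : ∀ (p l : ℕ) (S : Set Ω), 1 ≤ p → k ≤ l → l ≤ 2 * k →
      ∫ ω in S, ‖g (sampleMean W (p * k + l) ω)‖ ^ 2 ∂P ≤
      3 * C ^ 2 * ((1 + μ) ^ 2 * P.real S + (∫ ω in S, (sampleMean V p ω - μ) ^ 2 ∂P +
        (2 * k / (p * k + l : ℕ)) ^ 2 * B)) := by
    intro p l S hp hl hl2
    set r : ℝ := (2 * k / (p * k + l : ℕ)) ^ 2 with hr
    obtain ⟨hL1, hL2⟩ := hLi p l hl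
    have i1 := integrable_sampleMean_sub_sq hVL2 hVid p μ
    have i2 : Integrable (fun ω => r * L p l ω ^ 2) P := hL1.const_mul _
    have i3 : Integrable (fun ω => (sampleMean V p ω - μ) ^ 2 + r * L p l ω ^ 2) P := i1.add i2
    have i4 : Integrable (fun ω => (1 + μ) ^ 2 + ((sampleMean V p ω - μ) ^ 2 +
      r * L p l ω ^ 2)) P := (integrable_const _).add i3
    have h1 := integral_mono_of_nonneg (μ := P.restrict S)
      (Eventually.of_forall fun _ => sq_nonneg _) (i4.const_mul (3 * C ^ 2)).integrableOn
      (ae_restrict_of_ae (hpt p l hp (hk1.trans hl) hl2))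
    rw [integral_const_mul, integral_add (integrable_const _).integrableOn i3.integrableOn,
      integral_add i1.integrableOn i2.integrableOn, setIntegral_const, smul_eq_mul,
      mul_comm (P.real S), integral_const_mul] at h1
    refine h1.trans ?_
    gcongr
    exact (setIntegral_le_integral hL1 (Eventually.of_forall fun _ => sq_nonneg _)).trans hL2
  have hB0 : 0 ≤ B := (integral_nonneg fun ω => sq_nonneg _).trans (hB N le_rfl).2
  -- One full block is withheld, so that the leftover length `k + n % k` is at least `N` and its
  -- second moment is bounded by `B` too.
  have hdiv : Tendsto (fun n : ℕ => n / k - 1) atTop atTop :=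
    (tendsto_sub_atTop_nat 1).comp (Nat.tendsto_div_const_atTop (by lia))
  have hA0 : Tendsto (fun n => P.real (A n)) atTop (𝓝 0) := by
    refine squeeze_zero' (Eventually.of_forall fun _ => measureReal_nonneg) ?_ hA
    filter_upwards [eventually_ge_atTop 1] with n hn
    have : (1 : ℝ) ≤ n := by exact_mod_cast hn
    nlinarith [measureReal_nonneg (μ := P) (s := A n)]
  have l1 := hA.const_mul ((1 + μ) ^ 2)
  have l2 := (tendsto_mul_setIntegral_sq hVL2 hVind hVid hdiv hA0).const_mul (3 * (k : ℝ))
  have l3 := (tendsto_inv_atTop_nhds_zero_nat (𝕜 := ℝ)).const_mul (4 * (k : ℝ) ^ 2 * B)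
  have l4 := (l1.add (l2.add l3)).const_mul (3 * C ^ 2)
  simp only [mul_zero, add_zero] at l4
  refine squeeze_zero' (Eventually.of_forall fun n =>
    mul_nonneg (Nat.cast_nonneg _) (integral_nonneg fun _ => sq_nonneg _)) ?_ l4
  filter_upwards [eventually_ge_atTop (2 * k)] with n hn
  set p := n / k - 1 with hp
  have hk0 : 0 < k := hk1
  have hd : 2 ≤ n / k := (Nat.le_div_iff_mul_le hk0).2 hn
  have hp1 : 1 ≤ p := by lia
  have hmod := Nat.mod_lt n hk0
  have hn' : p * k + (k + n % k) = n := by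
    have h1 := Nat.div_add_mod n k
    have h2 : n / k = p + 1 := by lia
    rw [h2] at h1
    linarith
  have h1 := hint p (k + n % k) (A n) hp1 (by lia) (by lia)
  rw [hn'] at h1
  have hn0 : (0 : ℝ) < n := by
    have : 1 ≤ n := by lia
    positivity
  have h3 : (n : ℝ) ≤ 3 * k * p := by
    have h4 : n ≤ 3 * (p * k) := by
      have : k ≤ p * k := Nat.le_mul_of_pos_left k hp1
      lia
    have h5 : (n : ℝ) ≤ 3 * (p * k) := by exact_mod_cast h4
    linarith
  have h6 : (n : ℝ) * ∫ ω in A n, (sampleMean V p ω - μ) ^ 2 ∂P ≤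
      3 * k * (p * ∫ ω in A n, (sampleMean V p ω - μ) ^ 2 ∂P) := by
    rw [← mul_assoc]
    exact mul_le_mul_of_nonneg_right h3 (integral_nonneg fun _ => sq_nonneg _)
  have h7 : (n : ℝ) * ((2 * k / n) ^ 2 * B) = 4 * (k : ℝ) ^ 2 * B * (n : ℝ)⁻¹ := by
    field_simp
    ring
  calc (n : ℝ) * ∫ ω in A n, ‖g (sampleMean W n ω)‖ ^ 2 ∂P
      ≤ n * (3 * C ^ 2 * ((1 + μ) ^ 2 * P.real (A n) +
        (∫ ω in A n, (sampleMean V p ω - μ) ^ 2 ∂P + (2 * k / n) ^ 2 * B))) := by gcongr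
    _ = 3 * C ^ 2 * ((1 + μ) ^ 2 * (n * P.real (A n)) +
        (n * ∫ ω in A n, (sampleMean V p ω - μ) ^ 2 ∂P + n * ((2 * k / n) ^ 2 * B))) := by ring
    _ ≤ _ := by
        rw [h7]
        gcongr

end IsConvexMap

/-! ### Moments and perturbation of the variance -/

section Variance

variable {Ω : Type*} [MeasurableSpace Ω] {P : Measure Ω}

theorem exists_integrable_norm_rpow_of_limsup_lt {M : ℕ → Ω → ℂ} (hM : ∀ n, Measurable (M n))
    {p : ℝ} (hp : 0 ≤ p) (h : limsup (fun n : ℕ => ∫⁻ ω, ‖M n ω‖ₑ ^ p ∂P) atTop < ∞) :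
    ∃ (B : ℝ) (N : ℕ), ∀ n, N ≤ n →
      Integrable (fun ω => ‖M n ω‖ ^ p) P ∧ ∫ ω, ‖M n ω‖ ^ p ∂P ≤ B := by
  obtain ⟨b, hb1, hb2⟩ := exists_between h
  obtain ⟨N, hN⟩ := eventually_atTop.1 (eventually_lt_of_limsup_lt hb1)
  have he : ∀ n ω, ENNReal.ofReal (‖M n ω‖ ^ p) = ‖M n ω‖ₑ ^ p := fun n ω => by
    rw [← ENNReal.ofReal_rpow_of_nonneg (norm_nonneg _) hp, ofReal_norm]
  refine ⟨b.toReal, N, fun n hn => ?_⟩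
  have h0 : ∀ ω, 0 ≤ ‖M n ω‖ ^ p := fun ω => Real.rpow_nonneg (norm_nonneg _) _
  have hm : Measurable fun ω => ‖M n ω‖ ^ p := (hM n).norm.pow_const p
  have h1 := hN n hn
  constructor
  · refine ⟨hm.aestronglyMeasurable, ?_⟩
    rw [hasFiniteIntegral_iff_ofReal (Eventually.of_forall h0)]
    simp only [he]
    exact h1.trans hb2
  · rw [integral_eq_lintegral_of_nonneg_ae (Eventually.of_forall h0) hm.aestronglyMeasurable]
    simp only [he]
    exact ENNReal.toReal_mono hb2.ne h1.le

variable [IsProbabilityMeasure P]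

theorem sq_integral_le_integral_sq {T : Ω → ℝ} (hT : MemLp T 2 P) :
    (∫ ω, T ω ∂P) ^ 2 ≤ ∫ ω, T ω ^ 2 ∂P := by
  have h1 := variance_nonneg T P
  rw [variance_eq_sub hT] at h1
  exact sub_nonneg.1 h1

theorem integral_norm_sub_mean_sq_le {R : Ω → ℂ} (hR : MemLp R 2 P) :
    ∫ ω, ‖R ω - ∫ ω', R ω' ∂P‖ ^ 2 ∂P ≤ 4 * ∫ ω, ‖R ω‖ ^ 2 ∂P := by
  set c := ∫ ω', R ω' ∂P with hc
  have i1 : Integrable (fun ω => ‖R ω - c‖ ^ 2) P :=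
    (hR.sub (memLp_const c)).integrable_norm_pow (by simp)
  have i2 : Integrable (fun ω => ‖R ω‖ ^ 2) P := hR.integrable_norm_pow (by simp)
  have h1 : ‖c‖ ^ 2 ≤ ∫ ω, ‖R ω‖ ^ 2 ∂P :=
    (pow_le_pow_left₀ (norm_nonneg _) (norm_integral_le_integral_norm R) 2).trans
      (sq_integral_le_integral_sq hR.norm)
  have i3 : Integrable (fun ω => 2 * ‖R ω‖ ^ 2 + 2 * ‖c‖ ^ 2) P :=
    (i2.const_mul 2).add (integrable_const _)
  have h2 := integral_mono i1 i3 fun ω => by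
    have h3 : ‖R ω - c‖ ^ 2 ≤ (‖R ω‖ + ‖c‖) ^ 2 :=
      pow_le_pow_left₀ (norm_nonneg _) (norm_sub_le _ _) 2
    nlinarith [sq_nonneg (‖R ω‖ - ‖c‖)]
  rw [integral_add (i2.const_mul 2) (integrable_const _), integral_const_mul, integral_const,
    probReal_univ, one_smul] at h2
  linarith

/-- The cross term is split by `2 y q ≤ θ y² + θ⁻¹ q²`, so `θ` can be fixed before `n → ∞`; the `4`
pays for centring `R`. -/
theorem abs_complexVariance_sub_le {Y R : Ω → ℂ} (b : ℂ) (hY : MemLp Y 2 P) (hR : MemLp R 2 P)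
    (hY0 : ∫ ω, Y ω ∂P = 0) {θ : ℝ} (hθ : 0 < θ) :
    |complexVariance (fun ω => b + Y ω + R ω) P - ∫ ω, ‖Y ω‖ ^ 2 ∂P| ≤
      θ * ∫ ω, ‖Y ω‖ ^ 2 ∂P + 4 * (1 + θ⁻¹) * ∫ ω, ‖R ω‖ ^ 2 ∂P := by
  have hYi := hY.integrable one_le_two
  have hRi := hR.integrable one_le_two
  have hmean : ∫ ω, (b + Y ω + R ω) ∂P = b + ∫ ω, R ω ∂P := by
    have i0 : Integrable (fun ω => b + Y ω) P := (integrable_const b).add hYi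
    rw [integral_add i0 hRi, integral_add (integrable_const b) hYi, hY0]
    simp
  set c := ∫ ω, R ω ∂P with hc
  have e : complexVariance (fun ω => b + Y ω + R ω) P = ∫ ω, ‖Y ω + (R ω - c)‖ ^ 2 ∂P := by
    rw [complexVariance, hmean]
    congr 1 with ω
    congr 2
    ring
  have hQ : MemLp (fun ω => R ω - c) 2 P := hR.sub (memLp_const c)
  have i1 : Integrable (fun ω => ‖Y ω + (R ω - c)‖ ^ 2) P :=
    (hY.add hQ).integrable_norm_pow (by simp)
  have i2 : Integrable (fun ω => ‖Y ω‖ ^ 2) P := hY.integrable_norm_pow (by simp)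
  have i3 : Integrable (fun ω => ‖R ω - c‖ ^ 2) P := hQ.integrable_norm_pow (by simp)
  have i4 : Integrable (fun ω => θ * ‖Y ω‖ ^ 2 + (1 + θ⁻¹) * ‖R ω - c‖ ^ 2) P :=
    (i2.const_mul θ).add (i3.const_mul _)
  rw [e, ← integral_sub i1 i2]
  have hpt : ∀ ω, |‖Y ω + (R ω - c)‖ ^ 2 - ‖Y ω‖ ^ 2| ≤
      θ * ‖Y ω‖ ^ 2 + (1 + θ⁻¹) * ‖R ω - c‖ ^ 2 := by
    intro ω
    set y := ‖Y ω‖ with hy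
    set q := ‖R ω - c‖ with hq
    have hy0 : 0 ≤ y := norm_nonneg _
    have hq0 : 0 ≤ q := norm_nonneg _
    have h1 : ‖Y ω + (R ω - c)‖ ≤ y + q := norm_add_le _ _
    have h2 : y ≤ ‖Y ω + (R ω - c)‖ + q := by
      have := norm_sub_le (Y ω + (R ω - c)) (R ω - c)
      rwa [add_sub_cancel_right] at this
    have h3 : 2 * y * q ≤ θ * y ^ 2 + θ⁻¹ * q ^ 2 := by
      have h4 : 0 ≤ θ⁻¹ * (θ * y - q) ^ 2 := by positivity
      have h5 : θ⁻¹ * (θ * y - q) ^ 2 = θ * y ^ 2 + θ⁻¹ * q ^ 2 - 2 * y * q := by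
        field_simp
        ring
      linarith
    have h0 := norm_nonneg (Y ω + (R ω - c))
    rw [abs_le]
    constructor
    · nlinarith
    · nlinarith
  refine (abs_integral_le_integral_abs).trans ((integral_mono (i1.sub i2).abs i4 hpt).trans ?_)
  rw [integral_add (i2.const_mul θ) (i3.const_mul _), integral_const_mul, integral_const_mul]
  have h6 := mul_le_mul_of_nonneg_left (integral_norm_sub_mean_sq_le hR)
    (show 0 ≤ 1 + θ⁻¹ by positivity)
  linarith

end Variance

namespace IsConvexMap

variable {α : ℂ} {U : Set ℂ} {f : ℂ → ℂ} {Ω : Type*} [MeasurableSpace Ω] {P : Measure Ω}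
  [IsProbabilityMeasure P] {W : ℕ → Ω → ℂ}

theorem tendsto_tail (h : IsConvexMap α U f) (hWm : ∀ i, Measurable (W i)) (hW : MemLp (W 0) 2 P)
    (hind : iIndepFun W P) (hid : ∀ i, IdentDistrib (W i) (W 0) P P)
    (hWK : ∀ᵐ ω ∂P, ∀ j, W j ω ∈ f '' puncturedClosedHalfPlane α) {ε B : ℝ} {N : ℕ} (hε : 0 < ε)
    (hB : ∀ n, N ≤ n →
      Integrable (fun ω => ‖Function.invFunOn f U (sampleMean W n ω)‖ ^ (2 + ε)) P ∧
      ∫ ω, ‖Function.invFunOn f U (sampleMean W n ω)‖ ^ (2 + ε) ∂P ≤ B)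
    {A : ℕ → Set Ω} (hA : Tendsto (fun n : ℕ => (n : ℝ) * P.real (A n)) atTop (𝓝 0)) :
    Tendsto (fun n : ℕ => (n : ℝ) *
      ∫ ω in A n, ‖Function.invFunOn f U (sampleMean W n ω)‖ ^ 2 ∂P) atTop (𝓝 0) := by
  rcases h.tendsto_or_hasMeanBound with ⟨c, hc, hlim⟩ | hbd
  · exact h.tendsto_tail_of_limit hc hlim hWm hW hind hid hWK hε hB hA
  · exact h.tendsto_tail_of_hasMeanBound hbd hWm hind hid hWK (fun n hn =>
      integrable_norm_sq_of_rpow (h.measurable_inv_sampleMean hWm n) hε (hB n hn).1 (hB n hn).2) hA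

end IsConvexMap

/-! ### The delta method -/

section Delta

variable {Ω : Type*} [MeasurableSpace Ω] {P : Measure Ω} [IsProbabilityMeasure P] {W : ℕ → Ω → ℂ}

/-- The remainder in the first order expansion of a function of the sample mean is negligible in
mean square, provided the tails of the function of the sample mean are. -/
theorem tendsto_mul_integral_remainder_sq {g : ℂ → ℂ} {a : ℂ}
    (hWm : ∀ i, Measurable (W i)) (hW : MemLp (W 0) 2 P) (hind : iIndepFun W P)
    (hid : ∀ i, IdentDistrib (W i) (W 0) P P) (hg : HasDerivAt g a (∫ ω, W 0 ω ∂P))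
    (hL2 : ∀ᶠ n in atTop, MemLp (fun ω => g (sampleMean W n ω)) 2 P)
    (htail : ∀ A : ℕ → Set Ω, Tendsto (fun n : ℕ => (n : ℝ) * P.real (A n)) atTop (𝓝 0) →
      Tendsto (fun n : ℕ => (n : ℝ) * ∫ ω in A n, ‖g (sampleMean W n ω)‖ ^ 2 ∂P) atTop (𝓝 0)) :
    Tendsto (fun n : ℕ => (n : ℝ) * ∫ ω, ‖g (sampleMean W n ω) - g (∫ ω, W 0 ω ∂P) -
      a * (sampleMean W n ω - ∫ ω, W 0 ω ∂P)‖ ^ 2 ∂P) atTop (𝓝 0) := by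
  set m := ∫ ω, W 0 ω ∂P with hm
  set v := ∫ ω, ‖W 0 ω - m‖ ^ 2 ∂P with hv
  have hv0 : 0 ≤ v := integral_nonneg fun _ => sq_nonneg _
  have hSm : ∀ n, Measurable (sampleMean W n) := fun n => by
    unfold sampleMean
    fun_prop
  rw [Metric.tendsto_atTop']
  intro ε hε
  -- Within `δ` of `m` the remainder is at most `η |S n - m|`, whose normalized second moment is `η²
  -- v < ε`.
  set η := Real.sqrt (ε / (2 * (v + 1))) with hη
  have hη0 : 0 < η := Real.sqrt_pos.2 (by positivity)
  have hη2 : η ^ 2 * v < ε := by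
    rw [hη, Real.sq_sqrt (by positivity), div_mul_eq_mul_div, div_lt_iff₀ (by positivity)]
    nlinarith
  obtain ⟨δ, hδ, hloc⟩ := Metric.eventually_nhds_iff.1
    ((hasDerivAt_iff_isLittleO.1 hg).def hη0)
  set A : ℕ → Set Ω := fun n => {ω | δ ≤ ‖sampleMean W n ω - m‖} with hA
  have hAm : ∀ n, MeasurableSet (A n) := fun n =>
    measurableSet_le measurable_const ((hSm n).sub_const m).norm
  have hAlim := tendsto_mul_measureReal_deviation hW hWm hind hid hδ
  have hAlim0 := tendsto_measureReal_deviation hW hind hid hδ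
  have l1 := htail A hAlim
  have l2 := tendsto_mul_setIntegral_norm_sq hW hind hid hAlim0
  have l3 := ((l1.add ((hAlim.const_mul (‖g m‖ ^ 2)).add
    (l2.const_mul (‖a‖ ^ 2)))).const_mul 3).const_add (η ^ 2 * v)
  simp only [mul_zero, add_zero] at l3
  have hpt : ∀ n ω, ‖g (sampleMean W n ω) - g m - a * (sampleMean W n ω - m)‖ ^ 2 ≤
      η ^ 2 * ‖sampleMean W n ω - m‖ ^ 2 + (A n).indicator (fun ω =>
        3 * (‖g (sampleMean W n ω)‖ ^ 2 + (‖g m‖ ^ 2 + ‖a‖ ^ 2 * ‖sampleMean W n ω - m‖ ^ 2))) ω := by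
    intro n ω
    by_cases hω : ω ∈ A n
    · rw [Set.indicator_of_mem hω]
      have h1 : ‖g (sampleMean W n ω) - g m - a * (sampleMean W n ω - m)‖ ≤
          ‖g (sampleMean W n ω)‖ + ‖g m‖ + ‖a‖ * ‖sampleMean W n ω - m‖ := by
        refine (norm_sub_le _ _).trans ?_
        rw [norm_mul]
        gcongr
        exact norm_sub_le _ _
      have h2 := pow_le_pow_left₀ (norm_nonneg _) h1 2
      rw [← mul_pow]
      set x := ‖g (sampleMean W n ω)‖
      set y := ‖g m‖
      set z := ‖a‖ * ‖sampleMean W n ω - m‖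
      nlinarith [sq_nonneg (x - y), sq_nonneg (x - z), sq_nonneg (y - z),
        mul_nonneg (sq_nonneg η) (sq_nonneg ‖sampleMean W n ω - m‖)]
    · rw [Set.indicator_of_notMem hω, add_zero, ← mul_pow]
      have hω' : dist (sampleMean W n ω) m < δ := by
        rw [dist_eq_norm]
        exact not_le.1 hω
      have h1 := hloc hω'
      rw [smul_eq_mul, mul_comm _ a] at h1
      exact pow_le_pow_left₀ (norm_nonneg _) h1 2
  have hev := l3.eventually_lt_const hη2
  obtain ⟨n₀, hn₀⟩ := eventually_atTop.1 (hev.and (hL2.and (eventually_ge_atTop 1)))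
  refine ⟨n₀, fun n hn => ?_⟩
  obtain ⟨h1, h2, h3⟩ := hn₀ n hn.le
  rw [Real.dist_eq, sub_zero, abs_of_nonneg
    (mul_nonneg (Nat.cast_nonneg _) (integral_nonneg fun _ => sq_nonneg _))]
  refine lt_of_le_of_lt ?_ h1
  have iS : Integrable (fun ω => ‖sampleMean W n ω - m‖ ^ 2) P :=
    ((memLp_sampleMean_complex hW hid n).sub (memLp_const m)).integrable_norm_pow (by simp)
  have iM : Integrable (fun ω => ‖g (sampleMean W n ω)‖ ^ 2) P := h2.integrable_norm_pow (by simp)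
  have i5 : Integrable (fun ω => ‖a‖ ^ 2 * ‖sampleMean W n ω - m‖ ^ 2) P := iS.const_mul _
  have i6 : Integrable (fun ω => ‖g m‖ ^ 2 + ‖a‖ ^ 2 * ‖sampleMean W n ω - m‖ ^ 2) P :=
    (integrable_const _).add i5
  have i7 : Integrable (fun ω => ‖g (sampleMean W n ω)‖ ^ 2 +
      (‖g m‖ ^ 2 + ‖a‖ ^ 2 * ‖sampleMean W n ω - m‖ ^ 2)) P := iM.add i6
  have i8 : Integrable ((A n).indicator fun ω => 3 * (‖g (sampleMean W n ω)‖ ^ 2 +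
      (‖g m‖ ^ 2 + ‖a‖ ^ 2 * ‖sampleMean W n ω - m‖ ^ 2))) P :=
    (i7.const_mul 3).indicator (hAm n)
  have h4 := integral_mono_of_nonneg (Eventually.of_forall fun _ => sq_nonneg _)
    ((iS.const_mul (η ^ 2)).add i8) (Eventually.of_forall (hpt n))
  have h5 := h4.trans_eq (integral_add (iS.const_mul (η ^ 2)) i8)
  rw [integral_indicator (hAm n), integral_const_mul, integral_const_mul,
    integral_add iM.integrableOn i6.integrableOn,
    integral_add (integrable_const _).integrableOn i5.integrableOn, setIntegral_const,
    smul_eq_mul, mul_comm (P.real _), integral_const_mul] at h5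
  have h6 := mul_integral_norm_sub_sq hW hind hid h3
  have h7 := mul_le_mul_of_nonneg_left h5 (Nat.cast_nonneg (α := ℝ) n)
  refine h7.trans_eq ?_
  rw [hv, ← h6]
  ring

/-- The delta method for variances. -/
theorem tendsto_mul_complexVariance {g : ℂ → ℂ} {a : ℂ}
    (hWm : ∀ i, Measurable (W i)) (hW : MemLp (W 0) 2 P) (hind : iIndepFun W P)
    (hid : ∀ i, IdentDistrib (W i) (W 0) P P) (hg : HasDerivAt g a (∫ ω, W 0 ω ∂P))
    (hL2 : ∀ᶠ n in atTop, MemLp (fun ω => g (sampleMean W n ω)) 2 P)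
    (htail : ∀ A : ℕ → Set Ω, Tendsto (fun n : ℕ => (n : ℝ) * P.real (A n)) atTop (𝓝 0) →
      Tendsto (fun n : ℕ => (n : ℝ) * ∫ ω in A n, ‖g (sampleMean W n ω)‖ ^ 2 ∂P) atTop (𝓝 0)) :
    Tendsto (fun n : ℕ => (n : ℝ) * complexVariance (fun ω => g (sampleMean W n ω)) P) atTop
      (𝓝 (‖a‖ ^ 2 * complexVariance (W 0) P)) := by
  have hrem := tendsto_mul_integral_remainder_sq hWm hW hind hid hg hL2 htail
  set m := ∫ ω, W 0 ω ∂P with hm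
  set s := ‖a‖ ^ 2 * complexVariance (W 0) P with hs
  have hs0 : 0 ≤ s := mul_nonneg (sq_nonneg _) (integral_nonneg fun _ => sq_nonneg _)
  rw [Metric.tendsto_atTop']
  intro ε hε
  -- With `θ` fixed, `θ s < ε` bounds the share of the linear term; the remainder's share tends to
  -- `0`.
  set θ := ε / (2 * (s + 1)) with hθ
  have hθ0 : 0 < θ := by positivity
  have hθs : θ * s < ε := by
    rw [hθ, div_mul_eq_mul_div, div_lt_iff₀ (by positivity)]
    nlinarith
  have l1 := (hrem.const_mul (4 * (1 + θ⁻¹))).const_add (θ * s)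
  rw [mul_zero, add_zero] at l1
  obtain ⟨n₀, hn₀⟩ := eventually_atTop.1
    ((l1.eventually_lt_const hθs).and (hL2.and (eventually_ge_atTop 1)))
  refine ⟨n₀, fun n hn => ?_⟩
  obtain ⟨h1, h2, h3⟩ := hn₀ n hn.le
  set Y : Ω → ℂ := fun ω => a * (sampleMean W n ω - m) with hY
  set R : Ω → ℂ := fun ω => g (sampleMean W n ω) - g m - a * (sampleMean W n ω - m) with hR
  have hS := memLp_sampleMean_complex hW hid n
  have hYL : MemLp Y 2 P := (hS.sub (memLp_const m)).const_mul a
  have hRL : MemLp R 2 P := (h2.sub (memLp_const _)).sub hYL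
  have hY0 : ∫ ω, Y ω ∂P = 0 := by
    simp only [hY]
    rw [integral_const_mul, integral_sub (hS.integrable one_le_two) (integrable_const m),
      integral_sampleMean_complex hW hid h3]
    simp [hm]
  have hYn : (n : ℝ) * ∫ ω, ‖Y ω‖ ^ 2 ∂P = s := by
    simp only [hY, norm_mul, mul_pow]
    rw [integral_const_mul, mul_left_comm, mul_integral_norm_sub_sq hW hind hid h3]
    rfl
  have e : (fun ω => g (sampleMean W n ω)) = fun ω => g m + Y ω + R ω := by
    ext ω
    simp only [hY, hR]
    ring
  have h4 := abs_complexVariance_sub_le (g m) hYL hRL hY0 hθ0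
  rw [← e] at h4
  have hn0 : (0 : ℝ) ≤ n := Nat.cast_nonneg n
  have h5 := mul_le_mul_of_nonneg_left h4 hn0
  rw [Real.dist_eq, ← hYn, ← mul_sub, abs_mul, abs_of_nonneg hn0]
  refine h5.trans_lt (lt_of_eq_of_lt ?_ h1)
  rw [← hYn]
  ring

end Delta

/-! ### The variance asymptotics -/

theorem mainTheorem1 {Ω : Type*} [MeasurableSpace Ω] (P : Measure Ω) [IsProbabilityMeasure P]
    (α : ℂ) (U : Set ℂ) (f : ℂ → ℂ) (hf : IsGenerator α U f)
    (X : ℕ → Ω → ℝ) (hX_meas : ∀ i, Measurable (X i)) (hX_indep : iIndepFun X P)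
    (hX_ident : ∀ i, IdentDistrib (X i) (X 0) P P)
    (hX_cont : ∀ x : ℝ, P {ω | X 0 ω = x} = 0)
    (h_sq : MemLp (fun ω => f (X 0 ω : ℂ)) 2 P)
    (h_ne : ∫ ω, f (X 0 ω : ℂ) ∂P ≠ 0)
    (ε₀ : ℝ) (hε₀ : 0 < ε₀)
    (h_limsup : limsup
      (fun n : ℕ => ∫⁻ ω, ‖quasiArithmeticMean f U X n ω‖ₑ ^ (2 + ε₀) ∂P) atTop < ∞) :
    (∫ ω, f (X 0 ω : ℂ) ∂P) ∈ f '' puncturedClosedHalfPlane α ∧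
    deriv f (Function.invFunOn f U (∫ ω, f (X 0 ω : ℂ) ∂P)) ≠ 0 ∧
    (∀ᶠ n : ℕ in atTop, MemLp (quasiArithmeticMean f U X n) 2 P) ∧
    Tendsto (fun n : ℕ => (n : ℝ) * complexVariance (quasiArithmeticMean f U X n) P) atTop
      (𝓝 (complexVariance (fun ω => f (X 0 ω : ℂ)) P /
        ‖deriv f (Function.invFunOn f U (∫ ω, f (X 0 ω : ℂ) ∂P))‖ ^ 2)) := by
  have h := hf.isConvexMap
  set W : ℕ → Ω → ℂ := fun j ω => f (X j ω : ℂ) with hW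
  have hWm : ∀ i, Measurable (W i) := fun i => h.measurable_comp_ofReal.comp (hX_meas i)
  have hWind : iIndepFun W P :=
    hX_indep.comp (fun _ (x : ℝ) => f x) fun _ => h.measurable_comp_ofReal
  have hWid : ∀ i, IdentDistrib (W i) (W 0) P P := fun i =>
    (hX_ident i).comp h.measurable_comp_ofReal
  have hWK : ∀ᵐ ω ∂P, ∀ j, W j ω ∈ f '' puncturedClosedHalfPlane α := by
    refine ae_all_iff.2 fun j => ?_
    -- Excluding the single real value `α.re` ensures `X j ≠ α` whether or not `α` is real.
    have h0 : ∀ᵐ ω ∂P, X 0 ω ∈ ({α.re}ᶜ : Set ℝ) := hX_cont α.re |> fun h => by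
      rw [ae_iff]
      simpa using h
    filter_upwards [(hX_ident j).symm.ae_mem_snd (measurableSet_singleton _).compl h0] with ω hω
    refine Set.mem_image_of_mem f (IsConvexMap.ofReal_mem _ fun hα => hω ?_)
    rw [Set.mem_singleton_iff, ← hα, Complex.ofReal_re]
  have hM : ∀ n, quasiArithmeticMean f U X n =
      fun ω => Function.invFunOn f U (sampleMean W n ω) := fun n => rfl
  have hmem : ∫ ω, W 0 ω ∂P ∈ f '' puncturedClosedHalfPlane α :=
    integral_mem_of_ae_mem h.convex_image h.isOpen_image_upperHalf h.convex_image_upperHalf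
      h.image_upperHalf_subset h.image_subset_closure (h_sq.integrable one_le_two)
      (hWK.mono fun ω hω => hω 0)
  have hz₀ := h.subset (h.inv_mem_punctured hmem)
  have hderiv := h.hasDerivAt_inv hz₀
  rw [h.apply_inv hmem] at hderiv
  obtain ⟨B, N, hB⟩ := exists_integrable_norm_rpow_of_limsup_lt
    (M := fun n ω => Function.invFunOn f U (sampleMean W n ω))
    (h.measurable_inv_sampleMean hWm) (by linarith) h_limsup
  have hL2 : ∀ᶠ n : ℕ in atTop,
      MemLp (fun ω => Function.invFunOn f U (sampleMean W n ω)) 2 P := by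
    filter_upwards [eventually_ge_atTop N] with n hn
    have hm := h.measurable_inv_sampleMean hWm n
    exact (memLp_two_iff_integrable_sq_norm hm.aestronglyMeasurable).2
      (IsConvexMap.integrable_norm_sq_of_rpow hm hε₀ (hB n hn).1 (hB n hn).2).1
  refine ⟨hmem, h.deriv_ne_zero hz₀, hL2, ?_⟩
  have hlim := tendsto_mul_complexVariance hWm h_sq hWind hWid hderiv hL2
    fun A hA => h.tendsto_tail hWm h_sq hWind hWid hWK hε₀ hB hA
  rw [norm_inv, inv_pow, inv_mul_eq_div] at hlim
  exact hlim
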